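/- Let $n\in\{2,3\}$ and write points of $\mathbb R^n$ as $x=(\tilde x,x_n)$. Let $\Gamma$ be a non-empty, bounded, relatively open subset (no regularity assumed) of the hyperplane $\Gamma_\infty=\{x\in\mathbb R^n: x_n=0\}$, which is identified with $\mathbb R^{n-1}$; put $L:=\operatorname{diam}\Gamma$, let $k>0$, and let $$\Phi(x,y)=\frac{e^{ik|x-y|}}{4\pi|x-y|}\ (n=3),\qquad \Phi(x,y)=\frac i4H^{(1)}_0(k|x-y|)\ (n=2).$$ With $\hat u(\xi)=(2\pi)^{-(n-1)/2}\int_{\mathbb R^{n-1}}e^{-i\xi\cdot x}u(x)\,dx$, let $H^s(\mathbb R^{n-1})$ be the space of tempered distributions $u$ with $\hat u$ locally integrable and $\|u\|_{H^s_k}^2:=\int(k^2+|\xi|^2)^s|\hat u(\xi)|^2\,d\xi<\infty$. Let $\tilde H^{1/2}(\Gamma)$ be the closure of $C_0^\infty(\Gamma)$ in $H^{1/2}(\mathbb R^{n-1})$, with the norm $\|\phi\|_{\tilde H^{1/2}_k(\Gamma)}:=\|\phi\|_{H^{1/2}_k}$, and let $H^{-1/2}(\Gamma)$ be the space of restrictions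 $U|_\Gamma$ of $U\in H^{-1/2}(\mathbb R^{n-1})$, with the duality pairing $\langle U|_\Gamma,\psi\rangle:=\int\hat U\,\overline{\hat\psi}\,d\xi$ for $\psi\in\tilde H^{1/2}(\Gamma)$. For $\phi\in\tilde H^{1/2}(\Gamma)$ let $$\mathcal D_k\phi(x)=\int_\Gamma\frac{\partial\Phi(x,y)}{\partial y_n}\phi(y)\,ds(y),\qquad x\notin\overline\Gamma,$$ and let the hypersingular operator be $T_k\phi:=\partial_n^\pm(\chi\,\mathcal D_k\phi)|_\Gamma\in H^{-1/2}(\Gamma)$, where $\chi\in C_0^\infty(\mathbb R^n)$ is any function equal to $1$ in a neighbourhood of $\Gamma$, and $\partial_n^\pm$ is the trace on $\Gamma_\infty$ of $\partial/\partial x_n$ from the half-space $\{\pm x_n>0\}$, either sign being allowed. Then $T_k\phi$ is well defined, and the sesquilinear form $$a_N(\phi,\psi):=\langle T_k\phi,\psi\rangle,\qquad\phi,\psi\in\tilde H^{1/2}(\Gamma),$$ satisfies the following: for every $c_0>0$ there is a constant $C>0$ depending only on $c_0$ such that, for all such $n$, $\Gamma$ and all $k>0$ with $kL\ge c_0$,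 $$|a_N(\phi,\phi)|\ \ge\ C\,(kL)^{\beta}\,\|\phi\|^2_{\tilde H^{1/2}_k(\Gamma)}\qquad\text{for all }\phi\in\tilde H^{1/2}(\Gamma),$$ where $\beta=-\tfrac23$ if $n=3$ and $\beta=-\tfrac12$ if $n=2$. -/

import Mathlib

open MeasureTheory Complex FourierTransform TopologicalSpace
open scoped ContDiff ComplexConjugate ENNReal

/-!
Throughout, `n` is the dimension of the ambient space `ℝⁿ` (`n = 2` or `n = 3`), which is written as
`ℝⁿ⁻¹ × ℝ`, a point being `x = (x̃, xₙ)`.  The hyperplane `Γ_∞ = {xₙ = 0}` is identified with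
`ℝⁿ⁻¹`, and a relatively open screen `Γ ⊆ Γ_∞` with an open subset of `ℝⁿ⁻¹`.
-/

namespace PlanarScreen

noncomputable section

/-- `ℝⁿ⁻¹`, identified with the hyperplane `Γ_∞ ⊆ ℝⁿ`. -/
abbrev Hyper (n : ℕ) : Type := EuclideanSpace ℝ (Fin (n - 1))

/-- `ℝⁿ = ℝⁿ⁻¹ × ℝ` as a topological vector space with Lebesgue measure.  (The norm of the product
type is not used: Euclidean distances are written out in `euclDist`.) -/
abbrev Space (n : ℕ) : Type := Hyper n × ℝ

/-- The Euclidean distance in `ℝⁿ`. -/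
def euclDist {n : ℕ} (x y : Space n) : ℝ := √(‖x.1 - y.1‖ ^ 2 + (x.2 - y.2) ^ 2)

/-! ### The fundamental solution of the Helmholtz equation -/

/-- The Bessel function `J₀`. -/
def besselJ0 (x : ℝ) : ℝ := ∑' m : ℕ, (-1) ^ m / (m.factorial : ℝ) ^ 2 * (x ^ 2 / 4) ^ m

/-- The Bessel function of the second kind `Y₀`, for positive argument (`harmonic m` is the harmonic
number `1 + 1/2 + ⋯ + 1/m`). -/
def besselY0 (x : ℝ) : ℝ :=
  2 / Real.pi * (Real.log (x / 2) + Real.eulerMascheroniConstant) * besselJ0 x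
    - 2 / Real.pi *
      ∑' m : ℕ, (-1) ^ m * (harmonic m : ℝ) / (m.factorial : ℝ) ^ 2 * (x ^ 2 / 4) ^ m

/-- The Hankel function `H₀⁽¹⁾ = J₀ + i Y₀`, for positive argument. -/
def hankelH0 (x : ℝ) : ℂ := (besselJ0 x : ℂ) + I * (besselY0 x : ℂ)

/-- The outgoing fundamental solution `Φ(x, y)` of `Δu + k²u = 0` in `ℝⁿ`, for `x ≠ y` and
`n = 3` (first case) or `n = 2` (second case). -/
def fundSol {n : ℕ} (k : ℝ) (x y : Space n) : ℂ :=
  if n = 3 then cexp (I * (k * euclDist x y : ℝ)) / (4 * Real.pi * euclDist x y : ℝ)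
  else I / 4 * hankelH0 (k * euclDist x y)

/-! ### Sobolev spaces on `ℝⁿ⁻¹` and on the screen -/

/-- `L²(ℝⁿ⁻¹)`. -/
abbrev L2 (n : ℕ) : Type := Lp ℂ 2 (volume : Measure (Hyper n))

/-- The measure `(k² + |ξ|²)ˢ dξ`, in the variable `η = ξ / 2π` of Mathlib's Fourier transform
`𝓕 u (η) = ∫ e^{-2πi η·x} u(x) dx`.

With `û(ξ) = (2π)^{-(n-1)/2} ∫ e^{-i ξ·x} u(x) dx = (2π)^{-(n-1)/2} 𝓕 u (ξ / 2π)` the substitution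
`ξ = 2π η` gives `∫ (k² + |ξ|²)ˢ |û(ξ)|² dξ = ∫ (k² + |2πη|²)ˢ |𝓕 u (η)|² dη` and
`∫ û(ξ) conj (v̂(ξ)) dξ = ∫ 𝓕 u (η) conj (𝓕 v (η)) dη`, so that the norms and the duality pairings
below carry no additional constants. -/
def sobolevMeasure (n : ℕ) (k s : ℝ) : Measure (Hyper n) :=
  volume.withDensity fun η => ENNReal.ofReal ((k ^ 2 + (2 * Real.pi * ‖η‖) ^ 2) ^ s)

/-- The (possibly infinite) wavenumber-dependent norm `‖φ‖_{H^{1/2}_k(ℝⁿ⁻¹)}` of `φ ∈ L²(ℝⁿ⁻¹)`;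
`φ` belongs to `H^{1/2}(ℝⁿ⁻¹)` iff this is finite for `k = 1` (equivalently, for any `k > 0`). -/
def eHalfNorm {n : ℕ} (k : ℝ) (φ : L2 n) : ℝ≥0∞ :=
  eLpNorm (𝓕 φ : L2 n) 2 (sobolevMeasure n k (1 / 2))

/-- The norm `‖φ‖_{H^{1/2}_k(ℝⁿ⁻¹)} = (∫ (k² + |ξ|²)^{1/2} |φ̂(ξ)|² dξ)^{1/2}`. -/
def halfNorm {n : ℕ} (k : ℝ) (φ : L2 n) : ℝ := (eHalfNorm k φ).toReal

lemma sobolevMeasure_ac (n : ℕ) (k s : ℝ) : sobolevMeasure n k s ≪ volume :=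
  withDensity_absolutelyContinuous _ _

lemma aesm_fourier {n : ℕ} (k s : ℝ) (φ : L2 n) :
    AEStronglyMeasurable (𝓕 φ : L2 n) (sobolevMeasure n k s) :=
  (Lp.aestronglyMeasurable (𝓕 φ : L2 n)).mono_ac (sobolevMeasure_ac n k s)

lemma eHalfNorm_zero {n : ℕ} (k : ℝ) : eHalfNorm k (0 : L2 n) = 0 := by
  have h : (𝓕 (0 : L2 n) : L2 n) = 0 := (Lp.fourierTransformₗᵢ (Hyper n) ℂ).map_zero
  unfold eHalfNorm
  rw [h, eLpNorm_congr_ae ((sobolevMeasure_ac n k _).ae_le (Lp.coeFn_zero ℂ 2 volume))]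
  exact eLpNorm_zero

lemma eHalfNorm_add_le {n : ℕ} (k : ℝ) (φ ψ : L2 n) :
    eHalfNorm k (φ + ψ) ≤ eHalfNorm k φ + eHalfNorm k ψ := by
  have h : (𝓕 (φ + ψ) : L2 n) = 𝓕 φ + 𝓕 ψ := (Lp.fourierTransformₗᵢ (Hyper n) ℂ).map_add φ ψ
  unfold eHalfNorm
  rw [h, eLpNorm_congr_ae ((sobolevMeasure_ac n k _).ae_le (Lp.coeFn_add (𝓕 φ) (𝓕 ψ)))]
  exact eLpNorm_add_le (aesm_fourier k _ φ) (aesm_fourier k _ ψ) (by norm_num)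

lemma eHalfNorm_smul {n : ℕ} (k : ℝ) (c : ℂ) (φ : L2 n) :
    eHalfNorm k (c • φ) = ‖c‖ₑ * eHalfNorm k φ := by
  have h : (𝓕 (c • φ) : L2 n) = c • 𝓕 φ := (Lp.fourierTransformₗᵢ (Hyper n) ℂ).map_smul c φ
  unfold eHalfNorm
  rw [h, eLpNorm_congr_ae ((sobolevMeasure_ac n k _).ae_le (Lp.coeFn_smul c (𝓕 φ)))]
  exact eLpNorm_const_smul c _ _ _

/-- The test functions `𝓓(Γ)` on the screen (smooth, with compact support in `Γ`). -/
abbrev Test {n : ℕ} (Γ : Opens (Hyper n)) : Type := TestFunction Γ ℂ ⊤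

lemma Test.memLp {n : ℕ} {Γ : Opens (Hyper n)} (θ : Test Γ) :
    MemLp (θ : Hyper n → ℂ) 2 volume :=
  θ.contDiff.continuous.memLp_of_hasCompactSupport θ.hasCompactSupport

/-- A test function, extended by zero, as an element of `L²(ℝⁿ⁻¹)`. -/
def Test.toL2 {n : ℕ} {Γ : Opens (Hyper n)} (θ : Test Γ) : L2 n := θ.memLp.toLp

/-- `H̃^{1/2}(Γ)`, the closure of `𝓓(Γ)` in `H^{1/2}(ℝⁿ⁻¹)`. -/
def HTilde {n : ℕ} (Γ : Opens (Hyper n)) : Submodule ℂ (L2 n) where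
  carrier := {φ | eHalfNorm 1 φ < ⊤ ∧ ∀ ε : ℝ≥0∞, 0 < ε → ∃ θ : Test Γ,
    eHalfNorm 1 (φ - θ.toL2) < ε}
  zero_mem' := by
    refine ⟨by simp [eHalfNorm_zero], fun ε hε => ⟨0, ?_⟩⟩
    have h : (0 : Test Γ).toL2 = 0 := by
      ext1
      filter_upwards [(0 : Test Γ).memLp.coeFn_toLp, Lp.coeFn_zero ℂ 2 (volume : Measure (Hyper n))]
        with x h1 h2
      rw [Test.toL2, h1, h2]
      simp
    simpa [h, eHalfNorm_zero] using hε
  add_mem' := by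
    rintro φ ψ ⟨hφ, hφ'⟩ ⟨hψ, hψ'⟩
    refine ⟨(eHalfNorm_add_le 1 φ ψ).trans_lt (ENNReal.add_lt_top.2 ⟨hφ, hψ⟩), fun ε hε => ?_⟩
    obtain ⟨θ₁, h₁⟩ := hφ' (ε / 2) (ENNReal.half_pos hε.ne')
    obtain ⟨θ₂, h₂⟩ := hψ' (ε / 2) (ENNReal.half_pos hε.ne')
    refine ⟨θ₁ + θ₂, ?_⟩
    have h : (θ₁ + θ₂).toL2 = θ₁.toL2 + θ₂.toL2 := by
      ext1
      filter_upwards [(θ₁ + θ₂).memLp.coeFn_toLp, θ₁.memLp.coeFn_toLp, θ₂.memLp.coeFn_toLp,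
        Lp.coeFn_add θ₁.toL2 θ₂.toL2] with x h0 h1 h2 h3
      rw [h3, Pi.add_apply, Test.toL2, Test.toL2, Test.toL2, h0, h1, h2]
      simp
    have e : φ + ψ - (θ₁ + θ₂).toL2 = (φ - θ₁.toL2) + (ψ - θ₂.toL2) := by rw [h]; abel
    rw [e, ← ENNReal.add_halves ε]
    exact (eHalfNorm_add_le 1 _ _).trans_lt (ENNReal.add_lt_add h₁ h₂)
  smul_mem' := by
    rintro c φ ⟨hφ, hφ'⟩
    refine ⟨by rw [eHalfNorm_smul]; exact ENNReal.mul_lt_top enorm_lt_top hφ, fun ε hε => ?_⟩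
    have hc : ‖c‖ₑ + 1 ≠ ⊤ := by simp
    obtain ⟨θ, h⟩ := hφ' (ε / (‖c‖ₑ + 1)) (ENNReal.div_pos hε.ne' hc)
    refine ⟨c • θ, ?_⟩
    have h' : (c • θ).toL2 = c • θ.toL2 := by
      ext1
      filter_upwards [(c • θ).memLp.coeFn_toLp, θ.memLp.coeFn_toLp, Lp.coeFn_smul c θ.toL2]
        with x h0 h1 h2
      rw [h2, Pi.smul_apply, Test.toL2, Test.toL2, h0, h1]
      simp
    rw [h', ← smul_sub, eHalfNorm_smul]
    calc ‖c‖ₑ * eHalfNorm 1 (φ - θ.toL2) ≤ (‖c‖ₑ + 1) * eHalfNorm 1 (φ - θ.toL2) := by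
          gcongr; exact le_self_add
      _ < ε := by
          rw [mul_comm]
          exact (ENNReal.lt_div_iff_mul_lt (Or.inl (by simp)) (Or.inl hc)).1 h

/-- `F` is the Fourier transform `Û` of a distribution `U ∈ H^{-1/2}(ℝⁿ⁻¹)`, that is
`∫ (1 + |ξ|²)^{-1/2} |Û(ξ)|² dξ < ∞`.  (Each such `F` is locally integrable and determines the
tempered distribution `U`, which acts on `v` by `fourierPairing F v`.) -/
def IsNegHalfDensity {n : ℕ} (F : Hyper n → ℂ) : Prop := MemLp F 2 (sobolevMeasure n 1 (-1 / 2))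

/-- The pairing `⟨U, v⟩_{H^{-1/2}(ℝⁿ⁻¹) × H^{1/2}(ℝⁿ⁻¹)} = ∫ Û conj v̂`, where `F = Û`. -/
def fourierPairing {n : ℕ} (F : Hyper n → ℂ) (v : L2 n) : ℂ :=
  ∫ η, F η * conj ((𝓕 v : L2 n) η)

/-- Let `g` be an antilinear functional on `𝓓(Γ)`.  This says that `g` belongs to `H^{-1/2}(Γ)`,
i.e. `g = U|_Γ` for some `U ∈ H^{-1/2}(ℝⁿ⁻¹)`, and that `z = ⟨U, ψ⟩` for such a `U`, i.e.
`z` is the value of `⟨g, ψ⟩_{H^{-1/2}(Γ) × H̃^{1/2}(Γ)}`. -/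
def IsDualityPairing {n : ℕ} (Γ : Opens (Hyper n)) (g : Test Γ → ℂ) (ψ : HTilde Γ) (z : ℂ) : Prop :=
  ∃ F : Hyper n → ℂ, IsNegHalfDensity F ∧ (∀ θ : Test Γ, g θ = fourierPairing F θ.toL2) ∧
    z = fourierPairing F ψ

/-! ### Normal derivatives on the screen from the two half-spaces -/

/-- The unit coordinate vectors of `ℝⁿ = ℝⁿ⁻¹ × ℝ`; `none` stands for the normal direction `eₙ`. -/
def coordVec {n : ℕ} : Option (Fin (n - 1)) → Space n
  | some j => (EuclideanSpace.single j 1, 0)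
  | none => (0, 1)

/-- The partial derivative `∂ᵢ w`. -/
def pderiv {n : ℕ} (i : Option (Fin (n - 1))) (w : Space n → ℂ) (x : Space n) : ℂ :=
  fderiv ℝ w x (coordVec i)

/-- The Laplacian in `ℝⁿ`. -/
def lap {n : ℕ} (w : Space n → ℂ) (x : Space n) : ℂ := ∑ i, pderiv i (pderiv i w) x

/-- The half-spaces `U⁺` (`σ = 1`) and `U⁻` (`σ = -1`). -/
def halfSpace (n : ℕ) (σ : ℝ) : Set (Space n) := {x | 0 < σ * x.2}

/-- `w ∈ C²(U^σ) ∩ W¹(U^σ; Δ)`: the function `w`, its gradient and its Laplacian are in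
`L²(U^σ)`.  (For `w` of class `C²` the weak derivatives are the classical ones.) -/
def MemW1Lap {n : ℕ} (σ : ℝ) (w : Space n → ℂ) : Prop :=
  ContDiffOn ℝ 2 w (halfSpace n σ) ∧
  MemLp w 2 (volume.restrict (halfSpace n σ)) ∧
  (∀ i, MemLp (pderiv i w) 2 (volume.restrict (halfSpace n σ))) ∧
  MemLp (lap w) 2 (volume.restrict (halfSpace n σ))

/-- `g = (∂ₙ^σ w)|_Γ`, where `∂ₙ^σ` is the normal derivative trace on `Γ_∞` from the half-space
`U^σ` of `w ∈ C²(U^σ) ∩ W¹(U^σ; Δ)`, with the normal `eₙ` pointing into `U⁺`.  It is determined by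
Green's identity `⟨∂ₙ^σ w, v|_{Γ_∞}⟩ = -σ ∫_{U^σ} (∇w · conj ∇v + Δw conj v) dx`, for `v ∈ 𝓓(ℝⁿ)`,
the restriction to `Γ` being obtained from those `v` with `v|_{Γ_∞} ∈ 𝓓(Γ)`. -/
def IsNormalTrace {n : ℕ} (Γ : Opens (Hyper n)) (σ : ℝ) (w : Space n → ℂ) (g : Test Γ → ℂ) : Prop :=
  MemW1Lap σ w ∧
  ∀ (θ : Test Γ) (v : Space n → ℂ), ContDiff ℝ ∞ v → HasCompactSupport v →
    (∀ y : Hyper n, v (y, 0) = θ y) →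
    g θ = -σ * ∫ x in halfSpace n σ,
      ((∑ i, pderiv i w x * conj (pderiv i v x)) + lap w x * conj (v x))

/-! ### The hypersingular operator and its sesquilinear form -/

/-- The double layer potential `𝓓ₖφ(x) = ∫_Γ ∂Φ(x, y)/∂n(y) φ(y) ds(y)`, for `x ∉ closure Γ`.
(As `φ ∈ H̃^{1/2}(Γ)` is in `L²`, and vanishes almost everywhere outside the bounded set `Γ`, and as
the kernel is smooth on the closure of `Γ`, the duality pairing of `φ` with the kernel is this
absolutely convergent integral.) -/
def doubleLayer {n : ℕ} (k : ℝ) (Γ : Opens (Hyper n)) (φ : L2 n) (x : Space n) : ℂ :=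
  ∫ y in (Γ : Set (Hyper n)), deriv (fun t : ℝ => fundSol k x (y, t)) 0 * φ y

/-- The cut-off functions `𝓓_{1,Γ}(ℝⁿ)`: test functions on `ℝⁿ` that are equal to `1` in a
neighbourhood of `Γ`. -/
def IsCutoff {n : ℕ} (Γ : Opens (Hyper n)) (χ : Space n → ℂ) : Prop :=
  ContDiff ℝ ∞ χ ∧ HasCompactSupport χ ∧ ∀ y ∈ Γ, ∀ᶠ x in nhds ((y, 0) : Space n), χ x = 1

/-- `g = Tₖφ := ∂ₙ^±(χ 𝓓ₖφ)|_Γ`, for any cut-off function `χ ∈ 𝓓_{1,Γ}(ℝⁿ)` and either sign. -/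
def IsHypersingular {n : ℕ} (k : ℝ) (Γ : Opens (Hyper n)) (φ : HTilde Γ) (g : Test Γ → ℂ) : Prop :=
  ∀ χ : Space n → ℂ, IsCutoff Γ χ → ∀ σ : ℝ, σ = 1 ∨ σ = -1 →
    IsNormalTrace Γ σ (fun x => χ x * doubleLayer k Γ φ x) g

/-- `a` is the sesquilinear form `a_N(φ, ψ) = ⟨Tₖφ, ψ⟩_{H^{-1/2}(Γ) × H̃^{1/2}(Γ)}` on
`H̃^{1/2}(Γ) × H̃^{1/2}(Γ)` (linear in `φ`, antilinear in `ψ`). -/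
def IsHypersingularForm {n : ℕ} (k : ℝ) (Γ : Opens (Hyper n))
    (a : HTilde Γ →ₗ[ℂ] HTilde Γ →ₗ⋆[ℂ] ℂ) : Prop :=
  ∀ φ : HTilde Γ, ∃ g : Test Γ → ℂ, IsHypersingular k Γ φ g ∧
    ∀ ψ : HTilde Γ, IsDualityPairing Γ g ψ (a φ ψ)

/-- The exponent `β`, equal to `-2/3` for `n = 3` and to `-1/2` for `n = 2`. -/
def coercivityExponent (n : ℕ) : ℝ := if n = 3 then -2 / 3 else -1 / 2

end

end PlanarScreen

/-!
Write `F = 𝓕 φ` and `ω(η) = √(|ξ|² - k²)`, `ξ = 2πη`, with `Re ω ≤ 0 ≤ Im ω` (`symb`).  The operator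
`Tₖ` is the Fourier multiplier `ω / 2`, and coercivity holds because `ω` vanishes only on the sphere
`|ξ| = k`, near which the Fourier transform of a function supported in a set of diameter `L` cannot
concentrate on scales below `1 / L`.

*The multiplier.*  On each side of the screen the kernel `∂Φ(x, y) / ∂yₙ` is a superposition of the
outgoing plane and evanescent waves `e^{2πi x̃·η ± ω xₙ}` (`deriv_fundSol`).  To see this, an
integration by parts in `η` shows that the superposition, divided by the distance `t` from the
hyperplane, depends on the distance from the origin only (`kern_rotation`, `kern_eq_axis`), so that
it suffices to compute it on the `xₙ`-axis: for `n = 3` it is elementary there, and for `n = 2` it is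
a known integral for the derivative of `H₀⁽¹⁾`.  The latter integral representation (`hankelH0_eq`)
is proved from the power series by uniqueness for Bessel's equation, both sides having the same
logarithmic singularity at `0`, where the constant `γ` comes from `∫ e^{-w} log w dw = -γ`.  Hence
the double layer potential is `±½ ∫ e^{2πi x̃·η ± ω xₙ} F(η) dη` (`doubleLayer_eq_pot`), a function
whose normal derivative on the screen is read off from Green's identity in `±xₙ > ε` as `ε → 0`
(`green_identity`, `tendsto_integral_pot_mul`, `isHypersingular_fourierPairing`).  The form is
therefore `a(φ, ψ) = ∫ (ω / 2) F conj (𝓕 ψ)`, and it is the only one, as the trace is unique and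
test functions are dense in `H̃^{1/2}(Γ)` (`IsHypersingularForm.eq_hyperForm`).

*Coercivity.*  The real and imaginary parts of `ω` have constant signs, so `|a(φ, φ)|` is at least
`¼ ∫ |ω| |F|²` (`integral_symb_le_norm_hyperForm`).  Let `A` be the annulus `||ξ| - k| < δk`.
Outside `A` one has `|ω| ≥ ½ √δ (k² + |ξ|²)^{1/2}` (`weight_le_of_notMem_annulus`).  A translation
of `F` by `h` changes it in `L²`, up to a unimodular factor, by at most `2π|h|L ‖F‖`
(`integral_fourier_shift_le`).  For `δ` a small multiple of `1 / (kL)`, each quarter of `A` can be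
moved out of `A` by such a translation with a small relative error, so that the mass of `F` on `A` is
controlled by that outside (`setIntegral_annulus_le`).  This gives
`|a(φ, φ)| ≥ C (kL)^{-1/2} ‖φ‖²` in both dimensions (`hyperForm_coercive`), and for `n = 3` the
exponent `-2/3` is weaker, since `kL ≥ c₀`.
-/

namespace PlanarScreen

noncomputable section

/-! ### The Fourier transform on `L¹ ∩ L²` -/

section Plancherel

variable {V : Type*} [NormedAddCommGroup V] [InnerProductSpace ℝ V] [FiniteDimensional ℝ V]
  [MeasurableSpace V] [BorelSpace V]

lemma continuous_fourier {f : V → ℂ} (h1 : Integrable f) : Continuous (𝓕 f) :=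
  VectorFourier.fourierIntegral_continuous Real.continuous_fourierChar
    (by exact continuous_inner) h1

/-- On `L¹ ∩ L²` the Fourier transform of `L²` is given by the Fourier integral: both have the same
integrals against test functions. -/
lemma fourier_toLp_ae_eq {f : V → ℂ} (h1 : Integrable f) (h2 : MemLp f 2) :
    (𝓕 (h2.toLp f) : Lp ℂ 2 (volume : Measure V)) =ᵐ[volume] 𝓕 f := by
  have hc : Continuous (𝓕 f) := continuous_fourier h1
  refine ae_eq_of_integral_contDiff_smul_eq
    ((Lp.memLp _).locallyIntegrable (by norm_num)) hc.locallyIntegrable fun g hg hgs => ?_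
  let G : SchwartzMap V ℂ := (hgs.comp_left (g := ((↑) : ℝ → ℂ)) (by simp)).toSchwartzMap
    (Complex.ofRealCLM.contDiff.comp hg)
  have hG : ∀ x, G x = (g x : ℂ) := fun x => rfl
  have e1 := DFunLike.congr_fun (Lp.fourier_toTemperedDistribution_eq (h2.toLp f)) G
  rw [TemperedDistribution.fourier_apply, Lp.toTemperedDistribution_apply,
    Lp.toTemperedDistribution_apply] at e1
  have e2 := VectorFourier.integral_fourierIntegral_smul_eq_flip (μ := volume) (ν := volume)
    (L := innerₗ V) Real.continuous_fourierChar (by exact continuous_inner) G.integrable h1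
  have e3 : ∫ x, (𝓕 G) x • (h2.toLp f : V → ℂ) x = ∫ x, (𝓕 G) x • f x := by
    refine integral_congr_ae ?_
    filter_upwards [h2.coeFn_toLp] with x hx
    rw [hx]
  have e4 : ∀ x, g x • (𝓕 f) x = G x • (𝓕 f) x := fun x => by rw [hG]; simp
  have e5 : ∀ x, g x • (𝓕 (h2.toLp f) : Lp ℂ 2 (volume : Measure V)) x
      = G x • (𝓕 (h2.toLp f) : Lp ℂ 2 (volume : Measure V)) x := fun x => by rw [hG]; simp
  simp_rw [e4, e5]
  rw [← e1, e3]
  refine Eq.trans ?_ (e2.trans ?_)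
  · rfl
  · rw [flip_innerₗ]
    rfl

/-- Plancherel's theorem for `L¹ ∩ L²`. -/
lemma eLpNorm_fourier {f : V → ℂ} (h1 : Integrable f) (h2 : MemLp f 2) :
    eLpNorm (𝓕 f) 2 volume = eLpNorm f 2 volume := by
  rw [← eLpNorm_congr_ae (fourier_toLp_ae_eq h1 h2), ← eLpNorm_congr_ae h2.coeFn_toLp]
  have := Lp.norm_fourier_eq (h2.toLp f)
  rw [Lp.norm_def, Lp.norm_def] at this
  exact (ENNReal.toReal_eq_toReal_iff' (Lp.memLp _).2.ne (Lp.memLp _).2.ne).1 this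

lemma eLpNorm_fourierInv {f : V → ℂ} (h1 : Integrable f) (h2 : MemLp f 2) :
    eLpNorm (𝓕⁻ f) 2 volume = eLpNorm f 2 volume := by
  rw [← eLpNorm_fourier h1 h2]
  have : (𝓕⁻ f) = (𝓕 f) ∘ (fun x => -x) := by
    ext x; rw [Real.fourierInv_eq_fourier_neg]; rfl
  rw [this]
  exact eLpNorm_comp_measurePreserving (continuous_fourier h1).aestronglyMeasurable
    (Measure.measurePreserving_neg volume)

end Plancherel

/-! ### Bessel's equation of order zero -/

/-- A solution of `x y'' + y' + x y = 0` on `(0, ∞)` that tends to `0` at the origin vanishes. -/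
lemma bessel_unique_real {D D' : ℝ → ℝ} (h1 : ∀ x, 0 < x → HasDerivAt D (D' x) x)
    (h2 : ∀ x, 0 < x → HasDerivAt (fun x => x * D' x) (-(x * D x)) x)
    (h0 : Filter.Tendsto D (nhdsWithin 0 (Set.Ioi 0)) (nhds 0)) {x : ℝ} (hx : 0 < x) :
    D x = 0 := by
  have hlim : ∀ ε > 0, ∃ δ > 0, ∀ y, 0 < y → y < δ → |D y| < ε := by
    intro ε hε
    have := (Metric.tendsto_nhdsWithin_nhds.1 h0) ε hε
    obtain ⟨δ, hδ, h⟩ := this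
    refine ⟨δ, hδ, fun y hy hy' => ?_⟩
    have := h (show y ∈ Set.Ioi 0 from hy) (by rw [Real.dist_eq, sub_zero, abs_of_pos hy]; exact hy')
    rwa [Real.dist_eq, sub_zero] at this
  -- `x D'(x)` is small along a sequence tending to `0` (mean value theorem), hence it tends to `0`
  -- at a rate that makes `D'` tend to `0` as well.
  have key : ∀ ε > 0, ∃ δ > 0, ∀ y, 0 < y → y < δ → |D y| < ε ∧ |D' y| ≤ ε * y := by
    intro ε hε
    obtain ⟨δ, hδ, h⟩ := hlim ε hε
    refine ⟨δ, hδ, fun y hy hyδ => ⟨h y hy hyδ, ?_⟩⟩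
    have hle : ∀ η > 0, |y * D' y| ≤ η + ε * y * y := by
      intro η hη
      obtain ⟨δ', hδ', h'⟩ := hlim (η / 4) (by positivity)
      set z := min (y / 4) (δ' / 4) with hz
      have hz0 : 0 < z := by positivity
      have hz1 : z ≤ y / 4 := min_le_left _ _
      have hz2 : z ≤ δ' / 4 := min_le_right _ _
      obtain ⟨ξ, hξ, hξe⟩ := exists_hasDerivAt_eq_slope D D' (show z < 2 * z by linarith)
        (fun t ht => (h1 t (hz0.trans_le ht.1)).continuousAt.continuousWithinAt)
        (fun t ht => h1 t (hz0.trans ht.1))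
      have hξ0 : 0 < ξ := hz0.trans hξ.1
      have hξy : ξ < y := by linarith [hξ.2]
      have e1 : |ξ * D' ξ| ≤ η := by
        have a1 := h' z hz0 (by linarith)
        have a2 := h' (2 * z) (by linarith) (by linarith)
        have a3 : |D (2 * z) - D z| ≤ η / 2 := by
          refine (abs_sub _ _).trans ?_; linarith
        rw [hξe, show 2 * z - z = z by ring, ← mul_div_assoc, abs_div, abs_mul, abs_of_pos hz0,
          abs_of_pos hξ0, div_le_iff₀ hz0]
        nlinarith [hξ.2, abs_nonneg (D (2 * z) - D z)]
      have e2 : |y * D' y - ξ * D' ξ| ≤ ε * y * (y - ξ) := by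
        have := (convex_Icc ξ y).norm_image_sub_le_of_norm_hasDerivWithin_le
          (f := fun x => x * D' x) (f' := fun x => -(x * D x)) (C := ε * y) (x := ξ) (y := y)
          (fun t ht => (h2 t (hξ0.trans_le ht.1)).hasDerivWithinAt)
          (fun t ht => by
            have ht0 : 0 < t := hξ0.trans_le ht.1
            have := h t ht0 (ht.2.trans_lt hyδ)
            rw [norm_neg, Real.norm_eq_abs, abs_mul, abs_of_pos ht0, mul_comm]
            exact mul_le_mul this.le ht.2 ht0.le hε.le)
          ⟨le_rfl, hξy.le⟩ ⟨hξy.le, le_rfl⟩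
        simpa [Real.norm_eq_abs, abs_of_pos (sub_pos.2 hξy)] using this
      have e3 : |y * D' y| ≤ |y * D' y - ξ * D' ξ| + |ξ * D' ξ| := by
        simpa using abs_add_le (y * D' y - ξ * D' ξ) (ξ * D' ξ)
      have : ε * y * (y - ξ) ≤ ε * y * y := by
        have : 0 < ε * y := by positivity
        nlinarith
      linarith
    have := le_of_forall_pos_le_add (fun η hη => (hle η hη).trans_eq (add_comm _ _))
    rw [abs_mul, abs_of_pos hy] at this
    nlinarith
  -- the energy `D² + D'²` is nonincreasing
  have hD' : ∀ t, 0 < t → HasDerivAt D' ((-(t * D t) - D' t) / t) t := by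
    intro t ht
    have := (h2 t ht).div (hasDerivAt_id t) ht.ne'
    have e : (fun x => x * D' x) / id =ᶠ[nhds t] D' := by
      filter_upwards [lt_mem_nhds ht] with s hs
      simp only [Pi.div_apply, id]
      field_simp
    refine (this.congr_of_eventuallyEq e.symm).congr_deriv ?_
    simp only [id]
    field_simp
  have hE : AntitoneOn (fun t => D t ^ 2 + D' t ^ 2) (Set.Ioi 0) := by
    have hd : ∀ t, 0 < t → HasDerivAt (fun t => D t ^ 2 + D' t ^ 2) (-2 * D' t ^ 2 / t) t := by
      intro t ht
      refine (((h1 t ht).fun_pow 2).add ((hD' t ht).fun_pow 2)).congr_deriv ?_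
      field_simp
      push_cast
      ring
    refine antitoneOn_of_deriv_nonpos (convex_Ioi 0)
      (fun t ht => (hd t ht).continuousAt.continuousWithinAt)
      (fun t ht => by
        rw [interior_Ioi] at ht; exact (hd t ht).differentiableAt.differentiableWithinAt)
      (fun t ht => by
        rw [interior_Ioi] at ht
        have ht : 0 < t := ht
        rw [(hd t ht).deriv]
        exact div_nonpos_of_nonpos_of_nonneg (by nlinarith [sq_nonneg (D' t)]) ht.le)
  have hz : D x ^ 2 + D' x ^ 2 ≤ 0 := by
    refine le_of_forall_pos_le_add fun η hη => ?_
    rw [zero_add]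
    set ε := min 1 (η / 2)
    have hε : 0 < ε := by positivity
    obtain ⟨δ, hδ, h⟩ := key ε hε
    set y := min (min (δ / 2) x) 1
    have hy : 0 < y := by positivity
    have hyx : y ≤ x := (min_le_left _ _).trans (min_le_right _ _)
    have hyδ : y ≤ δ / 2 := (min_le_left _ _).trans (min_le_left _ _)
    have hy1 : y ≤ 1 := min_le_right _ _
    obtain ⟨b1, b2⟩ := h y hy (by linarith)
    have b3 : |D' y| ≤ ε := b2.trans (by nlinarith)
    refine (hE hy hx hyx).trans ?_
    have c1 : D y ^ 2 ≤ ε ^ 2 := sq_le_sq' (by linarith [(abs_le.1 b1.le).1]) (abs_le.1 b1.le).2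
    have c2 : D' y ^ 2 ≤ ε ^ 2 := sq_le_sq' (by linarith [(abs_le.1 b3).1]) (abs_le.1 b3).2
    have c3 : ε ≤ 1 := min_le_left _ _
    have c4 : ε ≤ η / 2 := min_le_right _ _
    show D y ^ 2 + D' y ^ 2 ≤ η
    nlinarith
  nlinarith [sq_nonneg (D x), sq_nonneg (D' x)]

lemma bessel_unique {D D' : ℝ → ℂ} (h1 : ∀ x, 0 < x → HasDerivAt D (D' x) x)
    (h2 : ∀ x : ℝ, 0 < x → HasDerivAt (fun x : ℝ => (x : ℂ) * D' x) (-(x * D x)) x)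
    (h0 : Filter.Tendsto D (nhdsWithin 0 (Set.Ioi 0)) (nhds 0)) {x : ℝ} (hx : 0 < x) :
    D x = 0 := by
  apply Complex.ext
  · refine bessel_unique_real (D := fun x => (D x).re) (D' := fun x => (D' x).re)
      (fun t ht => ?_) (fun t ht => ?_) ?_ hx
    · exact Complex.reCLM.hasFDerivAt.comp_hasDerivAt t (h1 t ht)
    · simpa [Function.comp_def] using Complex.reCLM.hasFDerivAt.comp_hasDerivAt t (h2 t ht)
    · exact (Complex.continuous_re.tendsto 0).comp h0
  · refine bessel_unique_real (D := fun x => (D x).im) (D' := fun x => (D' x).im)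
      (fun t ht => ?_) (fun t ht => ?_) ?_ hx
    · exact Complex.imCLM.hasFDerivAt.comp_hasDerivAt t (h1 t ht)
    · simpa [Function.comp_def] using Complex.imCLM.hasFDerivAt.comp_hasDerivAt t (h2 t ht)
    · exact (Complex.continuous_im.tendsto 0).comp h0

/-! ### The power series of `J₀` and `Y₀` -/

/-- The sum of the power series with coefficients `a`. -/
def seriesSum (a : ℕ → ℝ) (z : ℝ) : ℝ := ∑' m, a m * z ^ m

/-- The coefficients of the derivative of a power series. -/
def dcoeff (a : ℕ → ℝ) (m : ℕ) : ℝ := (m + 1) * a (m + 1)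

lemma dcoeff_le {a : ℕ → ℝ} (ha : ∀ m, |a m| ≤ 1 / m.factorial) (m : ℕ) :
    |dcoeff a m| ≤ 1 / m.factorial := by
  have h := ha (m + 1)
  unfold dcoeff
  rw [abs_mul, abs_of_nonneg (by positivity)]
  calc ((m : ℝ) + 1) * |a (m + 1)| ≤ (m + 1) * (1 / (m + 1).factorial) := by gcongr
    _ = 1 / m.factorial := by rw [Nat.factorial_succ]; push_cast; field_simp

lemma summable_series {a : ℕ → ℝ} (ha : ∀ m, |a m| ≤ 1 / m.factorial) (z : ℝ) :
    Summable fun m => a m * z ^ m := by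
  refine Summable.of_norm_bounded (Real.summable_pow_div_factorial |z|) fun m => ?_
  rw [Real.norm_eq_abs, abs_mul, abs_pow, div_eq_inv_mul, ← one_div]
  exact mul_le_mul_of_nonneg_right (ha m) (by positivity)

lemma hasDerivAt_seriesSum {a : ℕ → ℝ} (ha : ∀ m, |a m| ≤ 1 / m.factorial) (z : ℝ) :
    HasDerivAt (seriesSum a) (seriesSum (dcoeff a) z) z := by
  set R := |z| + 1
  have hR : 0 < R := by positivity
  have hu : Summable fun m : ℕ => (m : ℝ) * (R ^ (m - 1) / m.factorial) := by
    rw [← summable_nat_add_iff 1]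
    refine (Real.summable_pow_div_factorial R).congr fun m => ?_
    rw [Nat.factorial_succ, Nat.add_sub_cancel]
    push_cast
    field_simp
  have hz : z ∈ Metric.ball (0 : ℝ) R := by simp [R]
  have h := hasDerivAt_tsum_of_isPreconnected (g := fun m z => a m * z ^ m)
    (g' := fun m z => a m * (m * z ^ (m - 1))) hu Metric.isOpen_ball
    (convex_ball (0 : ℝ) R).isPreconnected (fun m y _ => (hasDerivAt_pow m y).const_mul (a m))
    (fun m y hy => by
      have hy : |y| ≤ R := by simpa using (Metric.mem_ball.1 hy).le
      rw [Real.norm_eq_abs, abs_mul, abs_mul, abs_pow, Nat.abs_cast]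
      calc |a m| * (m * |y| ^ (m - 1)) ≤ 1 / m.factorial * (m * R ^ (m - 1)) := by
            gcongr; exact ha m
        _ = _ := by ring) hz (summable_series ha z) hz
  refine h.congr_deriv ?_
  have hs : Summable fun m : ℕ => a m * (m * z ^ (m - 1)) := by
    rw [← summable_nat_add_iff 1]
    refine (summable_series (dcoeff_le ha) z).congr fun m => ?_
    simp only [dcoeff, Nat.add_sub_cancel]; push_cast; ring
  rw [hs.tsum_eq_zero_add]
  simp only [Nat.cast_zero, zero_mul, mul_zero, zero_add, seriesSum, dcoeff, Nat.add_sub_cancel]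
  refine tsum_congr fun m => ?_
  push_cast; ring

lemma seriesSum_ode {a : ℕ → ℝ} (ha : ∀ m, |a m| ≤ 1 / m.factorial) (z : ℝ) :
    z * seriesSum (dcoeff (dcoeff a)) z + seriesSum (dcoeff a) z + seriesSum a z
      = ∑' m : ℕ, ((m + 1) ^ 2 * a (m + 1) + a m) * z ^ m := by
  have h1 := summable_series ha z
  have h2 := summable_series (dcoeff_le ha) z
  have h3 := summable_series (dcoeff_le (dcoeff_le ha)) z
  have h4 : Summable fun m : ℕ => (m : ℝ) * dcoeff a m * z ^ m := by
    rw [← summable_nat_add_iff 1]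
    refine (h3.mul_left z).congr fun m => ?_
    simp only [dcoeff]; push_cast; ring
  have e : z * seriesSum (dcoeff (dcoeff a)) z = ∑' m : ℕ, (m : ℝ) * dcoeff a m * z ^ m := by
    rw [h4.tsum_eq_zero_add, seriesSum, ← tsum_mul_left]
    simp only [Nat.cast_zero, zero_mul, zero_add]
    refine tsum_congr fun m => ?_
    simp only [dcoeff]; push_cast; ring
  rw [e, seriesSum, seriesSum, ← h4.tsum_add h2, ← (h4.add h2).tsum_add h1]
  refine tsum_congr fun m => ?_
  simp only [dcoeff]; ring

/-- The coefficients of `J₀` as a power series in `x² / 4`. -/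
def jCoeff (m : ℕ) : ℝ := (-1) ^ m / (m.factorial : ℝ) ^ 2

/-- The coefficients, as a power series in `x² / 4`, of the part of `Y₀` without logarithm. -/
def yCoeff (m : ℕ) : ℝ := (-1) ^ m * (harmonic m : ℝ) / (m.factorial : ℝ) ^ 2

lemma jCoeff_le (m : ℕ) : |jCoeff m| ≤ 1 / m.factorial := by
  have h : (1 : ℝ) ≤ m.factorial := by exact_mod_cast Nat.one_le_iff_ne_zero.2 m.factorial_ne_zero
  rw [jCoeff, abs_div, abs_pow, abs_neg, abs_one, one_pow, abs_of_nonneg (by positivity)]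
  gcongr
  nlinarith

lemma harmonic_le (m : ℕ) : (harmonic m : ℝ) ≤ m := by
  induction m with
  | zero => simp
  | succ m ih =>
    rw [harmonic_succ]
    push_cast
    have : ((m : ℝ) + 1)⁻¹ ≤ 1 := inv_le_one_of_one_le₀ (by linarith [m.cast_nonneg (α := ℝ)])
    linarith

lemma yCoeff_le (m : ℕ) : |yCoeff m| ≤ 1 / m.factorial := by
  have h0 : (0 : ℝ) ≤ harmonic m := by
    rw [harmonic]; push_cast; positivity
  have h : (harmonic m : ℝ) ≤ m.factorial :=
    (harmonic_le m).trans (by exact_mod_cast Nat.self_le_factorial m)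
  rw [yCoeff, abs_div, abs_mul, abs_pow, abs_neg, abs_one, one_pow, one_mul, abs_of_nonneg h0,
    abs_of_nonneg (by positivity), div_le_div_iff₀ (by positivity) (by positivity)]
  nlinarith [show (0 : ℝ) < m.factorial from by positivity]

lemma jSeries_ode (z : ℝ) : z * seriesSum (dcoeff (dcoeff jCoeff)) z + seriesSum (dcoeff jCoeff) z
    + seriesSum jCoeff z = 0 := by
  rw [seriesSum_ode jCoeff_le]
  convert tsum_zero with m
  simp only [jCoeff, Nat.factorial_succ]
  push_cast
  field_simp
  ring

lemma ySeries_ode (z : ℝ) : z * seriesSum (dcoeff (dcoeff yCoeff)) z + seriesSum (dcoeff yCoeff) z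
    + seriesSum yCoeff z = seriesSum (dcoeff jCoeff) z := by
  rw [seriesSum_ode yCoeff_le, seriesSum]
  refine tsum_congr fun m => ?_
  congr 1
  simp only [dcoeff, jCoeff, yCoeff, Nat.factorial_succ, harmonic_succ]
  push_cast
  field_simp
  ring

lemma besselJ0_eq (x : ℝ) : besselJ0 x = seriesSum jCoeff (x ^ 2 / 4) := rfl

lemma besselY0_eq (x : ℝ) : besselY0 x = 2 / Real.pi *
    ((Real.log (x / 2) + Real.eulerMascheroniConstant) * seriesSum jCoeff (x ^ 2 / 4)
      - seriesSum yCoeff (x ^ 2 / 4)) := by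
  rw [besselY0, besselJ0_eq, seriesSum, seriesSum]
  simp only [yCoeff]
  ring

lemma hasDerivAt_sq_div_four (x : ℝ) : HasDerivAt (fun x : ℝ => x ^ 2 / 4) (x / 2) x := by
  refine ((hasDerivAt_pow 2 x).div_const 4).congr_deriv ?_
  norm_num; ring

/-- The derivative of `J₀`. -/
def besselJ0' (x : ℝ) : ℝ := x / 2 * seriesSum (dcoeff jCoeff) (x ^ 2 / 4)

/-- The derivative of `Y₀`. -/
def besselY0' (x : ℝ) : ℝ := 2 / Real.pi *
    (x⁻¹ * seriesSum jCoeff (x ^ 2 / 4) + (Real.log (x / 2) + Real.eulerMascheroniConstant) *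
      besselJ0' x - x / 2 * seriesSum (dcoeff yCoeff) (x ^ 2 / 4))

lemma hasDerivAt_besselJ0 (x : ℝ) : HasDerivAt besselJ0 (besselJ0' x) x := by
  refine ((hasDerivAt_seriesSum jCoeff_le (x ^ 2 / 4)).comp x (hasDerivAt_sq_div_four x)).congr_deriv
    ?_
  rw [besselJ0']; ring

lemma hasDerivAt_mul_besselJ0' (x : ℝ) :
    HasDerivAt (fun x => x * besselJ0' x) (-(x * besselJ0 x)) x := by
  have h := ((hasDerivAt_seriesSum (dcoeff_le jCoeff_le) (x ^ 2 / 4)).comp x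
    (hasDerivAt_sq_div_four x))
  refine (((hasDerivAt_sq_div_four x).const_mul 2).mul h).congr_of_eventuallyEq
    (Filter.Eventually.of_forall fun y => ?_) |>.congr_deriv ?_
  · simp only [besselJ0', Pi.mul_apply, Function.comp]; ring
  · rw [besselJ0_eq]
    simp only [Function.comp]
    linear_combination x * jSeries_ode (x ^ 2 / 4)

lemma hasDerivAt_log_half {x : ℝ} (hx : 0 < x) : HasDerivAt
    (fun x => Real.log (x / 2) + Real.eulerMascheroniConstant) x⁻¹ x := by
  refine ((((hasDerivAt_id x).div_const 2).log (by simp; exact hx.ne')).add_const _).congr_deriv ?_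
  simp only [id]
  field_simp

lemma hasDerivAt_besselY0 {x : ℝ} (hx : 0 < x) : HasDerivAt besselY0 (besselY0' x) x := by
  have h1 := hasDerivAt_besselJ0 x
  have h2 := (hasDerivAt_seriesSum yCoeff_le (x ^ 2 / 4)).comp x (hasDerivAt_sq_div_four x)
  refine ((((hasDerivAt_log_half hx).mul h1).sub h2).const_mul (2 / Real.pi)).congr_of_eventuallyEq
    (Filter.Eventually.of_forall fun y => besselY0_eq y) |>.congr_deriv ?_
  rw [besselY0', besselJ0_eq]; ring

lemma hasDerivAt_mul_besselY0' {x : ℝ} (hx : 0 < x) :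
    HasDerivAt (fun x => x * besselY0' x) (-(x * besselY0 x)) x := by
  have h1 := hasDerivAt_besselJ0 x
  have h2 := (hasDerivAt_log_half hx).mul (hasDerivAt_mul_besselJ0' x)
  have h3 := (hasDerivAt_seriesSum (dcoeff_le yCoeff_le) (x ^ 2 / 4)).comp x
    (hasDerivAt_sq_div_four x)
  have h4 := ((hasDerivAt_sq_div_four x).const_mul 2).mul h3
  refine (((h1.add h2).sub h4).const_mul (2 / Real.pi)).congr_of_eventuallyEq ?_ |>.congr_deriv ?_
  · filter_upwards [lt_mem_nhds hx] with y hy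
    simp only [besselY0', besselJ0_eq, Pi.mul_apply, Pi.add_apply, Pi.sub_apply, Function.comp]
    field_simp
    ring
  · rw [besselY0_eq, besselJ0', besselJ0_eq]
    simp only [Function.comp]
    field_simp
    linear_combination (-8) * ySeries_ode (x ^ 2 / 4)

/-! ### Integral representation of the Hankel function -/

lemma integrableOn_pow_mul_exp_neg {x : ℝ} (hx : 0 < x) (j : ℕ) :
    IntegrableOn (fun v : ℝ => v ^ j * Real.exp (-(x * v))) (Set.Ioi 0) := by
  have h := integrableOn_rpow_mul_exp_neg_mul_rpow (p := 1) (s := j) (b := x)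
    (by linarith [j.cast_nonneg (α := ℝ)]) one_pos hx
  refine h.congr_fun (fun v hv => ?_) measurableSet_Ioi
  simp [Real.rpow_natCast]

/-- The integrals `∫₀^∞ v^j (1 + v²)^{-1/2} e^{-xv} dv`. -/
def laplaceInt (j : ℕ) (x : ℝ) : ℝ :=
  ∫ v in Set.Ioi (0 : ℝ), v ^ j / √(1 + v ^ 2) * Real.exp (-(x * v))

lemma one_le_sqrt_one_add_sq (v : ℝ) : 1 ≤ √(1 + v ^ 2) :=
  Real.one_le_sqrt.2 (by nlinarith [sq_nonneg v])

lemma continuous_laplace_integrand (j : ℕ) (x : ℝ) :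
    Continuous fun v : ℝ => v ^ j / √(1 + v ^ 2) * Real.exp (-(x * v)) := by
  refine Continuous.mul (Continuous.div (by fun_prop) (by fun_prop) fun v => ?_) (by fun_prop)
  exact (zero_lt_one.trans_le (one_le_sqrt_one_add_sq v)).ne'

lemma laplace_integrand_le (j : ℕ) (x : ℝ) {v : ℝ} (hv : 0 < v) :
    ‖v ^ j / √(1 + v ^ 2) * Real.exp (-(x * v))‖ ≤ v ^ j * Real.exp (-(x * v)) := by
  rw [Real.norm_of_nonneg (by positivity)]
  gcongr
  exact div_le_self (by positivity) (one_le_sqrt_one_add_sq v)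

lemma integrableOn_laplace {x : ℝ} (hx : 0 < x) (j : ℕ) :
    IntegrableOn (fun v : ℝ => v ^ j / √(1 + v ^ 2) * Real.exp (-(x * v))) (Set.Ioi 0) :=
  (integrableOn_pow_mul_exp_neg hx j).mono' (continuous_laplace_integrand j x).aestronglyMeasurable
    ((ae_restrict_iff' measurableSet_Ioi).2 (.of_forall fun _ hv => laplace_integrand_le j x hv))

lemma hasDerivAt_laplaceInt (j : ℕ) {x : ℝ} (hx : 0 < x) :
    HasDerivAt (laplaceInt j) (-laplaceInt (j + 1) x) x := by
  have h := (hasDerivAt_integral_of_dominated_loc_of_deriv_le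
    (μ := volume.restrict (Set.Ioi (0 : ℝ)))
    (F := fun x v : ℝ => v ^ j / √(1 + v ^ 2) * Real.exp (-(x * v)))
    (F' := fun x v : ℝ => -(v ^ (j + 1) / √(1 + v ^ 2) * Real.exp (-(x * v))))
    (x₀ := x) (s := Set.Ioi (x / 2)) (bound := fun v => v ^ (j + 1) * Real.exp (-(x / 2 * v)))
    (Ioi_mem_nhds (by linarith))
    (.of_forall fun y => (continuous_laplace_integrand j y).aestronglyMeasurable)
    (integrableOn_laplace hx j)
    (continuous_laplace_integrand (j + 1) x).neg.aestronglyMeasurable ?_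
    (integrableOn_pow_mul_exp_neg (by positivity) (j + 1)) ?_).2
  · rw [integral_neg] at h
    exact h
  · refine (ae_restrict_iff' measurableSet_Ioi).2 (.of_forall fun v hv y hy => ?_)
    rw [norm_neg]
    refine (laplace_integrand_le (j + 1) y hv).trans ?_
    have hv : 0 < v := hv
    have hy : x / 2 < y := hy
    gcongr
  · refine (ae_restrict_iff' measurableSet_Ioi).2 (.of_forall fun v hv y hy => ?_)
    have := (((hasDerivAt_id y).mul_const v).neg.exp).const_mul (v ^ j / √(1 + v ^ 2))
    refine this.congr_deriv ?_
    simp only [id, Pi.neg_apply]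
    ring

lemma tendsto_mul_exp_neg {x : ℝ} (hx : 0 < x) :
    Filter.Tendsto (fun v : ℝ => v * Real.exp (-(x * v))) Filter.atTop (nhds 0) := by
  have h := (Real.tendsto_pow_mul_exp_neg_atTop_nhds_zero 1).comp
    (Filter.tendsto_id.const_mul_atTop hx)
  have h2 := h.const_mul x⁻¹
  rw [mul_zero] at h2
  refine h2.congr fun v => ?_
  simp only [Function.comp, id, pow_one]
  field_simp

/-- `∫₀^∞ (x (1 + v²) - v) (1 + v²)^{-1/2} e^{-xv} dv = 1`, the integrand being the derivative of
`-√(1 + v²) e^{-xv}`. -/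
lemma laplaceInt_ode {x : ℝ} (hx : 0 < x) :
    x * (laplaceInt 0 x + laplaceInt 2 x) - laplaceInt 1 x = 1 := by
  have i0 := integrableOn_laplace hx 0
  have i1 := integrableOn_laplace hx 1
  have i2 := integrableOn_laplace hx 2
  have i3 : IntegrableOn (fun v => x * (v ^ 0 / √(1 + v ^ 2) * Real.exp (-(x * v)) +
      v ^ 2 / √(1 + v ^ 2) * Real.exp (-(x * v)))) (Set.Ioi 0) := (i0.add i2).const_mul x
  have h := integral_Ioi_of_hasDerivAt_of_tendsto' (a := 0)
    (f := fun v => -(√(1 + v ^ 2) * Real.exp (-(x * v))))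
    (f' := fun v => x * (v ^ 0 / √(1 + v ^ 2) * Real.exp (-(x * v)) +
      v ^ 2 / √(1 + v ^ 2) * Real.exp (-(x * v))) - v ^ 1 / √(1 + v ^ 2) * Real.exp (-(x * v)))
    (m := 0) (fun v _ => by
      have hp : 0 < 1 + v ^ 2 := by positivity
      have h1 : HasDerivAt (fun v : ℝ => √(1 + v ^ 2)) (2 * v / (2 * √(1 + v ^ 2))) v := by
        refine HasDerivAt.sqrt ?_ hp.ne'
        simpa using (hasDerivAt_pow 2 v).const_add 1
      have h2 : HasDerivAt (fun v => Real.exp (-(x * v))) (Real.exp (-(x * v)) * (-x)) v := by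
        simpa using ((hasDerivAt_id v).const_mul x).neg.exp
      refine (h1.mul h2).neg.congr_deriv ?_
      have hs : √(1 + v ^ 2) ^ 2 = 1 + v ^ 2 := Real.sq_sqrt hp.le
      have hs0 : √(1 + v ^ 2) ≠ 0 := (Real.sqrt_pos.2 hp).ne'
      field_simp
      rw [hs]
      ring) (i3.sub i1) ?_
  · rw [integral_sub i3 i1, integral_const_mul,
      integral_add i0 i2] at h
    simpa [laplaceInt] using h
  · have h0 : Filter.Tendsto (fun v : ℝ => -((1 + v) * Real.exp (-(x * v)))) Filter.atTop
        (nhds 0) := by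
      have e1 : Filter.Tendsto (fun v : ℝ => Real.exp (-(x * v))) Filter.atTop (nhds 0) :=
        Real.tendsto_exp_neg_atTop_nhds_zero.comp (Filter.tendsto_id.const_mul_atTop hx)
      simpa [add_mul] using (e1.add (tendsto_mul_exp_neg hx)).neg
    refine tendsto_of_tendsto_of_tendsto_of_le_of_le' h0 tendsto_const_nhds ?_ ?_
    · filter_upwards [Filter.eventually_ge_atTop 0] with v hv
      have : √(1 + v ^ 2) ≤ 1 + v := Real.sqrt_le_iff.2 ⟨by linarith, by nlinarith⟩
      gcongr
    · exact .of_forall fun v => neg_nonpos.2 (by positivity)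

/-- `∫₀^∞ e^{-w} log w dw = Γ'(1) = -γ`. -/
lemma integral_exp_neg_mul_log :
    ∫ w in Set.Ioi (0 : ℝ), Real.exp (-w) * Real.log w = -Real.eulerMascheroniConstant := by
  have h1 := Complex.hasDerivAt_GammaIntegral (s := 1) (by simp)
  have h2 : HasDerivAt Complex.GammaIntegral (-Real.eulerMascheroniConstant : ℂ) 1 := by
    refine Complex.hasDerivAt_Gamma_one.congr_of_eventuallyEq ?_
    have : IsOpen {s : ℂ | 0 < s.re} := continuous_re.isOpen_preimage _ isOpen_Ioi
    filter_upwards [this.mem_nhds (show (1 : ℂ) ∈ {s : ℂ | 0 < s.re} by simp)] with s hs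
    exact (Complex.Gamma_eq_integral hs).symm
  have h3 := h1.unique h2
  have h4 : ∀ t : ℝ, (t : ℂ) ^ ((1 : ℂ) - 1) * ((Real.log t : ℂ) * (Real.exp (-t) : ℂ))
      = ((Real.exp (-t) * Real.log t : ℝ) : ℂ) := fun t => by
    rw [sub_self, Complex.cpow_zero, one_mul]; push_cast; ring
  simp_rw [h4] at h3
  rw [integral_complex_ofReal] at h3
  exact_mod_cast h3

lemma integrableOn_exp_neg_mul_log :
    IntegrableOn (fun w : ℝ => Real.exp (-w) * Real.log w) (Set.Ioi 0) := by
  by_contra h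
  have h1 := integral_exp_neg_mul_log
  rw [integral_undef h] at h1
  linarith [Real.one_half_lt_eulerMascheroniConstant]

lemma arsinh_le_self {v : ℝ} (hv : 0 ≤ v) : Real.arsinh v ≤ v := by
  have := Real.self_le_sinh_iff.2 (Real.arsinh_nonneg_iff.2 hv)
  rwa [Real.sinh_arsinh] at this

lemma laplaceInt_zero_eq {x : ℝ} (hx : 0 < x) :
    laplaceInt 0 x = ∫ w in Set.Ioi (0 : ℝ), Real.exp (-w) * Real.arsinh (w / x) := by
  have i0 := integrableOn_laplace hx 0
  have i1 : IntegrableOn (fun v => Real.exp (-(x * v)) * Real.arsinh v) (Set.Ioi 0) := by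
    refine (integrableOn_pow_mul_exp_neg hx 1).mono'
      (by have := Real.continuous_arsinh; exact (by fun_prop : Continuous _).aestronglyMeasurable)
      ((ae_restrict_iff' measurableSet_Ioi).2 (.of_forall fun v hv => ?_))
    have hv : 0 < v := hv
    rw [Real.norm_of_nonneg (mul_nonneg (by positivity) (Real.arsinh_nonneg_iff.2 hv.le)), pow_one,
      mul_comm]
    gcongr
    exact arsinh_le_self hv.le
  have h := integral_Ioi_of_hasDerivAt_of_tendsto' (a := 0)
    (f := fun v => Real.exp (-(x * v)) * Real.arsinh v)
    (f' := fun v => v ^ 0 / √(1 + v ^ 2) * Real.exp (-(x * v)) -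
      x * (Real.exp (-(x * v)) * Real.arsinh v))
    (m := 0) (fun v _ => by
      have h2 : HasDerivAt (fun v => Real.exp (-(x * v))) (Real.exp (-(x * v)) * (-x)) v := by
        simpa using ((hasDerivAt_id v).const_mul x).neg.exp
      refine (h2.mul (Real.hasDerivAt_arsinh v)).congr_deriv ?_
      rw [pow_zero]; ring) (i0.sub (i1.const_mul x)) (by
      refine squeeze_zero' ?_ ?_ (tendsto_mul_exp_neg hx)
      · filter_upwards [Filter.eventually_ge_atTop 0] with v hv
        exact mul_nonneg (by positivity) (Real.arsinh_nonneg_iff.2 hv)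
      · filter_upwards [Filter.eventually_ge_atTop 0] with v hv
        rw [mul_comm]
        gcongr
        exact arsinh_le_self hv)
  rw [integral_sub i0 (i1.const_mul x), integral_const_mul] at h
  have e := integral_comp_mul_left_Ioi (fun w => Real.exp (-w) * Real.arsinh (w / x)) 0 hx
  rw [mul_zero, smul_eq_mul] at e
  have e2 : ∀ v, x * v / x = v := fun v => by field_simp
  simp only [e2] at e
  rw [e] at h
  simp only [Real.arsinh_zero, mul_zero, sub_zero] at h
  rw [mul_inv_cancel_left₀ hx.ne'] at h
  exact sub_eq_zero.1 h

lemma laplaceInt_zero_add_log {x : ℝ} (hx : 0 < x) : laplaceInt 0 x + Real.log x =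
    ∫ w in Set.Ioi (0 : ℝ), Real.exp (-w) * Real.log (w + √(x ^ 2 + w ^ 2)) := by
  have i1 : IntegrableOn (fun w => Real.exp (-w) * Real.arsinh (w / x)) (Set.Ioi 0) := by
    refine ((integrableOn_pow_mul_exp_neg one_pos 1).const_mul x⁻¹).mono'
      (by have := Real.continuous_arsinh; exact (by fun_prop : Continuous _).aestronglyMeasurable)
      ((ae_restrict_iff' measurableSet_Ioi).2 (.of_forall fun v hv => ?_))
    have hv : 0 < v := hv
    have hvx : 0 ≤ v / x := by positivity
    rw [Real.norm_of_nonneg (mul_nonneg (by positivity) (Real.arsinh_nonneg_iff.2 hvx)), pow_one,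
      one_mul]
    calc Real.exp (-v) * Real.arsinh (v / x) ≤ Real.exp (-v) * (v / x) := by
          gcongr; exact arsinh_le_self hvx
      _ = _ := by field_simp
  have i2 : IntegrableOn (fun w => Real.exp (-w) * Real.log x) (Set.Ioi 0) :=
    (integrableOn_exp_neg_Ioi 0).mul_const _
  have e : Real.log x = ∫ w in Set.Ioi (0 : ℝ), Real.exp (-w) * Real.log x := by
    rw [integral_mul_const, integral_exp_neg_Ioi_zero, one_mul]
  rw [laplaceInt_zero_eq hx]
  nth_rewrite 1 [e]
  rw [← integral_add i1 i2]
  refine setIntegral_congr_fun measurableSet_Ioi fun w hw => ?_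
  have hw : 0 < w := hw
  rw [← mul_add, Real.arsinh, ← Real.log_mul (by positivity) hx.ne']
  congr 2
  have : √(x ^ 2 + w ^ 2) = x * √(1 + (w / x) ^ 2) := by
    rw [show x ^ 2 + w ^ 2 = x ^ 2 * (1 + (w / x) ^ 2) by field_simp,
      Real.sqrt_mul (by positivity), Real.sqrt_sq hx.le]
  rw [this]
  field_simp

lemma tendsto_laplaceInt_zero_add_log :
    Filter.Tendsto (fun x => laplaceInt 0 x + Real.log x) (nhdsWithin 0 (Set.Ioi 0))
      (nhds (Real.log 2 - Real.eulerMascheroniConstant)) := by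
  have hlim : ∫ w in Set.Ioi (0 : ℝ), Real.exp (-w) * Real.log (w + √(0 ^ 2 + w ^ 2))
      = Real.log 2 - Real.eulerMascheroniConstant := by
    have e : ∫ w in Set.Ioi (0 : ℝ), Real.exp (-w) * Real.log (w + √(0 ^ 2 + w ^ 2)) =
        ∫ w in Set.Ioi (0 : ℝ), (Real.exp (-w) * Real.log 2 + Real.exp (-w) * Real.log w) := by
      refine setIntegral_congr_fun measurableSet_Ioi fun w hw => ?_
      have hw : 0 < w := hw
      rw [zero_pow two_ne_zero, zero_add, Real.sqrt_sq hw.le, ← two_mul,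
        Real.log_mul two_ne_zero hw.ne', mul_add]
    rw [e, integral_add ((integrableOn_exp_neg_Ioi 0).mul_const _) integrableOn_exp_neg_mul_log,
      integral_mul_const, integral_exp_neg_Ioi_zero, integral_exp_neg_mul_log]
    ring
  rw [← hlim]
  have hc : Filter.Tendsto (fun x : ℝ => ∫ w in Set.Ioi (0 : ℝ),
      Real.exp (-w) * Real.log (w + √(x ^ 2 + w ^ 2))) (nhdsWithin 0 (Set.Ioi 0))
      (nhds (∫ w in Set.Ioi (0 : ℝ), Real.exp (-w) * Real.log (w + √(0 ^ 2 + w ^ 2)))) := by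
    refine tendsto_integral_filter_of_dominated_convergence
      (fun w => ‖Real.exp (-w) * Real.log w‖ + (2 * (w ^ 1 * Real.exp (-(1 * w)))))
      (.of_forall fun x => (by fun_prop : Measurable _).aestronglyMeasurable) ?_
      (integrableOn_exp_neg_mul_log.norm.add
        ((integrableOn_pow_mul_exp_neg one_pos 1).const_mul 2)) ?_
    · filter_upwards [Ioo_mem_nhdsGT (zero_lt_one (α := ℝ))] with x hx
      refine (ae_restrict_iff' measurableSet_Ioi).2 (.of_forall fun w hw => ?_)
      have hw : 0 < w := hw
      rw [norm_mul, norm_mul, Real.norm_of_nonneg (Real.exp_pos _).le, one_mul, pow_one,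
        show 2 * (w * Real.exp (-w)) = Real.exp (-w) * (2 * w) by ring, ← mul_add]
      gcongr
      have h1 : w ≤ w + √(x ^ 2 + w ^ 2) := by linarith [Real.sqrt_nonneg (x ^ 2 + w ^ 2)]
      have h2 : √(x ^ 2 + w ^ 2) ≤ 1 + w :=
        Real.sqrt_le_iff.2 ⟨by linarith, by nlinarith [hx.1, hx.2]⟩
      have h3 : Real.log (w + √(x ^ 2 + w ^ 2)) ≤ 2 * w := by
        linarith [Real.log_le_sub_one_of_pos (hw.trans_le h1)]
      have h4 := Real.log_le_log hw h1
      rw [Real.norm_eq_abs, Real.norm_eq_abs]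
      rw [abs_le]
      constructor
      · linarith [neg_abs_le (Real.log w)]
      · linarith [abs_nonneg (Real.log w)]
    · refine (ae_restrict_iff' measurableSet_Ioi).2 (.of_forall fun w hw => ?_)
      have hw : 0 < w := hw
      have hne : w + √(0 ^ 2 + w ^ 2) ≠ 0 := by positivity
      have : ContinuousAt (fun x : ℝ => Real.exp (-w) * Real.log (w + √(x ^ 2 + w ^ 2))) 0 := by
        refine continuousAt_const.mul (ContinuousAt.log ?_ hne)
        fun_prop
      exact this.tendsto.mono_left nhdsWithin_le_nhds
  refine hc.congr' ?_
  filter_upwards [self_mem_nhdsWithin] with x hx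
  exact (laplaceInt_zero_add_log hx).symm

/-- The integrals `∫₀^{π/2} sin^j θ e^{i x sin θ} dθ`. -/
def angleInt (j : ℕ) (x : ℝ) : ℂ :=
  ∫ θ in (0 : ℝ)..(Real.pi / 2), (Real.sin θ : ℂ) ^ j * cexp (I * (x * Real.sin θ))

lemma hasDerivAt_angleInt (j : ℕ) (x : ℝ) : HasDerivAt (angleInt j) (I * angleInt (j + 1) x) x := by
  have h := (intervalIntegral.hasDerivAt_integral_of_dominated_loc_of_deriv_le (μ := volume)
    (a := 0) (b := Real.pi / 2) (x₀ := x) (s := Set.univ) (bound := fun _ => 1)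
    (F := fun (x θ : ℝ) => (Real.sin θ : ℂ) ^ j * cexp (I * (x * Real.sin θ)))
    (F' := fun (x θ : ℝ) => I * ((Real.sin θ : ℂ) ^ (j + 1) * cexp (I * (x * Real.sin θ))))
    Filter.univ_mem
    (.of_forall fun y => (by fun_prop : Continuous _).aestronglyMeasurable)
    ((by fun_prop : Continuous _).intervalIntegrable _ _)
    ((by fun_prop : Continuous _).aestronglyMeasurable) ?_
    intervalIntegrable_const ?_).2
  · rw [intervalIntegral.integral_const_mul] at h
    exact h
  · refine .of_forall fun θ _ y _ => ?_
    rw [norm_mul, norm_mul, norm_pow, Complex.norm_I, Complex.norm_real, one_mul,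
      show I * ((y : ℂ) * (Real.sin θ : ℂ)) = ((y * Real.sin θ : ℝ) : ℂ) * I by push_cast; ring,
      Complex.norm_exp_ofReal_mul_I, mul_one]
    exact pow_le_one₀ (norm_nonneg _) (Real.abs_sin_le_one θ)
  · refine .of_forall fun θ _ y _ => ?_
    have h1 : HasDerivAt (fun y : ℝ => I * ((y : ℂ) * (Real.sin θ : ℂ))) (I * (1 * Real.sin θ)) y :=
      ((hasDerivAt_id y).ofReal_comp.mul_const _).const_mul _
    refine (h1.cexp.const_mul _).congr_deriv ?_
    ring

/-- `∫₀^{π/2} (i sin θ + x cos² θ) e^{i x sin θ} dθ = i`, the integrand being the derivative of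
`-i cos θ e^{i x sin θ}`. -/
lemma angleInt_ode (x : ℝ) : I * angleInt 1 x + x * (angleInt 0 x - angleInt 2 x) = I := by
  have i (j : ℕ) : IntervalIntegrable
      (fun θ : ℝ => (Real.sin θ : ℂ) ^ j * cexp (I * (x * Real.sin θ))) volume 0 (Real.pi / 2) :=
    (by fun_prop : Continuous _).intervalIntegrable _ _
  have h := intervalIntegral.integral_eq_sub_of_hasDerivAt (a := 0) (b := Real.pi / 2)
    (f := fun θ : ℝ => -I * Real.cos θ * cexp (I * (x * Real.sin θ)))
    (f' := fun θ : ℝ => I * ((Real.sin θ : ℂ) ^ 1 * cexp (I * (x * Real.sin θ))) +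
      x * ((Real.sin θ : ℂ) ^ 0 * cexp (I * (x * Real.sin θ)) -
        (Real.sin θ : ℂ) ^ 2 * cexp (I * (x * Real.sin θ)))) (fun θ _ => by
      have h1 : HasDerivAt (fun θ : ℝ => (Real.sin θ : ℂ)) (Real.cos θ : ℂ) θ :=
        (Real.hasDerivAt_sin θ).ofReal_comp
      have h2 : HasDerivAt (fun θ : ℝ => (Real.cos θ : ℂ)) ((-Real.sin θ : ℝ) : ℂ) θ :=
        (Real.hasDerivAt_cos θ).ofReal_comp
      refine ((h2.const_mul (-I)).mul ((h1.const_mul (x : ℂ)).const_mul I).cexp).congr_deriv ?_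
      have h3 : (Real.cos θ : ℂ) ^ 2 = 1 - (Real.sin θ : ℂ) ^ 2 := by
        exact_mod_cast Real.cos_sq' θ
      push_cast at h3 ⊢
      linear_combination (-(I ^ 2) * x * cexp (I * (x * Complex.sin θ))) * h3 +
        (x * cexp (I * (x * Complex.sin θ)) * ((Complex.sin θ) ^ 2 - 1)) * I_sq)
    (by exact (by fun_prop : Continuous _).intervalIntegrable _ _)
  rw [intervalIntegral.integral_add ((i 1).const_mul _) (((i 0).sub (i 2)).const_mul _),
    intervalIntegral.integral_const_mul, intervalIntegral.integral_const_mul,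
    intervalIntegral.integral_sub (i 0) (i 2)] at h
  simpa [angleInt] using h

/-- Integral representation of the Hankel function. -/
theorem hankelH0_eq {x : ℝ} (hx : 0 < x) :
    hankelH0 x = 2 / Real.pi * (angleInt 0 x - I * laplaceInt 0 x) := by
  have hpi : (Real.pi : ℂ) ≠ 0 := by exact_mod_cast Real.pi_ne_zero
  set D : ℝ → ℂ := fun x => 2 / Real.pi * (angleInt 0 x - I * laplaceInt 0 x) - hankelH0 x with hD
  set D' : ℝ → ℂ := fun x => 2 / Real.pi * (I * angleInt 1 x + I * laplaceInt 1 x) -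
    (besselJ0' x + I * besselY0' x) with hD'
  have h1 : ∀ x, 0 < x → HasDerivAt D (D' x) x := by
    intro x hx
    have e1 := (hasDerivAt_laplaceInt 0 hx).ofReal_comp
    have e2 := (hasDerivAt_besselJ0 x).ofReal_comp
    have e3 := (hasDerivAt_besselY0 hx).ofReal_comp
    refine ((((hasDerivAt_angleInt 0 x).sub (e1.const_mul I)).const_mul (2 / (Real.pi : ℂ))).sub
      (e2.add (e3.const_mul I))).congr_deriv ?_
    simp only [hD']
    push_cast
    ring
  have h2 : ∀ x : ℝ, 0 < x → HasDerivAt (fun x : ℝ => (x : ℂ) * D' x) (-(x * D x)) x := by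
    intro x hx
    have e0 : HasDerivAt (fun x : ℝ => (x : ℂ)) 1 x := (hasDerivAt_id x).ofReal_comp
    have e1 := (hasDerivAt_laplaceInt 1 hx).ofReal_comp
    have e2 := (hasDerivAt_mul_besselJ0' x).ofReal_comp
    have e3 := (hasDerivAt_mul_besselY0' hx).ofReal_comp
    have e4 := e0.mul ((((hasDerivAt_angleInt 1 x).const_mul I).add (e1.const_mul I)).const_mul
      (2 / (Real.pi : ℂ)))
    refine (e4.sub (e2.add (e3.const_mul I))).congr_of_eventuallyEq
      (.of_forall fun y => ?_) |>.congr_deriv ?_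
    · simp only [hD', Pi.mul_apply, Pi.sub_apply, Pi.add_apply]
      push_cast
      ring
    · have a1 := angleInt_ode x
      have a2 : (x : ℂ) * ((laplaceInt 0 x : ℂ) + laplaceInt 2 x) - laplaceInt 1 x = 1 := by
        exact_mod_cast laplaceInt_ode hx
      simp only [hD, hankelH0, Pi.add_apply]
      push_cast
      linear_combination (2 / (Real.pi : ℂ)) * a1 - (2 / (Real.pi : ℂ)) * I * a2 +
        (2 / (Real.pi : ℂ)) * x * angleInt 2 x * I_sq
  have h0 : Filter.Tendsto D (nhdsWithin 0 (Set.Ioi 0)) (nhds 0) := by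
    have cj : Continuous besselJ0 :=
      continuous_iff_continuousAt.2 fun x => (hasDerivAt_besselJ0 x).continuousAt
    have cy : Continuous fun x : ℝ => seriesSum yCoeff (x ^ 2 / 4) :=
      (continuous_iff_continuousAt.2 fun z =>
        (hasDerivAt_seriesSum yCoeff_le z).continuousAt).comp (by fun_prop)
    have ca : Continuous (angleInt 0) :=
      continuous_iff_continuousAt.2 fun x => (hasDerivAt_angleInt 0 x).continuousAt
    have sz : ∀ a : ℕ → ℝ, seriesSum a 0 = a 0 := fun a => by
      rw [seriesSum, tsum_eq_single 0 (fun m hm => by simp [hm])]; simp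
    have j0 : besselJ0 0 = 1 := by rw [besselJ0_eq]; simp [sz, jCoeff]
    have y0 : seriesSum yCoeff (0 ^ 2 / 4) = 0 := by simp [sz, yCoeff]
    have a0 : angleInt 0 0 = Real.pi / 2 := by simp [angleInt]
    -- the logarithmic singularity of `J₀ log` is that of `log`, as `J₀ - 1` vanishes at `0`
    have hlog : Filter.Tendsto (fun x => (Real.log (x / 2) + Real.eulerMascheroniConstant) *
        (besselJ0 x - 1)) (nhdsWithin 0 (Set.Ioi 0)) (nhds 0) := by
      have d : Filter.Tendsto (fun x => x⁻¹ * (besselJ0 x - 1)) (nhdsWithin 0 (Set.Ioi 0))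
          (nhds (besselJ0' 0)) := by
        have := (hasDerivAt_besselJ0 0).tendsto_slope_zero_right
        simpa [j0] using this
      have l : Filter.Tendsto (fun x => (Real.log (x / 2) + Real.eulerMascheroniConstant) * x)
          (nhdsWithin 0 (Set.Ioi 0)) (nhds 0) := by
        have l1 : Filter.Tendsto (fun x => Real.log x * x) (nhdsWithin 0 (Set.Ioi 0)) (nhds 0) := by
          have := tendsto_log_mul_rpow_nhdsGT_zero (r := 1) one_pos
          simpa using this
        have l2 : Filter.Tendsto (fun x : ℝ => (Real.eulerMascheroniConstant - Real.log 2) * x)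
            (nhdsWithin 0 (Set.Ioi 0)) (nhds 0) := by
          have : Continuous fun x : ℝ => (Real.eulerMascheroniConstant - Real.log 2) * x := by
            fun_prop
          simpa using this.continuousAt.tendsto.mono_left (nhdsWithin_le_nhds (a := (0 : ℝ)))
        have := l1.add l2
        rw [add_zero] at this
        refine this.congr' ?_
        filter_upwards [self_mem_nhdsWithin] with x hx
        rw [Real.log_div (ne_of_gt hx) two_ne_zero]
        ring
      have := l.mul d
      rw [zero_mul] at this
      refine this.congr' ?_
      filter_upwards [self_mem_nhdsWithin] with x hx
      have : x ≠ 0 := ne_of_gt hx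
      field_simp
    have hB := tendsto_laplaceInt_zero_add_log
    have hre : Filter.Tendsto (fun x => 2 / Real.pi * ((laplaceInt 0 x + Real.log x) -
        (Real.log 2 - Real.eulerMascheroniConstant) +
        (Real.log (x / 2) + Real.eulerMascheroniConstant) * (besselJ0 x - 1)
        - seriesSum yCoeff (x ^ 2 / 4))) (nhdsWithin 0 (Set.Ioi 0)) (nhds 0) := by
      have c := (cy.tendsto 0).mono_left (nhdsWithin_le_nhds (s := Set.Ioi (0 : ℝ)))
      rw [y0] at c
      have := (((hB.sub_const (Real.log 2 - Real.eulerMascheroniConstant)).add hlog).sub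
        c).const_mul (2 / Real.pi)
      simpa using this
    have hA : Filter.Tendsto (fun x : ℝ => 2 / (Real.pi : ℂ) * angleInt 0 x - (besselJ0 x : ℂ))
        (nhdsWithin 0 (Set.Ioi 0)) (nhds 0) := by
      have : Continuous fun x : ℝ => 2 / (Real.pi : ℂ) * angleInt 0 x - (besselJ0 x : ℂ) := by
        fun_prop
      have := (this.tendsto 0).mono_left (nhdsWithin_le_nhds (s := Set.Ioi (0 : ℝ)))
      rwa [a0, j0, show (2 : ℂ) / Real.pi * (Real.pi / 2) - ((1 : ℝ) : ℂ) = 0 by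
        push_cast; field_simp; ring] at this
    have := hA.sub (((Complex.continuous_ofReal.tendsto 0).comp hre).const_mul I)
    simp only [Complex.ofReal_zero, mul_zero, sub_zero] at this
    refine this.congr' ?_
    filter_upwards [self_mem_nhdsWithin] with x hx
    simp only [hD, hankelH0, Function.comp, besselY0_eq, ← besselJ0_eq]
    rw [Real.log_div (ne_of_gt hx) two_ne_zero]
    push_cast
    ring
  exact (sub_eq_zero.1 (bessel_unique h1 h2 h0 hx)).symm

lemma hasDerivAt_hankelH0 {x : ℝ} (hx : 0 < x) :
    HasDerivAt hankelH0 (2 / Real.pi * I * (angleInt 1 x + laplaceInt 1 x)) x := by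
  refine (((hasDerivAt_angleInt 0 x).sub ((hasDerivAt_laplaceInt 0 hx).ofReal_comp.const_mul
    I)).const_mul (2 / (Real.pi : ℂ))).congr_of_eventuallyEq ?_ |>.congr_deriv ?_
  · filter_upwards [lt_mem_nhds hx] with y hy
    exact hankelH0_eq hy
  · push_cast
    ring

/-! ### The symbol of the outgoing Dirichlet-to-Neumann map -/

/-- The square root of `s - k²` with nonpositive real part and nonnegative imaginary part. -/
def sqrtSymb (k s : ℝ) : ℂ := -(√(s - k ^ 2) : ℂ) + I * (√(k ^ 2 - s) : ℂ)

lemma sqrtSymb_of_le {k s : ℝ} (h : k ^ 2 ≤ s) : sqrtSymb k s = -(√(s - k ^ 2) : ℂ) := by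
  rw [sqrtSymb, Real.sqrt_eq_zero_of_nonpos (x := k ^ 2 - s) (by linarith)]; simp

lemma sqrtSymb_of_ge {k s : ℝ} (h : s ≤ k ^ 2) : sqrtSymb k s = I * (√(k ^ 2 - s) : ℂ) := by
  rw [sqrtSymb, Real.sqrt_eq_zero_of_nonpos (x := s - k ^ 2) (by linarith)]; simp

@[simp] lemma sqrtSymb_re (k s : ℝ) : (sqrtSymb k s).re = -√(s - k ^ 2) := by simp [sqrtSymb]

@[simp] lemma sqrtSymb_im (k s : ℝ) : (sqrtSymb k s).im = √(k ^ 2 - s) := by simp [sqrtSymb]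

lemma sqrtSymb_sq (k s : ℝ) : sqrtSymb k s ^ 2 = ((s - k ^ 2 : ℝ) : ℂ) := by
  rcases le_total (k ^ 2) s with h | h
  · rw [sqrtSymb_of_le h, neg_sq]
    exact_mod_cast Real.sq_sqrt (sub_nonneg.2 h)
  · rw [sqrtSymb_of_ge h, mul_pow, I_sq]
    have := Real.sq_sqrt (sub_nonneg.2 h)
    rw [← Complex.ofReal_pow, this]
    push_cast; ring

lemma norm_sqrtSymb (k s : ℝ) : ‖sqrtSymb k s‖ = √|s - k ^ 2| := by
  rw [← Real.sqrt_sq (norm_nonneg (sqrtSymb k s)), ← norm_pow, sqrtSymb_sq, Complex.norm_real,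
    Real.norm_eq_abs]

lemma norm_sqrtSymb_le {k s : ℝ} (hk : 0 ≤ k) (hs : 0 ≤ s) : ‖sqrtSymb k (s ^ 2)‖ ≤ k + s := by
  rw [norm_sqrtSymb]
  refine Real.sqrt_le_iff.2 ⟨by positivity, abs_le.2 ⟨?_, ?_⟩⟩ <;> nlinarith

lemma continuous_sqrtSymb (k : ℝ) : Continuous (sqrtSymb k) := by
  unfold sqrtSymb; fun_prop

lemma hasDerivAt_sqrtSymb {k s : ℝ} (hs : s ≠ k ^ 2) :
    HasDerivAt (sqrtSymb k) (1 / (2 * sqrtSymb k s)) s := by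
  rcases hs.lt_or_gt with h | h
  · have h0 : 0 < k ^ 2 - s := sub_pos.2 h
    have h1 : HasDerivAt (fun s => √(k ^ 2 - s)) (-1 / (2 * √(k ^ 2 - s))) s :=
      ((hasDerivAt_id s).const_sub (k ^ 2)).sqrt h0.ne'
    refine (h1.ofReal_comp.const_mul I).congr_of_eventuallyEq ?_ |>.congr_deriv ?_
    · filter_upwards [gt_mem_nhds h] with t ht
      exact sqrtSymb_of_ge ht.le
    · rw [sqrtSymb_of_ge h.le]
      have : (√(k ^ 2 - s) : ℂ) ≠ 0 := by exact_mod_cast (Real.sqrt_pos.2 h0).ne'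
      push_cast
      field_simp
      simp
  · have h0 : 0 < s - k ^ 2 := sub_pos.2 h
    have h1 : HasDerivAt (fun s => √(s - k ^ 2)) (1 / (2 * √(s - k ^ 2))) s :=
      ((hasDerivAt_id s).sub_const (k ^ 2)).sqrt h0.ne'
    refine h1.ofReal_comp.neg.congr_of_eventuallyEq ?_ |>.congr_deriv ?_
    · filter_upwards [lt_mem_nhds h] with t ht
      exact sqrtSymb_of_le ht.le
    · rw [sqrtSymb_of_le h.le]
      have : (√(s - k ^ 2) : ℂ) ≠ 0 := by exact_mod_cast (Real.sqrt_pos.2 h0).ne'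
      push_cast
      field_simp

/-- The function `e^{ωt} (ωt - 1)`, a primitive of `t² e^{ωt} / 2` with respect to `s`. -/
def symbPrim (k t s : ℝ) : ℂ := cexp (sqrtSymb k s * t) * (sqrtSymb k s * t - 1)

/-- Although `ω` is not differentiable at `s = k²`, the function `e^{ωt} (ωt - 1)` is, since the
singular factor `1 / ω` in `dω / ds` cancels. -/
lemma hasDerivAt_symbPrim (k t s : ℝ) :
    HasDerivAt (symbPrim k t) (t ^ 2 / 2 * cexp (sqrtSymb k s * t)) s := by
  have hc := continuous_sqrtSymb k
  have hne : ∀ s, s ≠ k ^ 2 →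
      HasDerivAt (symbPrim k t) (t ^ 2 / 2 * cexp (sqrtSymb k s * t)) s := by
    intro s hs
    have h1 := (hasDerivAt_sqrtSymb hs).mul_const (t : ℂ)
    refine (h1.cexp.mul (h1.sub_const 1)).congr_deriv ?_
    have : sqrtSymb k s ≠ 0 := by
      intro h
      have h2 := sqrtSymb_sq k s
      rw [h, zero_pow two_ne_zero] at h2
      have : s - k ^ 2 = 0 := by exact_mod_cast h2.symm
      exact hs (by linarith)
    field_simp
    ring
  by_cases hs : s = k ^ 2
  · subst hs
    refine hasDerivAt_of_hasDerivAt_of_ne (g := fun s => (t : ℂ) ^ 2 / 2 * cexp (sqrtSymb k s * t))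
      (fun y hy => hne y hy) ?_ ?_
    · unfold symbPrim; fun_prop
    · fun_prop
  · exact hne s hs

section Space
variable {n : ℕ}

/-- The symbol `ω(η) = √(|ξ|² - k²)`, `ξ = 2πη`, with the branch of `sqrtSymb`: the outgoing
solution in the upper half-space with trace `φ` has the partial Fourier transform `e^{ωt} 𝓕 φ`. -/
def symb (k : ℝ) (η : Hyper n) : ℂ := sqrtSymb k ((2 * Real.pi * ‖η‖) ^ 2)

lemma continuous_symb (k : ℝ) : Continuous (symb k : Hyper n → ℂ) :=
  (continuous_sqrtSymb k).comp (by fun_prop)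

lemma norm_symb_le {k : ℝ} (hk : 0 ≤ k) (η : Hyper n) : ‖symb k η‖ ≤ (k + 7) * (1 + ‖η‖) := by
  have h := norm_sqrtSymb_le hk (s := 2 * Real.pi * ‖η‖) (by positivity)
  have : 2 * Real.pi * ‖η‖ ≤ 7 * ‖η‖ := by
    have := Real.pi_lt_d2
    gcongr
    linarith
  refine h.trans ?_
  nlinarith [norm_nonneg η]

lemma neg_re_symb_ge {k : ℝ} (hk : 0 ≤ k) (η : Hyper n) : ‖η‖ - k ≤ -(symb k η).re := by
  rw [symb, sqrtSymb_re, neg_neg]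
  have h3 : 1 ≤ 2 * Real.pi := by linarith [Real.pi_gt_three]
  have h : ‖η‖ ≤ 2 * Real.pi * ‖η‖ := le_mul_of_one_le_left (norm_nonneg η) h3
  rcases le_total ‖η‖ k with h1 | h1
  · linarith [Real.sqrt_nonneg ((2 * Real.pi * ‖η‖) ^ 2 - k ^ 2)]
  · refine Real.le_sqrt_of_sq_le ?_
    nlinarith [norm_nonneg η]

lemma re_symb_nonpos (k : ℝ) (η : Hyper n) : (symb k η).re ≤ 0 := by
  rw [symb, sqrtSymb_re]; exact neg_nonpos.2 (Real.sqrt_nonneg _)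

/-! ### Superpositions of plane and evanescent waves -/

/-- The phase `z ↦ 2πi x·η + σ ω(η) τ`, `z = (x, τ)`, as a linear map. -/
def phase (k σ : ℝ) (η : Hyper n) : Space n →L[ℝ] ℂ :=
  (2 * Real.pi * I : ℂ) • (ofRealCLM ∘L innerSL ℝ η ∘L ContinuousLinearMap.fst ℝ (Hyper n) ℝ) +
    (σ * symb k η) • (ofRealCLM ∘L ContinuousLinearMap.snd ℝ (Hyper n) ℝ)

lemma phase_apply (k σ : ℝ) (η : Hyper n) (z : Space n) :
    phase k σ η z = 2 * Real.pi * I * (inner ℝ η z.1 : ℝ) + σ * symb k η * z.2 := by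
  simp [phase]

lemma continuous_phase (k σ : ℝ) : Continuous (phase k σ : Hyper n → Space n →L[ℝ] ℂ) := by
  have h := continuous_symb (n := n) k
  have h2 : Continuous fun η : Hyper n => (ofRealCLM ∘L innerSL ℝ η ∘L
      ContinuousLinearMap.fst ℝ (Hyper n) ℝ : Space n →L[ℝ] ℂ) :=
    (ContinuousLinearMap.compL ℝ (Space n) ℝ ℂ ofRealCLM).continuous.comp
      (((ContinuousLinearMap.compL ℝ (Space n) (Hyper n) ℝ).flip
        (ContinuousLinearMap.fst ℝ (Hyper n) ℝ)).continuous.comp (innerSL ℝ).continuous)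
  unfold phase
  fun_prop

lemma norm_phase_le {k : ℝ} (hk : 0 ≤ k) (σ : ℝ) (η : Hyper n) :
    ‖phase k σ η‖ ≤ (7 + |σ| * (k + 7)) * (1 + ‖η‖) := by
  refine ContinuousLinearMap.opNorm_le_bound _ (by positivity) fun z => ?_
  rw [phase_apply]
  have h1 : ‖(2 * Real.pi * I * (inner ℝ η z.1 : ℝ) : ℂ)‖ ≤ 7 * (1 + ‖η‖) * ‖z‖ := by
    have e : ‖(2 * Real.pi * I * (inner ℝ η z.1 : ℝ) : ℂ)‖ = 2 * Real.pi * |inner ℝ η z.1| := by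
      rw [norm_mul, norm_mul, norm_mul, norm_I, Complex.norm_real, Complex.norm_real]
      simp [Real.pi_pos.le]
    have a : |inner ℝ η z.1| ≤ (1 + ‖η‖) * ‖z‖ :=
      (abs_real_inner_le_norm _ _).trans (mul_le_mul (by linarith) (norm_fst_le z) (norm_nonneg _)
        (by positivity))
    have := Real.pi_lt_d2
    rw [e, mul_assoc 7]
    exact mul_le_mul (by linarith) a (abs_nonneg _) (by norm_num)
  have h2 : ‖(σ * symb k η * z.2 : ℂ)‖ ≤ |σ| * (k + 7) * (1 + ‖η‖) * ‖z‖ := by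
    rw [norm_mul, norm_mul, Complex.norm_real, Complex.norm_real, Real.norm_eq_abs, mul_assoc |σ| (k + 7)]
    have := norm_symb_le hk η
    have hz := norm_snd_le z
    exact mul_le_mul (mul_le_mul_of_nonneg_left this (abs_nonneg σ)) hz (norm_nonneg _)
      (by positivity)
  calc _ ≤ _ := norm_add_le _ _
    _ ≤ 7 * (1 + ‖η‖) * ‖z‖ + |σ| * (k + 7) * (1 + ‖η‖) * ‖z‖ := add_le_add h1 h2
    _ = _ := by ring

lemma norm_cexp_phase (k σ : ℝ) (η : Hyper n) (z : Space n) :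
    ‖cexp (phase k σ η z)‖ = Real.exp (σ * z.2 * (symb k η).re) := by
  rw [Complex.norm_exp, phase_apply]
  congr 1
  simp
  ring

lemma norm_cexp_phase_le {k σ δ : ℝ} (hk : 0 ≤ k) (hδ : 0 ≤ δ) (η : Hyper n) {z : Space n}
    (hz : δ ≤ σ * z.2) : ‖cexp (phase k σ η z)‖ ≤ Real.exp (δ * k) * Real.exp (-δ * ‖η‖) := by
  rw [norm_cexp_phase, ← Real.exp_add]
  refine Real.exp_le_exp.2 ?_
  nlinarith [neg_re_symb_ge hk η, re_symb_nonpos k η]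

lemma continuous_cexp_phase (k σ : ℝ) (z : Space n) :
    Continuous fun η : Hyper n => cexp (phase k σ η z) := by
  have := continuous_phase (n := n) k σ
  fun_prop

variable {G : Type} [NormedAddCommGroup G]

/-- A density that is integrable against every exponentially decaying weight. -/
def ExpIntegrable (m : Hyper n → G) : Prop :=
  AEStronglyMeasurable m ∧ ∀ δ : ℝ, 0 < δ → Integrable fun η => Real.exp (-δ * ‖η‖) * ‖m η‖

lemma pow_mul_exp_neg_le (j : ℕ) {δ r : ℝ} (hδ : 0 < δ) (hr : 0 ≤ r) :
    (1 + r) ^ j * Real.exp (-δ * r) ≤ j.factorial / δ ^ j * Real.exp δ := by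
  have h := Real.pow_div_factorial_le_exp (x := δ * (1 + r)) (by positivity) j
  rw [div_le_iff₀ (by positivity), mul_pow] at h
  have e : Real.exp (δ * (1 + r)) = Real.exp δ * (Real.exp (-δ * r))⁻¹ := by
    rw [← Real.exp_neg, ← Real.exp_add]; congr 1; ring
  rw [e] at h
  have hp := Real.exp_pos (-δ * r)
  rw [div_mul_eq_mul_div, le_div_iff₀ (by positivity)]
  calc (1 + r) ^ j * Real.exp (-δ * r) * δ ^ j
      = δ ^ j * (1 + r) ^ j * Real.exp (-δ * r) := by ring
    _ ≤ Real.exp δ * (Real.exp (-δ * r))⁻¹ * j.factorial * Real.exp (-δ * r) := by gcongr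
    _ = _ := by field_simp

lemma ExpIntegrable.of_le {G' : Type} [NormedAddCommGroup G'] {m : Hyper n → G}
    {m' : Hyper n → G'} (hm : ExpIntegrable m) (h' : AEStronglyMeasurable m') {C : ℝ}
    (h : ∀ η, ‖m' η‖ ≤ C * (1 + ‖η‖) * ‖m η‖) : ExpIntegrable m' := by
  refine ⟨h', fun δ hδ => ?_⟩
  have hi := (hm.2 (δ / 2) (by positivity)).const_mul (|C| * (1 / (δ / 2) * Real.exp (δ / 2)))
  refine hi.mono' ((by fun_prop : Continuous fun η : Hyper n =>
    Real.exp (-δ * ‖η‖)).aestronglyMeasurable.mul h'.norm) (.of_forall fun η => ?_)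
  rw [norm_mul, Real.norm_of_nonneg (Real.exp_pos _).le, norm_norm]
  have h1 := pow_mul_exp_neg_le 1 (half_pos hδ) (norm_nonneg η)
  rw [pow_one, pow_one, Nat.factorial_one, Nat.cast_one] at h1
  have e : Real.exp (-δ * ‖η‖) = Real.exp (-(δ / 2) * ‖η‖) * Real.exp (-(δ / 2) * ‖η‖) := by
    rw [← Real.exp_add]; congr 1; ring
  calc Real.exp (-δ * ‖η‖) * ‖m' η‖
      ≤ Real.exp (-δ * ‖η‖) * (|C| * (1 + ‖η‖) * ‖m η‖) := by
        gcongr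
        exact (h η).trans (by gcongr; exact le_abs_self C)
    _ = |C| * ((1 + ‖η‖) * Real.exp (-(δ / 2) * ‖η‖)) * (Real.exp (-(δ / 2) * ‖η‖) * ‖m η‖) := by
        rw [e]; ring
    _ ≤ _ := by gcongr

lemma integrable_pow_mul_exp_neg (j : ℕ) {δ : ℝ} (hδ : 0 < δ) :
    Integrable fun η : Hyper n => (1 + ‖η‖) ^ j * Real.exp (-δ * ‖η‖) := by
  set N := Module.finrank ℝ (Hyper n) + 1
  have h := (integrable_one_add_norm (E := Hyper n) (μ := volume) (r := N)
    (by simp [N])).const_mul ((j + N).factorial / δ ^ (j + N) * Real.exp δ)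
  refine h.mono' (by fun_prop : Continuous _).aestronglyMeasurable (.of_forall fun η => ?_)
  rw [Real.norm_of_nonneg (by positivity), Real.rpow_neg (by positivity), Real.rpow_natCast,
    ← div_eq_mul_inv, le_div_iff₀ (by positivity)]
  refine le_trans (le_of_eq ?_) (pow_mul_exp_neg_le (j + N) hδ (norm_nonneg η))
  rw [pow_add]; ring

lemma expIntegrable_const (c : G) : ExpIntegrable (fun _ : Hyper n => c) :=
  ⟨aestronglyMeasurable_const, fun δ hδ => by
    simpa using (integrable_pow_mul_exp_neg (n := n) 0 hδ).mul_const ‖c‖⟩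

variable [NormedSpace ℂ G]

/-- The superposition `z ↦ ∫ e^{2πi x·η + σ ω(η) τ} m(η) dη`, `z = (x, τ)`, of plane and evanescent
waves, which is outgoing in the half-space `στ > 0`. -/
def pot (k σ : ℝ) (m : Hyper n → G) (z : Space n) : G := ∫ η, cexp (phase k σ η z) • m η

lemma pot_integrable {k σ : ℝ} (hk : 0 ≤ k) {m : Hyper n → G} (hm : ExpIntegrable m) {z : Space n}
    (hz : z ∈ halfSpace n σ) : Integrable fun η => cexp (phase k σ η z) • m η := by
  refine ((hm.2 (σ * z.2) hz).const_mul (Real.exp (σ * z.2 * k))).mono'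
    ((continuous_cexp_phase k σ z).aestronglyMeasurable.smul hm.1) (.of_forall fun η => ?_)
  rw [norm_smul, ← mul_assoc]
  gcongr
  exact norm_cexp_phase_le hk (le_of_lt hz) η le_rfl

/-- The density of the derivative of `pot k σ m`. -/
def potDeriv (k σ : ℝ) (m : Hyper n → G) (η : Hyper n) : Space n →L[ℝ] G :=
  ((ContinuousLinearMap.lsmul ℝ ℂ).flip (m η)) ∘L phase k σ η

lemma potDeriv_apply (k σ : ℝ) (m : Hyper n → G) (η : Hyper n) (v : Space n) :
    potDeriv k σ m η v = phase k σ η v • m η := rfl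

lemma expIntegrable_potDeriv {k : ℝ} (hk : 0 ≤ k) (σ : ℝ) {m : Hyper n → G}
    (hm : ExpIntegrable m) : ExpIntegrable (potDeriv k σ m) := by
  refine hm.of_le (C := 7 + |σ| * (k + 7)) ?_ fun η => ?_
  · exact (ContinuousLinearMap.compL ℝ (Space n) ℂ G).aestronglyMeasurable_comp₂
      ((ContinuousLinearMap.lsmul ℝ ℂ).flip.continuous.comp_aestronglyMeasurable hm.1)
      (continuous_phase k σ).aestronglyMeasurable
  · refine ContinuousLinearMap.opNorm_le_bound _ (by positivity) fun v => ?_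
    rw [potDeriv_apply, norm_smul, mul_right_comm]
    gcongr
    exact ((phase k σ η).le_opNorm v).trans (by gcongr; exact norm_phase_le hk σ η)

lemma isOpen_halfSpace (n : ℕ) (σ : ℝ) : IsOpen (halfSpace n σ) :=
  isOpen_lt (by fun_prop) (by fun_prop)

lemma hasFDerivAt_pot [CompleteSpace G] {k σ : ℝ} (hk : 0 ≤ k) {m : Hyper n → G}
    (hm : ExpIntegrable m) {z : Space n} (hz : z ∈ halfSpace n σ) :
    HasFDerivAt (pot k σ m) (pot k σ (potDeriv k σ m) z) z := by
  have hz' : 0 < σ * z.2 := hz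
  have hm' := expIntegrable_potDeriv hk σ hm
  set δ := σ * z.2 / 2
  have hδ : 0 < δ := by positivity
  refine hasFDerivAt_integral_of_dominated_of_fderiv_le (𝕜 := ℝ)
    (s := {y : Space n | δ < σ * y.2})
    (bound := fun η => Real.exp (δ * k) * (Real.exp (-δ * ‖η‖) * ‖potDeriv k σ m η‖))
    ((isOpen_lt (by fun_prop) (by fun_prop)).mem_nhds (half_lt_self hz'))
    (.of_forall fun y => (continuous_cexp_phase k σ y).aestronglyMeasurable.smul hm.1)
    (pot_integrable hk hm hz)
    ((continuous_cexp_phase k σ z).aestronglyMeasurable.smul hm'.1)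
    (F' := fun y η => cexp (phase k σ η y) • potDeriv k σ m η)
    (.of_forall fun η y hy => ?_) ((hm'.2 δ hδ).const_mul _) (.of_forall fun η y _ => ?_)
  · rw [norm_smul, ← mul_assoc]
    gcongr
    exact norm_cexp_phase_le hk hδ.le η (le_of_lt hy)
  · have h := ((phase k σ η).hasFDerivAt (x := y)).cexp.smul_const (m η)
    refine h.congr_fderiv ?_
    ext v <;> simp [potDeriv_apply, mul_smul]

lemma contDiffOn_pot {k σ : ℝ} (hk : 0 ≤ k) (N : ℕ) :
    ∀ {G : Type} [NormedAddCommGroup G] [NormedSpace ℂ G] [CompleteSpace G] {m : Hyper n → G},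
      ExpIntegrable m → ContDiffOn ℝ N (pot k σ m) (halfSpace n σ) := by
  induction N with
  | zero =>
    intro G _ _ _ m hm
    exact contDiffOn_zero.2 fun z hz => (hasFDerivAt_pot hk hm hz).continuousAt.continuousWithinAt
  | succ N ih =>
    intro G _ _ _ m hm
    push_cast
    refine (contDiffOn_succ_iff_fderiv_of_isOpen (isOpen_halfSpace n σ)).2
      ⟨fun z hz => (hasFDerivAt_pot hk hm hz).differentiableAt.differentiableWithinAt, by simp, ?_⟩
    exact (ih (expIntegrable_potDeriv hk σ hm)).congr fun z hz => (hasFDerivAt_pot hk hm hz).fderiv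

lemma fderiv_pot_apply {k σ : ℝ} (hk : 0 ≤ k) {m : Hyper n → ℂ}
    (hm : ExpIntegrable m) {z : Space n} (hz : z ∈ halfSpace n σ) (v : Space n) :
    fderiv ℝ (pot k σ m) z v = pot k σ (fun η => phase k σ η v * m η) z := by
  rw [(hasFDerivAt_pot hk hm hz).fderiv, pot, ContinuousLinearMap.integral_apply
    (pot_integrable hk (expIntegrable_potDeriv hk σ hm) hz)]
  rfl

lemma expIntegrable_phase_mul {k : ℝ} (hk : 0 ≤ k) (σ : ℝ) {m : Hyper n → ℂ}
    (hm : ExpIntegrable m) (v : Space n) : ExpIntegrable fun η => phase k σ η v * m η := by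
  refine hm.of_le (C := (7 + |σ| * (k + 7)) * ‖v‖) ?_ fun η => ?_
  · have := continuous_phase (n := n) k σ
    exact (by fun_prop : Continuous fun η : Hyper n => phase k σ η v).aestronglyMeasurable.mul hm.1
  · rw [norm_mul]
    gcongr
    refine ((phase k σ η).le_opNorm v).trans ?_
    rw [mul_right_comm]
    gcongr
    exact norm_phase_le hk σ η

end Space

/-! ### The double layer kernel as a superposition of waves -/

section Kernel
variable {n : ℕ}

/-- The kernel of the double layer potential in the upper half-space, in Fourier representation. -/
def kern (k : ℝ) (z : Space n) : ℂ := pot k 1 (fun _ => (1 / 2 : ℂ)) z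

lemma symbPrim_symb (k t : ℝ) (η : Hyper n) :
    symbPrim k t ((2 * Real.pi * ‖η‖) ^ 2) = cexp (symb k η * t) * (symb k η * t - 1) := rfl

lemma cexp_phase_one (k : ℝ) (η x : Hyper n) (t : ℝ) : cexp (phase k 1 η (x, t)) =
    cexp (2 * Real.pi * I * (inner ℝ η x : ℝ)) * cexp (symb k η * t) := by
  rw [phase_apply, Complex.exp_add]; simp

lemma hasLineDerivAt_symbPrim (k t : ℝ) (η e : Hyper n) :
    HasLineDerivAt ℝ (fun η : Hyper n => symbPrim k t ((2 * Real.pi * ‖η‖) ^ 2))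
      (4 * Real.pi ^ 2 * t ^ 2 * (inner ℝ η e : ℝ) * cexp (symb k η * t)) η e := by
  have hN : HasDerivAt (fun s : ℝ => (2 * Real.pi * ‖η + s • e‖) ^ 2)
      (8 * Real.pi ^ 2 * inner ℝ η e) 0 := by
    have h1 : ∀ s : ℝ, (2 * Real.pi * ‖η + s • e‖) ^ 2 =
        4 * Real.pi ^ 2 * (‖η‖ ^ 2 + s * (2 * inner ℝ η e) + s ^ 2 * ‖e‖ ^ 2) := fun s => by
      simp only [mul_pow, norm_add_sq_real, inner_smul_right, norm_smul, Real.norm_eq_abs, sq_abs]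
      ring
    simp_rw [h1]
    refine ((((hasDerivAt_id (0 : ℝ)).mul_const (2 * inner ℝ η e)).const_add (‖η‖ ^ 2)).add
      ((hasDerivAt_pow 2 (0 : ℝ)).mul_const (‖e‖ ^ 2))).const_mul (4 * Real.pi ^ 2) |>.congr_deriv ?_
    simp; ring
  have h := HasDerivAt.scomp (0 : ℝ) (hasDerivAt_symbPrim k t _) hN
  unfold HasLineDerivAt
  refine h.congr_deriv ?_
  simp only [zero_smul, add_zero, Complex.real_smul, symb]
  push_cast
  ring

/-- Integration by parts in Fourier space: the infinitesimal form of the fact that `kern (x, t) / t`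
depends on `‖x‖² + t²` only. -/
lemma kern_rotation {k : ℝ} (hk : 0 ≤ k) (x e : Hyper n) {t : ℝ} (ht : 0 < t) :
    (t : ℂ) ^ 2 * fderiv ℝ (kern k) (x, t) (e, 0) + (inner ℝ x e : ℝ) * kern k (x, t)
      - t * (inner ℝ x e : ℝ) * fderiv ℝ (kern k) ((x, t) : Space n) (0, 1) = 0 := by
  have hz : ((x, t) : Space n) ∈ halfSpace n 1 := by simpa [halfSpace] using ht
  have hc := expIntegrable_const (n := n) (1 : ℂ)
  have hc2 := expIntegrable_const (n := n) (1 / 2 : ℂ)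
  have he := expIntegrable_phase_mul hk 1 hc ((e, 0) : Space n)
  have hω := expIntegrable_phase_mul hk 1 hc ((0, 1) : Space n)
  have I0 := pot_integrable hk hc hz
  have I1 := pot_integrable hk he hz
  have I2 := pot_integrable hk hω hz
  simp only [phase_apply, smul_eq_mul, mul_one, inner_zero_right, ofReal_zero, mul_zero, add_zero,
    zero_add, ofReal_one, one_mul] at I0 I1 I2
  have hpi : (2 * Real.pi * I : ℂ) ≠ 0 := Complex.two_pi_I_ne_zero
  have hex : ∀ η : Hyper n, cexp (2 * Real.pi * I * (inner ℝ η x : ℝ) + symb k η * t) =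
      cexp (2 * Real.pi * I * (inner ℝ η x : ℝ)) * cexp (symb k η * t) := fun η =>
    Complex.exp_add _ _
  have key := integral_bilinear_hasLineDerivAt_right_eq_neg_left_of_integrable
    (μ := (volume : Measure (Hyper n))) (B := ContinuousLinearMap.mul ℝ ℂ) (v := e)
    (f := fun η => cexp (2 * Real.pi * I * (inner ℝ η x : ℝ)))
    (f' := fun η => 2 * Real.pi * I * (inner ℝ x e : ℝ) *
      cexp (2 * Real.pi * I * (inner ℝ η x : ℝ)))
    (g := fun η : Hyper n => symbPrim k t ((2 * Real.pi * ‖η‖) ^ 2))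
    (g' := fun η => 4 * Real.pi ^ 2 * t ^ 2 * (inner ℝ η e : ℝ) * cexp (symb k η * t))
    ?_ ?_ ?_ ?_ ?_
  · simp only [ContinuousLinearMap.mul_apply'] at key
    have e1 : ∫ η : Hyper n, cexp (2 * Real.pi * I * (inner ℝ η x : ℝ)) *
        (4 * Real.pi ^ 2 * t ^ 2 * (inner ℝ η e : ℝ) * cexp (symb k η * t)) =
        -(2 * Real.pi * I) * t ^ 2 * ∫ η : Hyper n, cexp (2 * Real.pi * I * (inner ℝ η x : ℝ) +
          symb k η * t) * (2 * Real.pi * I * (inner ℝ η e : ℝ)) := by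
      rw [← integral_const_mul]
      congr 1; ext η
      rw [hex]
      linear_combination (4 * (Real.pi : ℂ) ^ 2 * t ^ 2 * (inner ℝ η e : ℝ) *
        cexp (2 * Real.pi * I * (inner ℝ η x : ℝ)) * cexp (symb k η * t)) * (I_sq)
    have e2 : ∫ η : Hyper n, 2 * Real.pi * I * (inner ℝ x e : ℝ) *
        cexp (2 * Real.pi * I * (inner ℝ η x : ℝ)) * symbPrim k t ((2 * Real.pi * ‖η‖) ^ 2) =
        2 * Real.pi * I * (inner ℝ x e : ℝ) * (t * ∫ η : Hyper n,
          cexp (2 * Real.pi * I * (inner ℝ η x : ℝ) + symb k η * t) * symb k η) -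
        2 * Real.pi * I * (inner ℝ x e : ℝ) * ∫ η : Hyper n,
          cexp (2 * Real.pi * I * (inner ℝ η x : ℝ) + symb k η * t) := by
      rw [← integral_const_mul, ← integral_const_mul, ← integral_const_mul,
        ← integral_sub ((I2.const_mul _).const_mul _) (I0.const_mul _)]
      congr 1; ext η
      rw [hex, symbPrim_symb]
      ring
    rw [e1, e2] at key
    rw [kern, show fderiv ℝ (kern k) ((x, t) : Space n) = fderiv ℝ (pot k 1 fun _ => (1 / 2 : ℂ))
      (x, t) from rfl, fderiv_pot_apply hk hc2 hz, fderiv_pot_apply hk hc2 hz]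
    simp only [pot, phase_apply, smul_eq_mul, inner_zero_right, ofReal_zero, mul_zero, add_zero,
      zero_add, ofReal_one, one_mul, mul_one, ← mul_assoc, integral_mul_const]
    refine mul_left_cancel₀ hpi ?_
    simp only [← mul_assoc] at key
    linear_combination (-1 / 2 : ℂ) * key
  · simp only [ContinuousLinearMap.mul_apply']
    refine ((I2.const_mul (t : ℂ)).sub I0).const_mul (2 * Real.pi * I * (inner ℝ x e : ℝ)) |>.congr
      (.of_forall fun η => ?_)
    simp only [Pi.sub_apply]
    rw [hex, symbPrim_symb]
    ring
  · simp only [ContinuousLinearMap.mul_apply']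
    refine I1.const_mul (-(2 * Real.pi * I) * (t : ℂ) ^ 2) |>.congr (.of_forall fun η => ?_)
    simp only
    rw [hex]
    linear_combination (-4 * (Real.pi : ℂ) ^ 2 * t ^ 2 * (inner ℝ η e : ℝ) *
        cexp (2 * Real.pi * I * (inner ℝ η x : ℝ)) * cexp (symb k η * t)) * (I_sq)
  · simp only [ContinuousLinearMap.mul_apply']
    refine ((I2.const_mul (t : ℂ)).sub I0).congr (.of_forall fun η => ?_)
    simp only [Pi.sub_apply]
    rw [hex, symbPrim_symb]
    ring
  · intro η _
    have h1 : HasDerivAt (fun s : ℝ => (2 * Real.pi * I * (inner ℝ (η + s • e) x : ℝ) : ℂ))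
        (2 * Real.pi * I * (inner ℝ x e : ℝ)) 0 := by
      have : ∀ s : ℝ, (2 * Real.pi * I * (inner ℝ (η + s • e) x : ℝ) : ℂ) =
          2 * Real.pi * I * (inner ℝ η x : ℝ) + (s : ℂ) * (2 * Real.pi * I * (inner ℝ x e : ℝ)) :=
        fun s => by
          rw [inner_add_left, inner_smul_left, real_inner_comm x e]; simp; ring
      simp_rw [this]
      simpa using ((hasDerivAt_id (0 : ℝ)).ofReal_comp.mul_const
        (2 * Real.pi * I * (inner ℝ x e : ℝ) : ℂ)).const_add (2 * Real.pi * I * (inner ℝ η x : ℝ))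
    unfold HasLineDerivAt
    refine h1.cexp.congr_deriv ?_
    simp only [zero_smul, add_zero]
    ring
  · intro η _
    exact hasLineDerivAt_symbPrim k t η e

/-- `kern (x, t) / t` depends on `r² = ‖x‖² + t²` only. -/
lemma kern_eq_axis {k : ℝ} (hk : 0 ≤ k) (x : Hyper n) {t : ℝ} (ht : 0 < t) :
    kern k (x, t) = t / √(‖x‖ ^ 2 + t ^ 2) * kern k ((0 : Hyper n), √(‖x‖ ^ 2 + t ^ 2)) := by
  set τ : ℝ → ℝ := fun s => √(‖x‖ ^ 2 + t ^ 2 - s ^ 2 * ‖x‖ ^ 2) with hτ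
  have hrad : ∀ s ∈ Set.Icc (0 : ℝ) 1, 0 < ‖x‖ ^ 2 + t ^ 2 - s ^ 2 * ‖x‖ ^ 2 := by
    intro s hs
    have : s ^ 2 ≤ 1 := by nlinarith [hs.1, hs.2]
    nlinarith [sq_nonneg ‖x‖, sq_pos_of_pos ht]
  have hτ0 : ∀ s ∈ Set.Icc (0 : ℝ) 1, 0 < τ s := fun s hs => Real.sqrt_pos.2 (hrad s hs)
  have hd : ∀ s ∈ Set.Icc (0 : ℝ) 1,
      HasDerivAt (fun s => kern k (s • x, τ s) / (τ s : ℂ)) 0 s := by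
    intro s hs
    have hz : ((s • x, τ s) : Space n) ∈ halfSpace n 1 := by simpa [halfSpace] using hτ0 s hs
    have hτ' : HasDerivAt τ (-s * ‖x‖ ^ 2 / τ s) s := by
      have h := (((hasDerivAt_pow 2 s).mul_const (‖x‖ ^ 2)).const_sub (‖x‖ ^ 2 + t ^ 2)).sqrt
        (hrad s hs).ne'
      refine h.congr_deriv ?_
      have := (hτ0 s hs).ne'
      simp only [hτ] at this ⊢
      field_simp
      norm_num
      ring_nf
    have hF := (hasFDerivAt_pot (σ := 1) hk (expIntegrable_const (n := n) (1 / 2 : ℂ))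
      hz).differentiableAt.hasFDerivAt
    have hpath : HasDerivAt (fun s => ((s • x, τ s) : Space n)) ((x, -s * ‖x‖ ^ 2 / τ s) : Space n)
        s := by
      have := ((hasDerivAt_id s).smul_const x).prodMk hτ'
      simpa using this
    have hcomp := hF.comp_hasDerivAt s hpath
    have hne : (τ s : ℂ) ≠ 0 := by exact_mod_cast (hτ0 s hs).ne'
    refine (hcomp.div hτ'.ofReal_comp hne).congr_deriv ?_
    have hsplit : ((x, -s * ‖x‖ ^ 2 / τ s) : Space n) =
        (x, 0) + (-s * ‖x‖ ^ 2 / τ s) • ((0, 1) : Space n) := by simp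
    have hrot := kern_rotation hk (s • x) x (hτ0 s hs)
    rw [inner_smul_left, real_inner_self_eq_norm_sq] at hrot
    rw [hsplit, map_add, map_smul]
    simp only [Function.comp, Complex.real_smul]
    rw [div_eq_zero_iff]
    left
    have hkern : (pot k 1 fun _ : Hyper n => (1 / 2 : ℂ)) = kern k := rfl
    rw [hkern]
    push_cast at hrot ⊢
    simp only [conj_trivial] at hrot
    field_simp
    linear_combination hrot
  have h := constant_of_has_deriv_right_zero (a := (0 : ℝ)) (b := 1)
    (fun s hs => (hd s hs).continuousAt.continuousWithinAt)
    (fun s hs => (hd s ⟨hs.1, hs.2.le⟩).hasDerivWithinAt) 1 ⟨zero_le_one, le_rfl⟩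
  have h1 : τ 1 = t := by simp [hτ, Real.sqrt_sq ht.le]
  have h0 : τ 0 = √(‖x‖ ^ 2 + t ^ 2) := by simp [hτ]
  simp only [one_smul, zero_smul, h1, h0] at h
  have ht' : (t : ℂ) ≠ 0 := by exact_mod_cast ht.ne'
  rw [div_eq_iff ht'] at h
  rw [h]; ring

lemma kern_axis (k r : ℝ) : kern k ((0 : Hyper n), r) =
    1 / 2 * ∫ η : Hyper n, cexp (sqrtSymb k ((2 * Real.pi * ‖η‖) ^ 2) * r) := by
  rw [kern, pot, ← integral_const_mul]
  congr 1; ext η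
  rw [cexp_phase_one]
  simp [symb, mul_comm]

end Kernel

/-- In polar coordinates, `symbPrim` provides a primitive of the integrand. -/
lemma kern_axis_three {k r : ℝ} (hk : 0 < k) (hr : 0 < r) : kern k ((0 : Hyper 3), r) =
    cexp (I * (k * r)) * (1 - I * (k * r)) / (4 * Real.pi * r ^ 2) := by
  have hint := pot_integrable (σ := 1) hk.le (expIntegrable_const (n := 3) (1 : ℂ))
    (z := ((0 : Hyper 3), r)) (by simpa [halfSpace] using hr)
  simp only [cexp_phase_one, inner_zero_right, ofReal_zero, mul_zero, Complex.exp_zero, one_mul,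
    smul_eq_mul, mul_one] at hint
  have hvol : (volume : Measure (Hyper 3)).real (Metric.ball 0 1) = Real.pi := by
    have : Nonempty (Fin (3 - 1)) := ⟨⟨0, by norm_num⟩⟩
    rw [Measure.real, EuclideanSpace.volume_ball]
    simp [one_add_one_eq_two, ENNReal.toReal_ofReal Real.pi_pos.le,
      Real.sq_sqrt Real.pi_pos.le]
  have hdim : Module.finrank ℝ (Hyper 3) = 2 := by simp
  have hint' : IntegrableOn (fun y : ℝ => y ^ (2 - 1) •
      cexp (sqrtSymb k ((2 * Real.pi * y) ^ 2) * r)) (Set.Ioi 0) := by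
    have := (integrable_fun_norm_addHaar (μ := (volume : Measure (Hyper 3)))
      (f := fun y => cexp (sqrtSymb k ((2 * Real.pi * y) ^ 2) * r))).1 hint
    rwa [hdim] at this
  rw [kern_axis, integral_fun_norm_addHaar volume
    (fun y => cexp (sqrtSymb k ((2 * Real.pi * y) ^ 2) * r)), hvol, hdim]
  have hpi : (Real.pi : ℂ) ≠ 0 := by exact_mod_cast Real.pi_ne_zero
  have hr' : (r : ℂ) ≠ 0 := by exact_mod_cast hr.ne'
  have hlim : Filter.Tendsto (fun y : ℝ => symbPrim k r ((2 * Real.pi * y) ^ 2)) Filter.atTop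
      (nhds 0) := by
    have hu : Filter.Tendsto (fun y : ℝ => √((2 * Real.pi * y) ^ 2 - k ^ 2)) Filter.atTop
        Filter.atTop := by
      refine Real.tendsto_sqrt_atTop.comp (Filter.tendsto_atTop_add_const_right _ _ ?_)
      exact (Filter.tendsto_pow_atTop two_ne_zero).comp
        (Filter.tendsto_id.const_mul_atTop (by positivity))
    have hF : Filter.Tendsto (fun u : ℝ => -(r * (u * Real.exp (-(r * u)))) - Real.exp (-(r * u)))
        Filter.atTop (nhds 0) := by
      have e1 : Filter.Tendsto (fun v : ℝ => Real.exp (-(r * v))) Filter.atTop (nhds 0) :=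
        Real.tendsto_exp_neg_atTop_nhds_zero.comp (Filter.tendsto_id.const_mul_atTop hr)
      simpa using ((tendsto_mul_exp_neg hr).const_mul r).neg.sub e1
    have := (Complex.continuous_ofReal.tendsto 0).comp (hF.comp hu)
    rw [ofReal_zero] at this
    refine this.congr' ?_
    filter_upwards [Filter.eventually_ge_atTop k] with y hy
    have h2 : k ≤ 2 * Real.pi * y := by nlinarith [Real.pi_gt_three]
    rw [symbPrim, sqrtSymb_of_le (pow_le_pow_left₀ hk.le h2 2)]
    simp only [Function.comp]
    push_cast
    rw [show -((√((2 * Real.pi * y) ^ 2 - k ^ 2) : ℝ) : ℂ) * r =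
      -(r * (√((2 * Real.pi * y) ^ 2 - k ^ 2) : ℝ)) by ring]
    ring
  have hftc := integral_Ioi_of_hasDerivAt_of_tendsto' (a := 0)
    (f := fun y : ℝ => symbPrim k r ((2 * Real.pi * y) ^ 2))
    (f' := fun y : ℝ => (4 * Real.pi ^ 2 * r ^ 2 : ℂ) * (y ^ (2 - 1) •
      cexp (sqrtSymb k ((2 * Real.pi * y) ^ 2) * r))) (fun y _ => by
        have h1 : HasDerivAt (fun y : ℝ => (2 * Real.pi * y) ^ 2) (8 * Real.pi ^ 2 * y) y := by
          refine (((hasDerivAt_id y).const_mul (2 * Real.pi)).fun_pow 2).congr_deriv ?_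
          simp; ring
        refine (HasDerivAt.scomp y (hasDerivAt_symbPrim k r _) h1).congr_deriv ?_
        simp only [Complex.real_smul]
        push_cast
        ring) (hint'.const_mul _) hlim
  rw [integral_const_mul] at hftc
  have h0 : symbPrim k r ((2 * Real.pi * 0) ^ 2) = cexp (I * (k * r)) * (I * (k * r) - 1) := by
    rw [symbPrim, mul_zero, zero_pow two_ne_zero, sqrtSymb_of_ge (by positivity), sub_zero,
      Real.sqrt_sq hk.le, mul_assoc]
  rw [h0] at hftc
  have hval := eq_div_of_mul_eq (show (4 * Real.pi ^ 2 * r ^ 2 : ℂ) ≠ 0 by simp [Real.pi_ne_zero, hr.ne'])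
    ((mul_comm _ _).trans hftc)
  rw [hval]
  simp only [nsmul_eq_mul, Complex.real_smul]
  push_cast
  field_simp
  ring

/-- The propagating waves (`|ξ| < k`) contribute the integral over angles, the evanescent waves
(`|ξ| > k`) the Laplace integral in the representation of the Hankel function. -/
lemma kern_axis_two {k r : ℝ} (hk : 0 < k) (hr : 0 < r) : kern k ((0 : Hyper 2), r) =
    k / (2 * Real.pi) * (angleInt 1 (k * r) + laplaceInt 1 (k * r)) := by
  have hint := pot_integrable (σ := 1) hk.le (expIntegrable_const (n := 2) (1 : ℂ))
    (z := ((0 : Hyper 2), r)) (by simpa [halfSpace] using hr)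
  simp only [cexp_phase_one, inner_zero_right, ofReal_zero, mul_zero, Complex.exp_zero, one_mul,
    smul_eq_mul, mul_one] at hint
  have hvol : (volume : Measure (Hyper 2)).real (Metric.ball 0 1) = 2 := by
    have : Nonempty (Fin (2 - 1)) := ⟨⟨0, by norm_num⟩⟩
    have h : Real.Gamma (1 / 2 + 1) = √Real.pi / 2 := by
      rw [Real.Gamma_add_one (by norm_num), Real.Gamma_one_half_eq]; ring
    have h2 : √Real.pi / (√Real.pi / 2) = 2 := by
      have : √Real.pi ≠ 0 := (Real.sqrt_pos.2 Real.pi_pos).ne'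
      field_simp
    rw [Measure.real, EuclideanSpace.volume_ball]
    simp only [Fintype.card_fin, Nat.add_one_sub_one, Nat.cast_one, pow_one, h, h2]
    simp
  have hdim : Module.finrank ℝ (Hyper 2) = 1 := by simp
  set f : ℝ → ℂ := fun y => cexp (sqrtSymb k ((2 * Real.pi * y) ^ 2) * r) with hf
  have hfc : Continuous f := by
    have := continuous_sqrtSymb k
    fun_prop
  have hint' : IntegrableOn f (Set.Ioi 0) := by
    have := (integrable_fun_norm_addHaar (μ := (volume : Measure (Hyper 2))) (f := f)).1 hint
    rw [hdim] at this
    simpa using this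
  rw [kern_axis, integral_fun_norm_addHaar volume f, hvol, hdim]
  simp only [Nat.sub_self, pow_zero, one_smul]
  set y₀ := k / (2 * Real.pi) with hy₀
  have hy0 : 0 < y₀ := by positivity
  have hpi := Real.pi_pos
  have hk2 : 2 * Real.pi * y₀ = k := by rw [hy₀]; field_simp
  -- the propagating waves: `2πy = k cos θ`
  have hprop : ∫ y in (0 : ℝ)..y₀, f y = y₀ * angleInt 1 (k * r) := by
    have hsub := intervalIntegral.integral_deriv_smul_comp (a := 0) (b := Real.pi / 2)
      (f := fun θ => y₀ * Real.cos θ) (f' := fun θ => y₀ * (-Real.sin θ)) (g := f)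
      (fun θ _ => (Real.hasDerivAt_cos θ).const_mul y₀) (by fun_prop) hfc
    simp only [Real.cos_zero, Real.cos_pi_div_two, mul_one, mul_zero] at hsub
    rw [intervalIntegral.integral_symm, ← hsub, angleInt, ← intervalIntegral.integral_const_mul,
      ← intervalIntegral.integral_neg]
    refine intervalIntegral.integral_congr fun θ hθ => ?_
    rw [Set.uIcc_of_le (by positivity)] at hθ
    have hs : 0 ≤ Real.sin θ := Real.sin_nonneg_of_nonneg_of_le_pi hθ.1 (by linarith [hθ.2])
    have e1 : (2 * Real.pi * (y₀ * Real.cos θ)) ^ 2 = (k * Real.cos θ) ^ 2 := by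
      rw [← mul_assoc, hk2]
    have e2 : k ^ 2 - (k * Real.cos θ) ^ 2 = (k * Real.sin θ) ^ 2 := by
      rw [mul_pow, mul_pow, Real.cos_sq']; ring
    have e3 : (k * Real.cos θ) ^ 2 ≤ k ^ 2 := by
      have := sq_nonneg (k * Real.sin θ); linarith
    simp only [hf, Function.comp, Complex.real_smul]
    rw [e1, sqrtSymb_of_ge e3, e2, Real.sqrt_sq (by positivity)]
    push_cast
    rw [show I * ((k : ℂ) * Complex.sin θ) * r = I * (k * r * Complex.sin θ) by ring]
    ring
  -- the evanescent waves: `2πy = k √(1 + v²)`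
  have hevan : ∫ y in Set.Ioi y₀, f y = y₀ * laplaceInt 1 (k * r) := by
    have hfr : ∀ y ∈ Set.Ioi y₀, f y = ((Real.exp (-(r * √((2 * Real.pi * y) ^ 2 - k ^ 2))) : ℝ) : ℂ)
        := by
      intro y hy
      have : k ≤ 2 * Real.pi * y := by rw [← hk2]; gcongr; exact le_of_lt hy
      simp only [hf]
      rw [sqrtSymb_of_le (pow_le_pow_left₀ hk.le this 2)]
      push_cast
      congr 1; ring
    rw [setIntegral_congr_fun measurableSet_Ioi hfr, integral_complex_ofReal]
    set g : ℝ → ℝ := fun y => Real.exp (-(r * √((2 * Real.pi * y) ^ 2 - k ^ 2))) with hg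
    have hsq : ∀ v : ℝ, 0 < 1 + v ^ 2 := fun v => by positivity
    have hgv : ∀ v : ℝ, 0 ≤ v → g (y₀ * √(1 + v ^ 2)) = Real.exp (-(k * r * v)) := by
      intro v hv
      simp only [hg]
      rw [← mul_assoc, hk2, mul_pow, Real.sq_sqrt (hsq v).le,
        show k ^ 2 * (1 + v ^ 2) - k ^ 2 = (k * v) ^ 2 by ring, Real.sqrt_sq (by positivity)]
      congr 1; ring
    have himg : (fun v : ℝ => y₀ * √(1 + v ^ 2)) '' Set.Ici 0 ⊆ Set.Ici y₀ := by
      rintro _ ⟨v, hv, rfl⟩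
      exact le_mul_of_one_le_right hy0.le (one_le_sqrt_one_add_sq v)
    have hsub := integral_comp_mul_deriv_Ioi (a := 0) (f := fun v => y₀ * √(1 + v ^ 2))
      (f' := fun v => y₀ * (v / √(1 + v ^ 2))) (g := g)
      (by fun_prop)
      (by
        refine Filter.Tendsto.const_mul_atTop hy0 (Filter.tendsto_atTop_mono (fun v => ?_)
          Filter.tendsto_id)
        exact Real.le_sqrt_of_sq_le (by simp))
      (fun v _ => by
        have h1 : HasDerivAt (fun v : ℝ => √(1 + v ^ 2)) (2 * v / (2 * √(1 + v ^ 2))) v := by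
          refine HasDerivAt.sqrt ?_ (hsq v).ne'
          simpa using (hasDerivAt_pow 2 v).const_add 1
        refine (h1.const_mul y₀).hasDerivWithinAt.congr_deriv ?_
        rw [mul_div_mul_left _ _ two_ne_zero])
      (by fun_prop)
      (by
        have h1 : IntegrableOn (fun y => ((g y : ℝ) : ℂ)) (Set.Ici y₀) := by
          rw [integrableOn_Ici_iff_integrableOn_Ioi]
          exact (hint'.mono_set (Set.Ioi_subset_Ioi hy0.le)).congr_fun hfr measurableSet_Ioi
        have h2 : Integrable (fun y => g y) (volume.restrict (Set.Ici y₀)) := by simpa using h1.re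
        exact IntegrableOn.mono_set h2 himg)
      (by
        rw [integrableOn_Ici_iff_integrableOn_Ioi]
        refine IntegrableOn.congr_fun (f := fun v => y₀ * (v ^ 1 / √(1 + v ^ 2) *
          Real.exp (-(k * r * v))))
          ((integrableOn_laplace (mul_pos hk hr) 1).const_mul y₀) (fun v hv => ?_)
          measurableSet_Ioi
        have hv : 0 < v := hv
        simp only [Function.comp]
        rw [hgv v hv.le]; ring)
    simp only [zero_pow two_ne_zero, add_zero, Real.sqrt_one, mul_one] at hsub
    rw [← hsub, laplaceInt, ← Complex.ofReal_mul, ← integral_const_mul]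
    congr 1
    refine setIntegral_congr_fun measurableSet_Ioi fun v hv => ?_
    have hv : 0 < v := hv
    simp only [Function.comp]
    rw [hgv v hv.le]; ring
  have hsplit : ∫ y in Set.Ioi (0 : ℝ), f y = (∫ y in (0 : ℝ)..y₀, f y) + ∫ y in Set.Ioi y₀, f y := by
    rw [intervalIntegral.integral_of_le hy0.le, ← setIntegral_union Set.Ioc_disjoint_Ioi_same
      measurableSet_Ioi (hint'.mono_set Set.Ioc_subset_Ioi_self)
      (hint'.mono_set (Set.Ioi_subset_Ioi hy0.le)), Set.Ioc_union_Ioi_eq_Ioi hy0.le]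
  rw [hsplit, hprop, hevan, hy₀]
  simp only [Complex.real_smul]
  push_cast
  ring

/-- The kernel of the double layer potential is the superposition of outgoing plane and evanescent
waves with constant density. -/
theorem deriv_fundSol {n : ℕ} (hn : n = 2 ∨ n = 3) {k σ : ℝ} (hk : 0 < k) (hσ : σ = 1 ∨ σ = -1)
    {z : Space n} (hz : z ∈ halfSpace n σ) (y : Hyper n) :
    deriv (fun s : ℝ => fundSol k z (y, s)) 0 = σ * kern k (z.1 - y, σ * z.2) := by
  have hz : 0 < σ * z.2 := hz
  have hσ2 : σ ^ 2 = 1 := by rcases hσ with h | h <;> simp [h]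
  set ρ := ‖z.1 - y‖ ^ 2 with hρ
  have hρ0 : 0 ≤ ρ := sq_nonneg _
  have hz2 : 0 < z.2 ^ 2 := by
    have : z.2 ≠ 0 := by rintro h; simp [h] at hz
    positivity
  set r := √(ρ + z.2 ^ 2) with hr
  have hr0 : 0 < r := Real.sqrt_pos.2 (by positivity)
  have hrc : (r : ℂ) ≠ 0 := by exact_mod_cast hr0.ne'
  have hpi : (Real.pi : ℂ) ≠ 0 := by exact_mod_cast Real.pi_ne_zero
  have hdist : HasDerivAt (fun s : ℝ => euclDist z ((y, s) : Space n)) (-z.2 / r) 0 := by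
    have h : HasDerivAt (fun s : ℝ => ρ + (z.2 - s) ^ 2) (-(2 * z.2)) 0 := by
      refine ((((hasDerivAt_id (0 : ℝ)).const_sub z.2).fun_pow 2).const_add ρ).congr_deriv ?_
      simp
    refine (h.sqrt (by simp; positivity)).congr_deriv ?_
    rw [sub_zero, ← hr]
    field_simp
  have hd0 : euclDist z ((y, 0) : Space n) = r := by simp [euclDist, hr, hρ]
  have hax : kern k (z.1 - y, σ * z.2) = (σ * z.2 : ℝ) / r * kern k ((0 : Hyper n), r) := by
    rw [kern_eq_axis hk.le _ hz, mul_pow, hσ2, one_mul]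
  have hσc : (σ : ℂ) * σ = 1 := by rw [← sq]; exact_mod_cast hσ2
  rw [hax]
  rcases hn with rfl | rfl
  · have hf : (fun s : ℝ => fundSol k z ((y, s) : Space 2)) =
        fun s => I / 4 * hankelH0 (k * euclDist z ((y, s) : Space 2)) := by
      ext s; simp [fundSol]
    have h1 : HasDerivAt hankelH0
        (2 / Real.pi * I * (angleInt 1 (k * r) + laplaceInt 1 (k * r)))
        (k * euclDist z ((y, 0) : Space 2)) := by
      rw [hd0]; exact hasDerivAt_hankelH0 (by positivity)
    have h2 := (HasDerivAt.scomp (0 : ℝ) h1 (hdist.const_mul k)).const_mul (I / 4)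
    rw [hf]
    refine h2.deriv.trans ?_
    rw [kern_axis_two hk hr0]
    simp only [Complex.real_smul]
    push_cast
    field_simp
    linear_combination (-4 * k * (z.2 : ℂ) * (angleInt 1 (k * r) + laplaceInt 1 (k * r))) * (I_sq) -
      4 * k * (z.2 : ℂ) * (angleInt 1 (k * r) + laplaceInt 1 (k * r)) * hσc
  · have hf : (fun s : ℝ => fundSol k z ((y, s) : Space 3)) =
        fun s => cexp (I * (k * euclDist z ((y, s) : Space 3) : ℝ)) /
          (4 * Real.pi * euclDist z ((y, s) : Space 3) : ℝ) := by
      ext s; simp [fundSol]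
    have hne : ((4 * Real.pi * euclDist z ((y, 0) : Space 3) : ℝ) : ℂ) ≠ 0 := by
      rw [hd0]; exact_mod_cast (by positivity : (4 * Real.pi * r : ℝ) ≠ 0)
    have h2 := (((hdist.const_mul k).ofReal_comp.const_mul I).cexp).div
      (hdist.const_mul (4 * Real.pi)).ofReal_comp hne
    rw [hf]
    refine h2.deriv.trans ?_
    rw [kern_axis_three hk hr0, hd0]
    push_cast
    field_simp
    linear_combination (-(z.2 : ℂ) * (1 - I * k * r)) * hσc

/-! ### Weighted `L²` spaces on the Fourier side -/

section Weights
variable {n : ℕ}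

lemma weight_pos {k : ℝ} (hk : 0 < k) (η : Hyper n) : 0 < k ^ 2 + (2 * Real.pi * ‖η‖) ^ 2 := by
  positivity

lemma measurable_weight (n : ℕ) (k s : ℝ) : Measurable fun η : Hyper n =>
    ENNReal.ofReal ((k ^ 2 + (2 * Real.pi * ‖η‖) ^ 2) ^ s) := by fun_prop

lemma memLp_sobolevMeasure_iff {k : ℝ} (hk : 0 < k) (s : ℝ) {F : Hyper n → ℂ} :
    MemLp F 2 (sobolevMeasure n k s) ↔ AEStronglyMeasurable F ∧
      Integrable fun η => ‖F η‖ ^ 2 * (k ^ 2 + (2 * Real.pi * ‖η‖) ^ 2) ^ s := by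
  have hac : (volume : Measure (Hyper n)) ≪ sobolevMeasure n k s :=
    withDensity_absolutelyContinuous' (measurable_weight n k s).aemeasurable
      (.of_forall fun η => by
        have := Real.rpow_pos_of_pos (weight_pos hk η) s
        simpa using this)
  have hint : Integrable (fun η => ‖F η‖ ^ 2) (sobolevMeasure n k s) ↔
      Integrable fun η => ‖F η‖ ^ 2 * (k ^ 2 + (2 * Real.pi * ‖η‖) ^ 2) ^ s := by
    rw [sobolevMeasure, integrable_withDensity_iff (measurable_weight n k s) (.of_forall fun η =>
      ENNReal.ofReal_lt_top)]
    refine integrable_congr (.of_forall fun η => ?_)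
    simp only
    rw [ENNReal.toReal_ofReal (Real.rpow_nonneg (weight_pos hk η).le s)]
  constructor
  · intro h
    exact ⟨h.1.mono_ac hac, hint.1 ((memLp_two_iff_integrable_sq_norm h.1).1 h)⟩
  · rintro ⟨h1, h2⟩
    have h1' := h1.mono_ac (sobolevMeasure_ac n k s)
    exact (memLp_two_iff_integrable_sq_norm h1').2 (hint.2 h2)

/-- `(1 + |2πη|²)^{1/2}` and `1 + ‖η‖` are equivalent weights. -/
lemma weight_one_bounds (η : Hyper n) :
    (1 + ‖η‖) / 2 ≤ (1 ^ 2 + (2 * Real.pi * ‖η‖) ^ 2 : ℝ) ^ (1 / 2 : ℝ) ∧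
      (1 ^ 2 + (2 * Real.pi * ‖η‖) ^ 2 : ℝ) ^ (1 / 2 : ℝ) ≤ 7 * (1 + ‖η‖) := by
  rw [← Real.sqrt_eq_rpow]
  have h0 := norm_nonneg η
  have h3 := Real.pi_gt_three
  have h4 := Real.pi_lt_d2
  have a1 : ‖η‖ ≤ 2 * Real.pi * ‖η‖ := le_mul_of_one_le_left h0 (by linarith)
  have a2 : 2 * Real.pi * ‖η‖ ≤ 7 * ‖η‖ := mul_le_mul_of_nonneg_right (by linarith) h0
  constructor
  · refine Real.le_sqrt_of_sq_le ?_
    nlinarith [sq_nonneg (1 - ‖η‖)]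
  · refine Real.sqrt_le_iff.2 ⟨by positivity, ?_⟩
    nlinarith

/-- `m` is square integrable with respect to `(1 + ‖η‖)⁻¹ dη`, that is, `m` is the Fourier transform
of an element of `H^{-1/2}`. -/
def NegHalf (m : Hyper n → ℂ) : Prop :=
  AEStronglyMeasurable m ∧ Integrable fun η => ‖m η‖ ^ 2 / (1 + ‖η‖)

lemma isNegHalfDensity_iff {F : Hyper n → ℂ} : IsNegHalfDensity F ↔ NegHalf F := by
  rw [IsNegHalfDensity, memLp_sobolevMeasure_iff one_pos, NegHalf]
  have e : ∀ η : Hyper n, ((1 : ℝ) ^ 2 + (2 * Real.pi * ‖η‖) ^ 2) ^ (-1 / 2 : ℝ) =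
      ((1 ^ 2 + (2 * Real.pi * ‖η‖) ^ 2 : ℝ) ^ (1 / 2 : ℝ))⁻¹ := fun η => by
    rw [← Real.rpow_neg (weight_pos one_pos η).le]; congr 1; ring
  refine and_congr_right fun hF => ⟨fun h => ?_, fun h => ?_⟩
  · refine (h.const_mul 7).mono' ?_ (.of_forall fun η => ?_)
    · exact ((hF.norm.pow 2).mul (by fun_prop : Measurable fun η : Hyper n =>
        (1 + ‖η‖)⁻¹).aestronglyMeasurable)
    · rw [Real.norm_of_nonneg (by positivity), e, div_eq_mul_inv, mul_left_comm]
      have := (weight_one_bounds η).2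
      have hp := Real.rpow_pos_of_pos (weight_pos one_pos η) (1 / 2)
      gcongr
      rw [← div_eq_mul_inv, inv_eq_one_div, div_le_div_iff₀ (by positivity) hp]
      linarith
  · refine (h.const_mul 2).mono' ?_ (.of_forall fun η => ?_)
    · exact ((hF.norm.pow 2).mul (by fun_prop : Measurable fun η : Hyper n =>
        ((1 : ℝ) ^ 2 + (2 * Real.pi * ‖η‖) ^ 2) ^ (-1 / 2 : ℝ)).aestronglyMeasurable)
    · rw [e, Real.norm_of_nonneg (by positivity), div_eq_mul_inv (‖F η‖ ^ 2), mul_left_comm 2]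
      have := (weight_one_bounds η).1
      have hp := Real.rpow_pos_of_pos (weight_pos one_pos η) (1 / 2)
      gcongr
      rw [← div_eq_mul_inv, inv_eq_one_div, div_le_div_iff₀ hp (by positivity)]
      linarith

lemma NegHalf.expIntegrable {m : Hyper n → ℂ} (hm : NegHalf m) : ExpIntegrable m := by
  refine ⟨hm.1, fun δ hδ => ?_⟩
  refine ((hm.2.add (integrable_pow_mul_exp_neg (n := n) 1 (δ := 2 * δ) (by positivity)))).mono'
    ((by fun_prop : Continuous fun η : Hyper n => Real.exp (-δ * ‖η‖)).aestronglyMeasurable.mul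
      hm.1.norm) (.of_forall fun η => ?_)
  rw [Real.norm_of_nonneg (by positivity)]
  simp only [Pi.add_apply, pow_one]
  have e : Real.exp (-(2 * δ) * ‖η‖) = Real.exp (-δ * ‖η‖) ^ 2 := by
    rw [← Real.exp_nat_mul]; congr 1; push_cast; ring
  rw [e]
  have hp : 0 < 1 + ‖η‖ := by positivity
  have hsq : √(1 + ‖η‖) ^ 2 = 1 + ‖η‖ := Real.sq_sqrt hp.le
  have h := two_mul_le_add_sq (‖m η‖ / √(1 + ‖η‖)) (√(1 + ‖η‖) * Real.exp (-δ * ‖η‖))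
  rw [div_pow, mul_pow, hsq] at h
  have h2 : 2 * (‖m η‖ / √(1 + ‖η‖)) * (√(1 + ‖η‖) * Real.exp (-δ * ‖η‖)) =
      2 * (Real.exp (-δ * ‖η‖) * ‖m η‖) := by
    have : √(1 + ‖η‖) ≠ 0 := (Real.sqrt_pos.2 hp).ne'
    field_simp
  have : 0 ≤ Real.exp (-δ * ‖η‖) * ‖m η‖ := by positivity
  linarith

/-- `F` is square integrable with respect to `(1 + ‖η‖) dη`, that is, `F` is the Fourier transform
of an element of `H^{1/2}`. -/
def PosHalf (F : Hyper n → ℂ) : Prop :=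
  AEStronglyMeasurable F ∧ Integrable fun η => ‖F η‖ ^ 2 * (1 + ‖η‖)

lemma posHalf_iff {φ : L2 n} : PosHalf (𝓕 φ : L2 n) ↔ eHalfNorm 1 φ < ⊤ := by
  have h : eHalfNorm 1 φ < ⊤ ↔ MemLp (𝓕 φ : L2 n) 2 (sobolevMeasure n 1 (1 / 2)) :=
    ⟨fun h => ⟨aesm_fourier 1 _ φ, h⟩, fun h => h.2⟩
  rw [h, memLp_sobolevMeasure_iff one_pos, PosHalf]
  refine and_congr_right fun hF => Iff.symm ⟨fun h => ?_, fun h => ?_⟩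
  · refine (h.const_mul 2).mono' ?_ (.of_forall fun η => ?_)
    · exact ((hF.norm.pow 2).mul (by fun_prop : Measurable fun η : Hyper n =>
        (1 + ‖η‖)).aestronglyMeasurable)
    · rw [Real.norm_of_nonneg (by positivity), mul_left_comm]
      have := (weight_one_bounds η).1
      gcongr
      linarith
  · refine (h.const_mul 7).mono' ?_ (.of_forall fun η => ?_)
    · exact ((hF.norm.pow 2).mul (by fun_prop : Measurable fun η : Hyper n =>
        ((1 : ℝ) ^ 2 + (2 * Real.pi * ‖η‖) ^ 2) ^ (1 / 2 : ℝ)).aestronglyMeasurable)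
    · have hp := Real.rpow_pos_of_pos (weight_pos one_pos η) (1 / 2)
      rw [Real.norm_of_nonneg (by positivity), mul_left_comm]
      gcongr
      exact (weight_one_bounds η).2

lemma PosHalf.negHalf_of_le {F m : Hyper n → ℂ} (hF : PosHalf F) (hm : AEStronglyMeasurable m)
    {C : ℝ} (h : ∀ η, ‖m η‖ ≤ C * (1 + ‖η‖) * ‖F η‖) : NegHalf m := by
  refine ⟨hm, (hF.2.const_mul (C ^ 2)).mono' ?_ (.of_forall fun η => ?_)⟩
  · exact ((hm.norm.pow 2).mul (by fun_prop : Measurable fun η : Hyper n =>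
        (1 + ‖η‖)⁻¹).aestronglyMeasurable)
  · have hp : 0 < 1 + ‖η‖ := by positivity
    rw [Real.norm_of_nonneg (by positivity), div_le_iff₀ hp]
    calc ‖m η‖ ^ 2 ≤ (C * (1 + ‖η‖) * ‖F η‖) ^ 2 := by gcongr; exact h η
      _ = _ := by ring

/-- The duality between `H^{-1/2}` and `H^{1/2}`. -/
lemma NegHalf.integrable_mul {m F : Hyper n → ℂ} (hm : NegHalf m) (hF : PosHalf F) :
    Integrable fun η => ‖m η‖ * ‖F η‖ := by
  refine (hm.2.add hF.2).mono' (hm.1.norm.mul hF.1.norm) (.of_forall fun η => ?_)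
  have hp : 0 < 1 + ‖η‖ := by positivity
  have hsq : √(1 + ‖η‖) ^ 2 = 1 + ‖η‖ := Real.sq_sqrt hp.le
  have h := two_mul_le_add_sq (‖m η‖ / √(1 + ‖η‖)) (√(1 + ‖η‖) * ‖F η‖)
  rw [div_pow, mul_pow, hsq] at h
  have h2 : 2 * (‖m η‖ / √(1 + ‖η‖)) * (√(1 + ‖η‖) * ‖F η‖) = 2 * (‖m η‖ * ‖F η‖) := by
    have : √(1 + ‖η‖) ≠ 0 := (Real.sqrt_pos.2 hp).ne'
    field_simp
  rw [Real.norm_of_nonneg (by positivity)]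
  simp only [Pi.add_apply]
  have : 0 ≤ ‖m η‖ * ‖F η‖ := by positivity
  linarith

lemma NegHalf.integrable_mul_conj {m F : Hyper n → ℂ} (hm : NegHalf m) (hF : PosHalf F) :
    Integrable fun η => m η * conj (F η) :=
  (hm.integrable_mul hF).mono' (hm.1.mul (continuous_conj.comp_aestronglyMeasurable hF.1))
    (.of_forall fun η => by simp)

end Weights

/-! ### Elements of `H̃^{1/2}(Γ)` -/

section HTilde
variable {n : ℕ} {Γ : Opens (Hyper n)}

lemma eLpNorm_fourier_Lp (φ : L2 n) :
    eLpNorm (𝓕 φ : L2 n) 2 volume = eLpNorm φ 2 volume := by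
  have := Lp.norm_fourier_eq φ
  rw [Lp.norm_def, Lp.norm_def] at this
  exact (ENNReal.toReal_eq_toReal_iff' (Lp.memLp _).2.ne (Lp.memLp _).2.ne).1 this

lemma eLpNorm_le_eHalfNorm (φ : L2 n) : eLpNorm φ 2 volume ≤ eHalfNorm 1 φ := by
  rw [← eLpNorm_fourier_Lp, eHalfNorm]
  refine eLpNorm_mono_measure _ ?_
  calc (volume : Measure (Hyper n)) = volume.withDensity 1 := withDensity_one.symm
    _ ≤ _ := withDensity_mono (.of_forall fun η => by
      rw [Pi.one_apply, ENNReal.one_le_ofReal]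
      exact Real.one_le_rpow (by nlinarith [sq_nonneg (2 * Real.pi * ‖η‖)]) (by norm_num))

lemma Test.eq_zero_of_notMem (θ : Test Γ) {x : Hyper n} (hx : x ∉ Γ) : θ x = 0 :=
  image_eq_zero_of_notMem_tsupport fun h => hx (θ.tsupport_subset h)

lemma HTilde.posHalf (φ : HTilde Γ) : PosHalf (𝓕 (φ : L2 n) : L2 n) := posHalf_iff.2 φ.2.1

/-- Elements of `H̃^{1/2}(Γ)` vanish almost everywhere outside `Γ`. -/
lemma HTilde.ae_eq_zero (φ : HTilde Γ) : ∀ᵐ x, x ∉ Γ → (φ : L2 n) x = 0 := by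
  have hmeas : MeasurableSet ((Γ : Set (Hyper n))ᶜ) := Γ.isOpen.measurableSet.compl
  have h0 : eLpNorm (φ : L2 n) 2 (volume.restrict (Γ : Set (Hyper n))ᶜ) = 0 := by
    refine le_antisymm (le_of_forall_pos_le_add fun ε hε => ?_) bot_le
    obtain ⟨θ, hθ⟩ := φ.2.2 ε hε
    have hz : eLpNorm θ.toL2 2 (volume.restrict (Γ : Set (Hyper n))ᶜ) = 0 := by
      rw [eLpNorm_eq_zero_iff (Lp.aestronglyMeasurable _).restrict (by norm_num)]
      filter_upwards [ae_restrict_of_ae θ.memLp.coeFn_toLp, ae_restrict_mem hmeas] with x h1 h2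
      rw [Test.toL2, h1, θ.eq_zero_of_notMem h2]; rfl
    have he : (φ : L2 n) = ((φ : L2 n) - θ.toL2) + θ.toL2 := by abel
    calc eLpNorm (φ : L2 n) 2 (volume.restrict (Γ : Set (Hyper n))ᶜ)
        = eLpNorm ((((φ : L2 n) - θ.toL2 : L2 n) : Hyper n → ℂ) + (θ.toL2 : Hyper n → ℂ)) 2
            (volume.restrict (Γ : Set (Hyper n))ᶜ) := by
          refine eLpNorm_congr_ae (ae_restrict_of_ae ?_)
          nth_rewrite 1 [he]
          exact Lp.coeFn_add _ _
      _ ≤ eLpNorm ((φ : L2 n) - θ.toL2 : L2 n) 2 (volume.restrict (Γ : Set (Hyper n))ᶜ) +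
            eLpNorm θ.toL2 2 (volume.restrict (Γ : Set (Hyper n))ᶜ) :=
          eLpNorm_add_le (Lp.aestronglyMeasurable _).restrict (Lp.aestronglyMeasurable _).restrict
            (by norm_num)
      _ ≤ eHalfNorm 1 ((φ : L2 n) - θ.toL2) + 0 := by
          rw [hz]
          gcongr
          exact (eLpNorm_mono_measure _ Measure.restrict_le_self).trans (eLpNorm_le_eHalfNorm _)
      _ ≤ 0 + ε := by rw [add_zero, zero_add]; exact hθ.le
  rw [eLpNorm_eq_zero_iff (Lp.aestronglyMeasurable _).restrict (by norm_num)] at h0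
  exact (ae_restrict_iff' hmeas).1 h0

lemma HTilde.integrable (hΓ : Bornology.IsBounded (Γ : Set (Hyper n))) (φ : HTilde Γ) :
    Integrable (φ : L2 n) := by
  have hfin : volume (Γ : Set (Hyper n)) < ⊤ := hΓ.measure_lt_top
  have : IsFiniteMeasure (volume.restrict (Γ : Set (Hyper n))) := ⟨by simpa using hfin⟩
  have h : IntegrableOn (φ : L2 n) (Γ : Set (Hyper n)) :=
    ((Lp.memLp (φ : L2 n)).restrict _).integrable (by norm_num)
  refine h.integrable_of_ae_notMem_eq_zero ?_
  exact HTilde.ae_eq_zero φ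

lemma HTilde.fourier_ae_eq (hΓ : Bornology.IsBounded (Γ : Set (Hyper n))) (φ : HTilde Γ) :
    (𝓕 (φ : L2 n) : L2 n) =ᵐ[volume] 𝓕 ((φ : L2 n) : Hyper n → ℂ) := by
  have := fourier_toLp_ae_eq (HTilde.integrable hΓ φ) (Lp.memLp (φ : L2 n))
  rwa [Lp.toLp_coeFn] at this

lemma phase_sub (k : ℝ) {σ : ℝ} (z : Space n) (y η : Hyper n) :
    cexp (phase k 1 η (z.1 - y, σ * z.2)) =
      cexp (-2 * Real.pi * (inner ℝ η y : ℝ) * I) * cexp (phase k σ η z) := by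
  rw [phase_apply, phase_apply, ← Complex.exp_add, inner_sub_right]
  congr 1
  push_cast
  ring

/-- Fourier representation of the double layer potential. -/
theorem doubleLayer_eq_pot (hn : n = 2 ∨ n = 3) {k σ : ℝ} (hk : 0 < k) (hσ : σ = 1 ∨ σ = -1)
    (hΓ : Bornology.IsBounded (Γ : Set (Hyper n))) (φ : HTilde Γ) {z : Space n}
    (hz : z ∈ halfSpace n σ) :
    doubleLayer k Γ φ z = pot k σ (fun η => σ / 2 * (𝓕 (φ : L2 n) : L2 n) η) z := by
  have hφ := HTilde.integrable hΓ φ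
  set h : Hyper n → ℂ := fun η => 1 / 2 * cexp (phase k σ η z) with hh
  have hhi : Integrable h := by
    have := pot_integrable hk.le (expIntegrable_const (n := n) (1 / 2 : ℂ)) hz
    refine this.congr (.of_forall fun η => ?_)
    simp [hh, mul_comm]
  have hker : ∀ y : Hyper n, kern k (z.1 - y, σ * z.2) = 𝓕 h y := by
    intro y
    rw [Real.fourier_eq', kern, pot]
    congr 1; ext η
    rw [phase_sub]
    simp only [hh, smul_eq_mul]
    push_cast
    ring
  have e1 : doubleLayer k Γ φ z = ∫ y, σ * (𝓕 h y * (φ : L2 n) y) := by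
    rw [doubleLayer, ← setIntegral_eq_integral_of_ae_compl_eq_zero (s := (Γ : Set (Hyper n)))
      (f := fun y => σ * (𝓕 h y * (φ : L2 n) y))]
    · refine setIntegral_congr_fun Γ.isOpen.measurableSet fun y _ => ?_
      rw [deriv_fundSol hn hk hσ hz, hker]
      ring
    · filter_upwards [HTilde.ae_eq_zero φ] with y hy hyΓ
      rw [hy hyΓ]; ring
  have flip := VectorFourier.integral_fourierIntegral_smul_eq_flip (μ := volume) (ν := volume)
    (L := innerₗ (Hyper n)) Real.continuous_fourierChar (by exact continuous_inner) hhi hφ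
  rw [flip_innerₗ] at flip
  rw [e1, integral_const_mul]
  have e2 : ∫ y, 𝓕 h y * (φ : L2 n) y = ∫ η, h η * 𝓕 ((φ : L2 n) : Hyper n → ℂ) η := flip
  rw [e2, pot, ← integral_const_mul]
  refine integral_congr_ae ?_
  filter_upwards [HTilde.fourier_ae_eq hΓ φ] with η hη
  rw [hη]
  simp only [hh, smul_eq_mul]
  ring

end HTilde

/-! ### Square integrability of the potentials -/

section SquareIntegrable
variable {n : ℕ}

lemma pot_slice_eq (k σ : ℝ) (m : Hyper n → ℂ) (x : Hyper n) (τ : ℝ) :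
    pot k σ m (x, τ) = 𝓕⁻ (fun η => cexp (σ * symb k η * τ) * m η) x := by
  rw [Real.fourierInv_eq', pot]
  congr 1; ext η
  rw [phase_apply, Complex.exp_add, smul_eq_mul, smul_eq_mul, ← mul_assoc]
  congr 3
  push_cast
  ring

lemma norm_slice_sq_le {k : ℝ} (hk : 0 ≤ k) {t R : ℝ} (ht : 0 ≤ t) (htR : t ≤ R) (η : Hyper n) :
    ‖cexp (symb k η * t)‖ ^ 2 ≤
      Real.exp (2 * (k + 1) * R) * Real.exp (-(2 * (1 + ‖η‖) * t)) := by
  rw [Complex.norm_exp, ← Real.exp_nat_mul, ← Real.exp_add]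
  refine Real.exp_le_exp.2 ?_
  have h := neg_re_symb_ge hk η
  simp only [mul_re, ofReal_re, ofReal_im, mul_zero, sub_zero]
  push_cast
  nlinarith

lemma lintegral_exp_halfLine {σ : ℝ} (hσ : σ = 1 ∨ σ = -1) {a : ℝ} (ha : 0 < a) :
    ∫⁻ τ in {τ : ℝ | 0 < σ * τ}, ENNReal.ofReal (Real.exp (-(a * (σ * τ)))) =
      ENNReal.ofReal (1 / a) := by
  have h1 : ∫⁻ τ in Set.Ioi (0 : ℝ), ENNReal.ofReal (Real.exp (-(a * τ))) =
      ENNReal.ofReal (1 / a) := by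
    have hi : IntegrableOn (fun τ : ℝ => Real.exp (-(a * τ))) (Set.Ioi 0) := by
      simpa using exp_neg_integrableOn_Ioi 0 ha
    rw [← ofReal_integral_eq_lintegral_ofReal hi (.of_forall fun τ => (Real.exp_pos _).le)]
    congr 1
    have := integral_comp_mul_left_Ioi (fun w => Real.exp (-w)) 0 ha
    rw [this, mul_zero, integral_exp_neg_Ioi_zero]
    simp
  rcases hσ with rfl | rfl
  · simpa [Set.Ioi] using h1
  · rw [← h1, ← (Measure.measurePreserving_neg (volume : Measure ℝ)).setLIntegral_comp_preimage
      measurableSet_Ioi (by fun_prop)]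
    congr 1
    · congr 1
      ext τ; simp
    · ext τ; simp

lemma halfSpace_eq_prod (n : ℕ) (σ : ℝ) :
    halfSpace n σ = Set.univ ×ˢ {τ : ℝ | 0 < σ * τ} := by
  ext z; simp [halfSpace]

lemma volume_restrict_halfSpace (n : ℕ) (σ : ℝ) :
    (volume : Measure (Space n)).restrict (halfSpace n σ) =
      (volume : Measure (Hyper n)).prod (volume.restrict {τ : ℝ | 0 < σ * τ}) := by
  rw [halfSpace_eq_prod, Measure.volume_eq_prod, ← Measure.prod_restrict, Measure.restrict_univ]

/-- By Plancherel's theorem in `x` and integration in `τ`, the potential with an `H^{-1/2}` density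
is square integrable near the screen: the decay `e^{-2στ‖η‖}` gains the factor `1 / ‖η‖`. -/
lemma memLp_mul_pot {k σ : ℝ} (hk : 0 ≤ k) (hσ : σ = 1 ∨ σ = -1) {m : Hyper n → ℂ}
    (hm : NegHalf m) {c : Space n → ℂ} (hc : Continuous c) (hcs : HasCompactSupport c) :
    MemLp (fun z => c z * pot k σ m z) 2 (volume.restrict (halfSpace n σ)) := by
  have hcont : ContinuousOn (pot k σ m) (halfSpace n σ) :=
    contDiffOn_zero.1 (contDiffOn_pot hk 0 hm.expIntegrable)
  have hmeas : MeasurableSet (halfSpace n σ) := (isOpen_halfSpace n σ).measurableSet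
  have haesm : AEStronglyMeasurable (fun z => c z * pot k σ m z)
      (volume.restrict (halfSpace n σ)) :=
    (hc.continuousOn.mul hcont).aestronglyMeasurable hmeas
  have hσ2 : σ * σ = 1 := by rcases hσ with h | h <;> simp [h]
  obtain ⟨C, hC⟩ := hc.bounded_above_of_compact_support hcs
  obtain ⟨R, hR0, hR⟩ := hcs.isCompact.isBounded.exists_pos_norm_le
  refine ⟨haesm, ?_⟩
  rw [eLpNorm_lt_top_iff_lintegral_rpow_enorm_lt_top (by norm_num) (by norm_num)]
  simp only [ENNReal.toReal_ofNat, ENNReal.rpow_ofNat]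
  -- Plancherel on the slice at height `τ`; slices with `στ > R` do not meet the support of `c`
  have hslice : ∀ τ : ℝ, 0 < σ * τ →
      ∫⁻ x : Hyper n, ‖c (x, τ) * pot k σ m (x, τ)‖ₑ ^ 2 ≤
        ∫⁻ η, ENNReal.ofReal (C ^ 2 * Real.exp (2 * (k + 1) * R) * ‖m η‖ ^ 2) *
          ENNReal.ofReal (Real.exp (-(2 * (1 + ‖η‖) * (σ * τ)))) := by
    intro τ hτ
    by_cases hτR : σ * τ ≤ R
    · set f : Hyper n → ℂ := fun η => cexp (σ * symb k η * τ) * m η with hf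
      have hphase : ∀ η : Hyper n, cexp (σ * symb k η * τ) = cexp (phase k σ η (0, τ)) := fun η => by
        rw [phase_apply]; simp
      have hz : ((0, τ) : Space n) ∈ halfSpace n σ := hτ
      have hf1 : Integrable f := by
        refine (pot_integrable hk hm.expIntegrable hz).congr (.of_forall fun η => ?_)
        simp only [hf, hphase, smul_eq_mul]
      have hexp : ∀ η : Hyper n, ‖cexp (σ * symb k η * τ)‖ ^ 2 ≤
          Real.exp (2 * (k + 1) * R) * Real.exp (-(2 * (1 + ‖η‖) * (σ * τ))) := fun η => by
        have := norm_slice_sq_le hk hτ.le hτR η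
        rwa [show symb k η * ((σ * τ : ℝ) : ℂ) = σ * symb k η * τ by push_cast; ring] at this
      have hf2 : MemLp f 2 := by
        refine (memLp_two_iff_integrable_sq_norm hf1.1).2 ?_
        have hb : ∀ η : Hyper n, (1 + ‖η‖) * Real.exp (-(2 * (1 + ‖η‖) * (σ * τ))) ≤
            1 / (2 * (σ * τ)) := fun η => by
          rw [le_div_iff₀ (by positivity)]
          have h := Real.add_one_le_exp (2 * (1 + ‖η‖) * (σ * τ))
          have e : Real.exp (-(2 * (1 + ‖η‖) * (σ * τ))) * Real.exp (2 * (1 + ‖η‖) * (σ * τ)) = 1 := by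
            rw [← Real.exp_add]; simp
          have hp := Real.exp_pos (-(2 * (1 + ‖η‖) * (σ * τ)))
          nlinarith
        refine (hm.2.const_mul (Real.exp (2 * (k + 1) * R) * (1 / (2 * (σ * τ))))).mono'
          (hf1.1.norm.pow 2) (.of_forall fun η => ?_)
        rw [Real.norm_of_nonneg (by positivity), hf]
        simp only [norm_mul, mul_pow]
        have hp : 0 < 1 + ‖η‖ := by positivity
        calc ‖cexp (σ * symb k η * τ)‖ ^ 2 * ‖m η‖ ^ 2
            ≤ (Real.exp (2 * (k + 1) * R) * Real.exp (-(2 * (1 + ‖η‖) * (σ * τ)))) * ‖m η‖ ^ 2 := by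
              gcongr; exact hexp η
          _ = Real.exp (2 * (k + 1) * R) * ((1 + ‖η‖) * Real.exp (-(2 * (1 + ‖η‖) * (σ * τ)))) *
              (‖m η‖ ^ 2 / (1 + ‖η‖)) := by field_simp
          _ ≤ _ := by gcongr; exact hb η
      have hpl := eLpNorm_fourierInv hf1 hf2
      rw [eLpNorm_eq_lintegral_rpow_enorm_toReal (by norm_num) (by norm_num),
        eLpNorm_eq_lintegral_rpow_enorm_toReal (by norm_num) (by norm_num)] at hpl
      simp only [ENNReal.toReal_ofNat, ENNReal.rpow_ofNat] at hpl
      have hpl' := (ENNReal.rpow_left_injective (x := 1 / 2) (by norm_num)) hpl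
      calc ∫⁻ x : Hyper n, ‖c (x, τ) * pot k σ m (x, τ)‖ₑ ^ 2
          ≤ ∫⁻ x : Hyper n, ENNReal.ofReal (C ^ 2) * ‖𝓕⁻ f x‖ₑ ^ 2 := by
            refine lintegral_mono fun x => ?_
            rw [pot_slice_eq, enorm_mul, mul_pow]
            gcongr
            rw [ENNReal.ofReal_pow ((norm_nonneg _).trans (hC 0))]
            gcongr
            rw [← ofReal_norm]
            exact ENNReal.ofReal_le_ofReal (hC _)
        _ = ENNReal.ofReal (C ^ 2) * ∫⁻ η, ‖f η‖ₑ ^ 2 := by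
            rw [lintegral_const_mul' _ _ ENNReal.ofReal_ne_top, hpl']
        _ = ∫⁻ η, ENNReal.ofReal (C ^ 2) * ‖f η‖ₑ ^ 2 := by
            rw [lintegral_const_mul' _ _ ENNReal.ofReal_ne_top]
        _ ≤ _ := by
            refine lintegral_mono fun η => ?_
            rw [← ofReal_norm, ← ENNReal.ofReal_pow (norm_nonneg _), ← ENNReal.ofReal_mul (sq_nonneg C),
              ← ENNReal.ofReal_mul (by positivity)]
            refine ENNReal.ofReal_le_ofReal ?_
            simp only [hf, norm_mul, mul_pow]
            calc C ^ 2 * (‖cexp (σ * symb k η * τ)‖ ^ 2 * ‖m η‖ ^ 2)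
                ≤ C ^ 2 * (Real.exp (2 * (k + 1) * R) * Real.exp (-(2 * (1 + ‖η‖) * (σ * τ))) *
                    ‖m η‖ ^ 2) := by gcongr; exact hexp η
              _ = _ := by ring
    · have hz : ∀ x : Hyper n, c (x, τ) = 0 := fun x => by
        by_contra hne
        have h1 := hR (x, τ) (subset_tsupport c hne)
        have h2 : |τ| ≤ R := (norm_snd_le ((x, τ) : Space n)).trans h1
        have h3 : σ * τ ≤ |τ| := by
          rcases hσ with h | h <;> rw [h]
          · simpa using le_abs_self τ
          · simpa using neg_le_abs τ
        exact hτR (h3.trans h2)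
      simp [hz]
  rw [volume_restrict_halfSpace, lintegral_prod_symm _ (by
    have := haesm.enorm.pow_const 2
    rwa [volume_restrict_halfSpace] at this)]
  have hms : MeasurableSet {τ : ℝ | 0 < σ * τ} :=
    (isOpen_lt continuous_const (by fun_prop)).measurableSet
  have hm1 : AEMeasurable (fun η => ENNReal.ofReal (C ^ 2 * Real.exp (2 * (k + 1) * R) * ‖m η‖ ^ 2))
      (volume : Measure (Hyper n)) :=
    ((hm.1.norm.pow 2).const_mul _).aemeasurable.ennreal_ofReal
  calc _ ≤ ∫⁻ τ in {τ : ℝ | 0 < σ * τ}, ∫⁻ η : Hyper n,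
        ENNReal.ofReal (C ^ 2 * Real.exp (2 * (k + 1) * R) * ‖m η‖ ^ 2) *
          ENNReal.ofReal (Real.exp (-(2 * (1 + ‖η‖) * (σ * τ)))) :=
        setLIntegral_mono' hms fun τ hτ => hslice τ hτ
    _ = ∫⁻ η : Hyper n, ∫⁻ τ in {τ : ℝ | 0 < σ * τ},
        ENNReal.ofReal (C ^ 2 * Real.exp (2 * (k + 1) * R) * ‖m η‖ ^ 2) *
          ENNReal.ofReal (Real.exp (-(2 * (1 + ‖η‖) * (σ * τ)))) := by
        rw [lintegral_lintegral_swap]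
        exact (hm1.comp_snd).mul (by fun_prop)
    _ = ∫⁻ η : Hyper n, ENNReal.ofReal (C ^ 2 * Real.exp (2 * (k + 1) * R) / 2 *
          (‖m η‖ ^ 2 / (1 + ‖η‖))) := by
        refine lintegral_congr fun η => ?_
        rw [lintegral_const_mul' _ _ ENNReal.ofReal_ne_top,
          lintegral_exp_halfLine hσ (by positivity), ← ENNReal.ofReal_mul (by positivity)]
        congr 1
        field_simp
    _ < ⊤ := (hm.2.const_mul _).lintegral_lt_top

end SquareIntegrable

/-! ### Green's identity in a half-space -/

section Green
variable {n : ℕ}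

lemma contDiff_pderiv {c : Space n → ℂ} (hc : ContDiff ℝ ∞ c) (i : Option (Fin (n - 1))) :
    ContDiff ℝ ∞ (pderiv i c) :=
  (hc.fderiv_right (m := ∞) (by simp)).clm_apply contDiff_const

lemma hasCompactSupport_pderiv {c : Space n → ℂ} (hc : HasCompactSupport c)
    (i : Option (Fin (n - 1))) : HasCompactSupport (pderiv i c) :=
  hc.fderiv_apply (𝕜 := ℝ) (coordVec i)

lemma pderiv_mul {c w : Space n → ℂ} {z : Space n} (hc : DifferentiableAt ℝ c z)
    (hw : DifferentiableAt ℝ w z) (i : Option (Fin (n - 1))) :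
    pderiv i (fun z => c z * w z) z = pderiv i c z * w z + c z * pderiv i w z := by
  unfold pderiv
  rw [fderiv_fun_mul hc hw]
  simp only [add_apply, smul_apply, smul_eq_mul]
  ring

lemma pderiv_congr {w w' : Space n → ℂ} {z : Space n} (h : w =ᶠ[nhds z] w')
    (i : Option (Fin (n - 1))) : pderiv i w z = pderiv i w' z := by
  unfold pderiv; rw [h.fderiv_eq]

lemma pderiv_congr_halfSpace {σ : ℝ} {w w' : Space n → ℂ} (h : Set.EqOn w w' (halfSpace n σ))
    (i : Option (Fin (n - 1))) : Set.EqOn (pderiv i w) (pderiv i w') (halfSpace n σ) :=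
  fun _ hz => pderiv_congr (h.eventuallyEq_of_mem ((isOpen_halfSpace n σ).mem_nhds hz)) i

lemma lap_congr_halfSpace {σ : ℝ} {w w' : Space n → ℂ} (h : Set.EqOn w w' (halfSpace n σ)) :
    Set.EqOn (lap w) (lap w') (halfSpace n σ) := fun _ hz =>
  Finset.sum_congr rfl fun i _ => pderiv_congr_halfSpace (pderiv_congr_halfSpace h i) i hz

lemma pderiv_conj {v : Space n → ℂ} {z : Space n} (hv : DifferentiableAt ℝ v z)
    (i : Option (Fin (n - 1))) : pderiv i (fun z => conj (v z)) z = conj (pderiv i v z) := by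
  have := (Complex.conjCLE.toContinuousLinearMap.hasFDerivAt.comp z hv.hasFDerivAt)
  unfold pderiv
  rw [show (fun z => conj (v z)) = Complex.conjCLE.toContinuousLinearMap ∘ v from rfl, this.fderiv]
  rfl

lemma contDiff_conj {v : Space n → ℂ} (hv : ContDiff ℝ ∞ v) :
    ContDiff ℝ ∞ fun z => conj (v z) := Complex.conjCLE.contDiff.comp hv

lemma hasCompactSupport_conj {v : Space n → ℂ} (hv : HasCompactSupport v) :
    HasCompactSupport fun z => conj (v z) := hv.comp_left (g := conj) (map_zero _)

lemma MemW1Lap.congr {σ : ℝ} {w w' : Space n → ℂ} (h : Set.EqOn w w' (halfSpace n σ))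
    (hw : MemW1Lap σ w') : MemW1Lap σ w := by
  have hm : MeasurableSet (halfSpace n σ) := (isOpen_halfSpace n σ).measurableSet
  have key {f f' : Space n → ℂ} (h : Set.EqOn f f' (halfSpace n σ)) :
      MemLp f' 2 (volume.restrict (halfSpace n σ)) → MemLp f 2 (volume.restrict (halfSpace n σ)) :=
    fun hf => hf.ae_eq ((ae_restrict_iff' hm).2 (.of_forall fun z hz => (h hz).symm))
  exact ⟨hw.1.congr h, key h hw.2.1, fun i => key (pderiv_congr_halfSpace h i) (hw.2.2.1 i),
    key (lap_congr_halfSpace h) hw.2.2.2⟩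

lemma IsNormalTrace.congr {Γ : Opens (Hyper n)} {σ : ℝ} {w w' : Space n → ℂ}
    (h : Set.EqOn w w' (halfSpace n σ)) {g : Test Γ → ℂ} (hw : IsNormalTrace Γ σ w' g) :
    IsNormalTrace Γ σ w g := by
  refine ⟨hw.1.congr h, fun θ v hv hvs hθ => ?_⟩
  rw [hw.2 θ v hv hvs hθ]
  congr 1
  refine setIntegral_congr_fun (isOpen_halfSpace n σ).measurableSet fun z hz => ?_
  rw [lap_congr_halfSpace h hz]
  congr 1
  exact Finset.sum_congr rfl fun i _ => by rw [pderiv_congr_halfSpace h i hz]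

lemma hasCompactSupport_slice {X : Space n → ℂ} (hs : HasCompactSupport X) (τ : ℝ) :
    HasCompactSupport fun x => X (x, τ) :=
  HasCompactSupport.intro (hs.isCompact.image continuous_fst) fun x hx => by
    by_contra h
    exact hx ⟨(x, τ), subset_tsupport X h, rfl⟩

lemma hasCompactSupport_normal {X : Space n → ℂ} (hs : HasCompactSupport X) (x : Hyper n) :
    HasCompactSupport fun τ => X (x, τ) :=
  HasCompactSupport.intro (hs.isCompact.image continuous_snd) fun τ hτ => by
    by_contra h
    exact hτ ⟨(x, τ), subset_tsupport X h, rfl⟩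

lemma integrable_pderiv {X : Space n → ℂ} (hX : ContDiff ℝ 1 X) (hs : HasCompactSupport X)
    (i : Option (Fin (n - 1))) : Integrable (pderiv i X) :=
  ((hX.continuous_fderiv (by norm_num)).clm_apply continuous_const).integrable_of_hasCompactSupport
    (hasCompactSupport_pderiv hs i)

lemma volume_restrict_slab (n : ℕ) (σ ε : ℝ) :
    (volume : Measure (Space n)).restrict {z | ε < σ * z.2} =
      (volume : Measure (Hyper n)).prod (volume.restrict {τ : ℝ | ε < σ * τ}) := by
  have : {z : Space n | ε < σ * z.2} = Set.univ ×ˢ {τ : ℝ | ε < σ * τ} := by ext z; simp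
  rw [this, Measure.volume_eq_prod, ← Measure.prod_restrict, Measure.restrict_univ]

lemma integral_pderiv_tangential {X : Space n → ℂ} (hX : ContDiff ℝ 1 X)
    (hs : HasCompactSupport X) (σ ε : ℝ) (j : Fin (n - 1)) :
    ∫ z in {z : Space n | ε < σ * z.2}, pderiv (some j) X z = 0 := by
  have hi := (integrable_pderiv hX hs (some j)).restrict (s := {z : Space n | ε < σ * z.2})
  rw [volume_restrict_slab] at hi ⊢
  rw [integral_prod_symm _ hi]
  refine integral_eq_zero_of_ae (.of_forall fun τ => ?_)
  set f : Hyper n → ℂ := fun x => X (x, τ) with hf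
  have hfc : ContDiff ℝ 1 f := hX.comp (contDiff_id.prodMk contDiff_const)
  have hfs : HasCompactSupport f := hasCompactSupport_slice hs τ
  have hfd : ∀ x, pderiv (some j) X (x, τ) = fderiv ℝ f x (EuclideanSpace.single j 1) := by
    intro x
    have h1 : HasFDerivAt (fun x : Hyper n => ((x, τ) : Space n))
        ((ContinuousLinearMap.id ℝ (Hyper n)).prod 0) x :=
      (hasFDerivAt_id x).prodMk (hasFDerivAt_const τ x)
    have h2 := ((hX.differentiable (by norm_num)) (x, τ)).hasFDerivAt.comp x h1
    rw [show f = X ∘ fun x : Hyper n => ((x, τ) : Space n) from rfl, h2.fderiv]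
    rfl
  simp only [hfd, Pi.zero_apply]
  have hint : Integrable fun x => fderiv ℝ f x (EuclideanSpace.single j 1) :=
    ((hfc.continuous_fderiv (by norm_num)).clm_apply
      continuous_const).integrable_of_hasCompactSupport (hfs.fderiv_apply (𝕜 := ℝ) _)
  have := integral_smul_fderiv_eq_neg_fderiv_smul_of_integrable (𝕜 := ℝ) (μ := volume)
    (f := fun _ : Hyper n => (1 : ℝ)) (g := f) (v := EuclideanSpace.single j 1)
    (by simp) (by simpa using hint)
    (by simpa using hfc.continuous.integrable_of_hasCompactSupport hfs)
    (fun x _ => differentiableAt_const _) (fun x _ => hfc.differentiable (by norm_num) x)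
  simpa using this

lemma integral_pderiv_normal {X : Space n → ℂ} (hX : ContDiff ℝ 1 X)
    (hs : HasCompactSupport X) {σ : ℝ} (hσ : σ = 1 ∨ σ = -1) (ε : ℝ) :
    ∫ z in {z : Space n | ε < σ * z.2}, pderiv none X z = -σ * ∫ x : Hyper n, X (x, σ * ε) := by
  have hi := (integrable_pderiv hX hs none).restrict (s := {z : Space n | ε < σ * z.2})
  rw [volume_restrict_slab] at hi ⊢
  rw [integral_prod _ hi, ← integral_const_mul]
  congr 1; ext x
  set f : ℝ → ℂ := fun τ => X (x, τ) with hf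
  have hfc : ContDiff ℝ 1 f := hX.comp (contDiff_const.prodMk contDiff_id)
  have hfs : HasCompactSupport f := hasCompactSupport_normal hs x
  have hfd : ∀ τ, pderiv none X (x, τ) = deriv f τ := by
    intro τ
    have h1 : HasDerivAt (fun τ : ℝ => ((x, τ) : Space n)) (0, 1) τ :=
      (hasDerivAt_const τ x).prodMk (hasDerivAt_id τ)
    have h2 := ((hX.differentiable (by norm_num)) (x, τ)).hasFDerivAt.comp_hasDerivAt τ h1
    exact h2.deriv.symm
  simp only [hfd]
  rcases hσ with rfl | rfl
  · have := hfs.integral_Ioi_deriv_eq hfc ε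
    simpa [Set.Ioi] using this
  · have := hfs.integral_Iic_deriv_eq hfc (-ε)
    rw [integral_Iic_eq_integral_Iio] at this
    have hset : {τ : ℝ | ε < -1 * τ} = Set.Iio (-ε) := by
      ext τ; simp only [Set.mem_ofPred_eq, Set.mem_Iio]; constructor <;> intro h <;> linarith
    rw [hset, this]
    simp [hf]

/-- Green's identity in the half-space `στ > ε`, for a function that is smooth in `στ > 0`. -/
lemma green_identity {σ : ℝ} (hσ : σ = 1 ∨ σ = -1) {w v : Space n → ℂ}
    (hw : ContDiffOn ℝ 2 w (halfSpace n σ)) (hv : ContDiff ℝ ∞ v) (hvs : HasCompactSupport v)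
    {ε : ℝ} (hε : 0 < ε) :
    ∫ z in {z : Space n | ε < σ * z.2},
      ((∑ i, pderiv i w z * conj (pderiv i v z)) + lap w z * conj (v z)) =
      -σ * ∫ x : Hyper n, pderiv none w (x, σ * ε) * conj (v (x, σ * ε)) := by
  have hσ2 : σ * σ = 1 := by rcases hσ with h | h <;> simp [h]
  have hopen := isOpen_halfSpace n σ
  -- a smooth cut-off equal to `1` where `στ ≥ ε` and to `0` where `στ ≤ ε / 2`
  set κ : Space n → ℂ := fun z => (Real.smoothTransition (2 / ε * (σ * z.2) - 1) : ℂ) with hκ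
  have hκc : ContDiff ℝ 1 κ := by
    refine Complex.ofRealCLM.contDiff.comp (Real.smoothTransition.contDiff.comp ?_)
    fun_prop
  have hκ1 : ∀ z : Space n, ε ≤ σ * z.2 → κ z = 1 := fun z hz => by
    simp only [hκ]
    rw [Real.smoothTransition.one_of_one_le, ofReal_one]
    rw [div_mul_eq_mul_div, le_sub_iff_add_le, le_div_iff₀ hε]
    linarith
  have hκ0 : ∀ z : Space n, σ * z.2 ≤ ε / 2 → κ z = 0 := fun z hz => by
    simp only [hκ]
    rw [Real.smoothTransition.zero_of_nonpos, ofReal_zero]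
    rw [div_mul_eq_mul_div, sub_nonpos, div_le_iff₀ hε]
    linarith
  have hwd : ∀ i, ContDiffOn ℝ 1 (pderiv i w) (halfSpace n σ) := fun i =>
    (hw.fderiv_of_isOpen hopen (m := 1) (by norm_num)).clm_apply contDiffOn_const
  have hvc := contDiff_conj hv
  set X : Option (Fin (n - 1)) → Space n → ℂ := fun i z => κ z * (pderiv i w z * conj (v z)) with hX
  have hXc : ∀ i, ContDiff ℝ 1 (X i) := by
    intro i
    rw [contDiff_iff_contDiffAt]
    intro z
    by_cases hz : 0 < σ * z.2
    · exact hκc.contDiffAt.mul (((hwd i).contDiffAt (hopen.mem_nhds hz)).mul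
        (hvc.contDiffAt.of_le (by exact_mod_cast le_top)))
    · have : X i =ᶠ[nhds z] fun _ => 0 := by
        have ho : IsOpen {y : Space n | σ * y.2 < ε / 2} := isOpen_lt (by fun_prop) (by fun_prop)
        filter_upwards [ho.mem_nhds (show σ * z.2 < ε / 2 by linarith)] with y hy
        simp only [hX]
        rw [hκ0 y (le_of_lt hy), zero_mul]
      exact contDiffAt_const.congr_of_eventuallyEq this
  have hXs : ∀ i, HasCompactSupport (X i) := fun i =>
    ((hasCompactSupport_conj hvs).mul_left (f := pderiv i w)).mul_left (f := κ)
  have hms : MeasurableSet {z : Space n | ε < σ * z.2} :=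
    (isOpen_lt continuous_const (by fun_prop)).measurableSet
  have hdX : ∀ z : Space n, ε < σ * z.2 → ∀ i, pderiv i (X i) z =
      pderiv i w z * conj (pderiv i v z) + pderiv i (pderiv i w) z * conj (v z) := by
    intro z hz i
    have ho : IsOpen {y : Space n | ε < σ * y.2} := isOpen_lt (by fun_prop) (by fun_prop)
    have hzh : z ∈ halfSpace n σ := hε.trans hz
    have hloc : X i =ᶠ[nhds z] fun z => pderiv i w z * conj (v z) := by
      filter_upwards [ho.mem_nhds hz] with y hy
      simp only [hX]
      rw [hκ1 y (le_of_lt hy), one_mul]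
    rw [pderiv_congr hloc, pderiv_mul
      (((hwd i).contDiffAt (hopen.mem_nhds hzh)).differentiableAt (by norm_num))
      (hvc.differentiable (by simp) z), pderiv_conj (hv.differentiable (by simp) z)]
    ring
  have hsum : ∫ z in {z : Space n | ε < σ * z.2},
      ((∑ i, pderiv i w z * conj (pderiv i v z)) + lap w z * conj (v z)) =
      ∑ i, ∫ z in {z : Space n | ε < σ * z.2}, pderiv i (X i) z := by
    rw [← integral_finsetSum _ fun i _ => (integrable_pderiv (hXc i) (hXs i) i).restrict]
    refine setIntegral_congr_fun hms fun z hz => ?_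
    rw [Finset.sum_congr rfl fun i _ => hdX z hz i, Finset.sum_add_distrib, lap, Finset.sum_mul]
  rw [hsum, Fintype.sum_option, integral_pderiv_normal (hXc none) (hXs none) hσ,
    Finset.sum_eq_zero fun j _ => integral_pderiv_tangential (hXc (some j)) (hXs (some j)) σ ε j,
    add_zero]
  congr 2; ext x
  simp only [hX]
  rw [hκ1 _ (by simp only [← mul_assoc, hσ2, one_mul, le_refl]), one_mul]

end Green

/-! ### Boundary values of the potentials -/

section BoundaryValues
variable {n : ℕ}

lemma integral_fourierInv_mul {V : Type*} [NormedAddCommGroup V] [InnerProductSpace ℝ V]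
    [FiniteDimensional ℝ V] [MeasurableSpace V] [BorelSpace V] {f g : V → ℂ} (hf : Integrable f)
    (hg : Integrable g) : ∫ x, 𝓕⁻ f x * g x = ∫ η, f η * 𝓕⁻ g η := by
  have h := VectorFourier.integral_fourierIntegral_smul_eq_flip (μ := volume) (ν := volume)
    (L := -innerₗ V) Real.continuous_fourierChar
    (by
      have : Continuous fun p : V × V => -inner ℝ p.1 p.2 := by fun_prop
      exact this) hf hg
  have hL : (-innerₗ V).flip = -innerₗ V := by
    ext x y
    simp [real_inner_comm]
  rw [hL] at h
  exact h

/-- The Fourier transforms of the slices of a test function on `ℝⁿ` decay rapidly, uniformly in the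
slice. -/
lemma exists_fourierInv_slice_le {q : Space n → ℂ} (hq : ContDiff ℝ ∞ q)
    (hqs : HasCompactSupport q) (N : ℕ) :
    ∃ C : ℝ, ∀ (τ : ℝ) (η : Hyper n), (1 + ‖η‖) ^ N * ‖𝓕⁻ (fun x => q (x, τ)) η‖ ≤ C := by
  set K : Set (Hyper n) := Prod.fst '' tsupport q
  have hK : IsCompact K := hqs.isCompact.image continuous_fst
  have hslice : ∀ τ : ℝ, ContDiff ℝ ∞ fun x : Hyper n => q (x, τ) := fun τ =>
    hq.comp (contDiff_id.prodMk contDiff_const)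
  have hbound : ∀ j : ℕ, ∃ B : ℝ, ∀ z, ‖iteratedFDeriv ℝ j q z‖ ≤ B := fun j =>
    (hq.continuous_iteratedFDeriv (by exact_mod_cast le_top)).bounded_above_of_compact_support
      (hqs.iteratedFDeriv j)
  choose B hB using hbound
  have hB0 : ∀ j, 0 ≤ B j := fun j => (norm_nonneg _).trans (hB j 0)
  have hder : ∀ (j : ℕ) (τ : ℝ) (x : Hyper n),
      ‖iteratedFDeriv ℝ j (fun x => q (x, τ)) x‖ ≤ K.indicator (fun _ => B j) x := by
    intro j τ x
    by_cases hx : x ∈ K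
    · rw [Set.indicator_of_mem hx]
      have e : (fun x : Hyper n => q (x, τ)) =
          (fun z => q (z + (0, τ))) ∘ ContinuousLinearMap.inl ℝ (Hyper n) ℝ := by
        ext y; simp
      have hsh : ContDiff ℝ ∞ fun z : Space n => q (z + (0, τ)) :=
        hq.comp (contDiff_id.add contDiff_const)
      rw [e, ContinuousLinearMap.iteratedFDeriv_comp_right (ContinuousLinearMap.inl ℝ (Hyper n) ℝ)
        hsh x (i := j) (by exact_mod_cast le_top), iteratedFDeriv_comp_add_right]
      refine (ContinuousMultilinearMap.norm_compContinuousLinearMap_le _ _).trans ?_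
      refine (mul_le_of_le_one_right (norm_nonneg _) ?_).trans (hB j _)
      exact Finset.prod_le_one (fun _ _ => norm_nonneg _) fun _ _ =>
        ContinuousLinearMap.norm_inl_le_one _ _ _
    · rw [Set.indicator_of_notMem hx]
      have hts : tsupport (fun x : Hyper n => q (x, τ)) ⊆ K := by
        refine closure_minimal (fun y hy => ⟨(y, τ), subset_tsupport q hy, rfl⟩) hK.isClosed
      have : iteratedFDeriv ℝ j (fun x => q (x, τ)) x = 0 := by
        by_contra h
        exact hx (hts (support_iteratedFDeriv_subset j h))
      rw [this, norm_zero]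
  have hint : ∀ (j : ℕ) (τ : ℝ),
      ∫ x, ‖iteratedFDeriv ℝ j (fun x => q (x, τ)) x‖ ≤ B j * volume.real K := by
    intro j τ
    refine (integral_mono_of_nonneg (.of_forall fun _ => norm_nonneg _)
      ((integrable_indicator_iff hK.measurableSet).2 (integrableOn_const hK.measure_lt_top.ne))
      (.of_forall fun x => hder j τ x)).trans ?_
    rw [integral_indicator hK.measurableSet, setIntegral_const, smul_eq_mul, mul_comm]
  have hpow : ∀ (M : ℕ) (τ : ℝ) (η : Hyper n), ‖η‖ ^ M * ‖𝓕⁻ (fun x => q (x, τ)) η‖ ≤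
      2 ^ M * ∑ p ∈ Finset.range 1 ×ˢ Finset.range (M + 1), B p.2 * volume.real K := by
    intro M τ η
    have h := Real.pow_mul_norm_iteratedFDeriv_fourier_le (K := ⊤) (N := ⊤)
      (f := fun x : Hyper n => q (x, τ)) (hslice τ) (fun a b _ _ => by
        refine Continuous.integrable_of_hasCompactSupport ?_ ?_
        · have := (hslice τ).continuous_iteratedFDeriv (m := b) (by exact_mod_cast le_top)
          fun_prop
        · exact ((hasCompactSupport_slice hqs τ).iteratedFDeriv b).norm.mul_left)
      (k := 0) (n := M) le_top le_top (-η)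
    rw [Real.fourierInv_eq_fourier_neg]
    rw [norm_neg, norm_iteratedFDeriv_zero] at h
    refine h.trans ?_
    simp only [Nat.cast_zero, mul_zero, zero_add, pow_zero, one_mul]
    gcongr with p hp
    have hp0 : p.1 = 0 := by simpa using (Finset.mem_product.1 hp).1
    rw [hp0]
    simpa using hint p.2 τ
  refine ⟨2 ^ (N - 1) * (2 ^ 0 * (∑ p ∈ Finset.range 1 ×ˢ Finset.range (0 + 1), B p.2 *
    volume.real K) + 2 ^ N * ∑ p ∈ Finset.range 1 ×ˢ Finset.range (N + 1), B p.2 * volume.real K),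
    fun τ η => ?_⟩
  have h1 := add_pow_le (zero_le_one (α := ℝ)) (norm_nonneg η) N
  calc (1 + ‖η‖) ^ N * ‖𝓕⁻ (fun x => q (x, τ)) η‖
      ≤ 2 ^ (N - 1) * (1 ^ N + ‖η‖ ^ N) * ‖𝓕⁻ (fun x => q (x, τ)) η‖ := by gcongr
    _ = 2 ^ (N - 1) * (‖η‖ ^ 0 * ‖𝓕⁻ (fun x => q (x, τ)) η‖ +
          ‖η‖ ^ N * ‖𝓕⁻ (fun x => q (x, τ)) η‖) := by rw [one_pow, pow_zero]; ring
    _ ≤ _ := mul_le_mul_of_nonneg_left (add_le_add (hpow 0 τ η) (hpow N τ η)) (by positivity)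

lemma NegHalf.integrable_mul_decay {m : Hyper n → ℂ} (hm : NegHalf m) :
    Integrable fun η => ‖m η‖ * ((1 + ‖η‖) ^ (n + 1))⁻¹ := by
  have hN : Integrable fun η : Hyper n => (1 + ‖η‖) ^ (-(n : ℝ)  - 1) := by
    have := integrable_one_add_norm (E := Hyper n) (μ := volume) (r := n + 1) (by
      simp only [finrank_euclideanSpace, Fintype.card_fin]
      have : ((n - 1 : ℕ) : ℝ) ≤ n := by exact_mod_cast Nat.sub_le n 1
      linarith)
    simpa [sub_eq_add_neg, add_comm] using this
  refine (hm.2.add hN).mono' (hm.1.norm.mul (by fun_prop : Measurable fun η : Hyper n =>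
    ((1 + ‖η‖) ^ (n + 1))⁻¹).aestronglyMeasurable) (.of_forall fun η => ?_)
  have hp : 1 ≤ 1 + ‖η‖ := by linarith [norm_nonneg η]
  have hp0 : 0 < 1 + ‖η‖ := by linarith
  rw [Real.norm_of_nonneg (by positivity)]
  simp only [Pi.add_apply]
  have e : (1 + ‖η‖) ^ (-(n : ℝ) - 1) = ((1 + ‖η‖) ^ (n + 1))⁻¹ := by
    rw [show -(n : ℝ) - 1 = -((n + 1 : ℕ) : ℝ) by push_cast; ring, Real.rpow_neg hp0.le,
      Real.rpow_natCast]
  rw [e]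
  set y := (1 + ‖η‖) ^ (n + 1) with hy
  have hy1 : 1 + ‖η‖ ≤ y := le_self_pow₀ hp (by simp)
  have hy0 : 0 < y := by positivity
  have h := two_mul_le_add_sq (‖m η‖ / √(1 + ‖η‖)) (√(1 + ‖η‖) * y⁻¹)
  have hsq : √(1 + ‖η‖) ^ 2 = 1 + ‖η‖ := Real.sq_sqrt hp0.le
  rw [div_pow, mul_pow, hsq] at h
  have h2 : 2 * (‖m η‖ / √(1 + ‖η‖)) * (√(1 + ‖η‖) * y⁻¹) = 2 * (‖m η‖ * y⁻¹) := by
    have : √(1 + ‖η‖) ≠ 0 := (Real.sqrt_pos.2 hp0).ne'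
    field_simp
  have h3 : (1 + ‖η‖) * y⁻¹ ^ 2 ≤ y⁻¹ := by
    rw [sq, ← mul_assoc]
    refine mul_le_of_le_one_left (by positivity) ?_
    rw [← div_eq_mul_inv]
    exact (div_le_one hy0).2 hy1
  have : 0 ≤ ‖m η‖ * y⁻¹ := by positivity
  linarith

/-- Boundary values of a potential on `Γ_∞`, tested against a test function. -/
lemma tendsto_integral_pot_mul {k σ : ℝ} (hk : 0 ≤ k) (hσ : σ = 1 ∨ σ = -1) {m : Hyper n → ℂ}
    (hm : NegHalf m) {q : Space n → ℂ} (hq : ContDiff ℝ ∞ q) (hqs : HasCompactSupport q) :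
    Filter.Tendsto (fun ε : ℝ => ∫ x, pot k σ m (x, σ * ε) * q (x, σ * ε))
      (nhdsWithin 0 (Set.Ioi 0)) (nhds (∫ η, m η * 𝓕⁻ (fun x => q (x, 0)) η)) := by
  have hσ2 : σ * σ = 1 := by rcases hσ with h | h <;> simp [h]
  obtain ⟨C, hC⟩ := exists_fourierInv_slice_le hq hqs (n + 1)
  obtain ⟨B, hB⟩ := hq.continuous.bounded_above_of_compact_support hqs
  have hqi : ∀ τ : ℝ, Integrable fun x => q (x, τ) := fun τ =>
    (hq.continuous.comp (by fun_prop)).integrable_of_hasCompactSupport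
      (hasCompactSupport_slice hqs τ)
  have hfub : ∀ ε : ℝ, 0 < ε → ∫ x, pot k σ m (x, σ * ε) * q (x, σ * ε) =
      ∫ η, cexp (symb k η * ε) * m η * 𝓕⁻ (fun x => q (x, σ * ε)) η := by
    intro ε hε
    have hsym : ∀ η : Hyper n, σ * symb k η * ((σ * ε : ℝ) : ℂ) = symb k η * ε := fun η => by
      have : (σ : ℂ) * σ = 1 := by exact_mod_cast hσ2
      push_cast
      linear_combination symb k η * ε * this
    have hi : Integrable fun η => cexp (symb k η * ε) * m η := by
      have hz : ((0, σ * ε) : Space n) ∈ halfSpace n σ := by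
        show 0 < σ * (σ * ε); rw [← mul_assoc, hσ2, one_mul]; exact hε
      refine (pot_integrable hk hm.expIntegrable hz).congr (.of_forall fun η => ?_)
      simp only [phase_apply, inner_zero_right, ofReal_zero, mul_zero, zero_add, smul_eq_mul]
      rw [hsym]
    rw [← integral_fourierInv_mul hi (hqi _)]
    congr 1; ext x
    rw [pot_slice_eq]
    simp only [hsym]
  have hlim : Filter.Tendsto (fun ε : ℝ => ∫ η, cexp (symb k η * ε) * m η *
      𝓕⁻ (fun x => q (x, σ * ε)) η) (nhdsWithin 0 (Set.Ioi 0))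
      (nhds (∫ η, m η * 𝓕⁻ (fun x => q (x, 0)) η)) := by
    refine tendsto_integral_filter_of_dominated_convergence
      (fun η => C * (‖m η‖ * ((1 + ‖η‖) ^ (n + 1))⁻¹)) ?_ ?_ (hm.integrable_mul_decay.const_mul C) ?_
    · refine .of_forall fun ε => AEStronglyMeasurable.mul (AEStronglyMeasurable.mul ?_ hm.1) ?_
      · have := continuous_symb (n := n) k
        exact (by fun_prop : Continuous _).aestronglyMeasurable
      · have : Continuous (𝓕⁻ fun x => q (x, σ * ε)) := by
          have := (continuous_fourier (hqi (σ * ε))).comp (continuous_neg (G := Hyper n))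
          refine this.congr fun x => ?_
          rw [Real.fourierInv_eq_fourier_neg]; rfl
        exact this.aestronglyMeasurable
    · filter_upwards [self_mem_nhdsWithin] with ε hε
      have hε : 0 < ε := hε
      refine .of_forall fun η => ?_
      have h1 : ‖cexp (symb k η * ε)‖ ≤ 1 := by
        rw [Complex.norm_exp]
        refine Real.exp_le_one_iff.2 ?_
        simp only [mul_re, ofReal_re, ofReal_im, mul_zero, sub_zero]
        exact mul_nonpos_of_nonpos_of_nonneg (re_symb_nonpos k η) hε.le
      have h2 : ‖𝓕⁻ (fun x => q (x, σ * ε)) η‖ ≤ C * ((1 + ‖η‖) ^ (n + 1))⁻¹ := by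
        rw [← div_eq_mul_inv, le_div_iff₀ (by positivity), mul_comm]
        exact hC _ η
      rw [norm_mul, norm_mul]
      calc ‖cexp (symb k η * ε)‖ * ‖m η‖ * ‖𝓕⁻ (fun x => q (x, σ * ε)) η‖
          ≤ 1 * ‖m η‖ * (C * ((1 + ‖η‖) ^ (n + 1))⁻¹) := by gcongr
        _ = _ := by ring
    · refine .of_forall fun η => ?_
      have h1 : Filter.Tendsto (fun ε : ℝ => cexp (symb k η * ε)) (nhds 0) (nhds 1) := by
        have : Continuous fun ε : ℝ => cexp (symb k η * ε) := by fun_prop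
        simpa using this.tendsto 0
      have h2 : Filter.Tendsto (fun ε : ℝ => 𝓕⁻ (fun x => q (x, σ * ε)) η) (nhds 0)
          (nhds (𝓕⁻ (fun x => q (x, 0)) η)) := by
        simp only [Real.fourierInv_eq']
        set K : Set (Hyper n) := Prod.fst '' tsupport q
        have hK : IsCompact K := hqs.isCompact.image continuous_fst
        refine tendsto_integral_filter_of_dominated_convergence (K.indicator fun _ => B)
          (.of_forall fun ε => ?_) (.of_forall fun ε => .of_forall fun x => ?_)
          ((integrable_indicator_iff hK.measurableSet).2 (integrableOn_const hK.measure_lt_top.ne))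
          (.of_forall fun x => ?_)
        · have := hq.continuous
          exact (by fun_prop : Continuous _).aestronglyMeasurable
        · rw [norm_smul, Complex.norm_exp_ofReal_mul_I, one_mul]
          by_cases hx : x ∈ K
          · rw [Set.indicator_of_mem hx]; exact hB _
          · rw [Set.indicator_of_notMem hx]
            have : q (x, σ * ε) = 0 := by
              by_contra h
              exact hx ⟨_, subset_tsupport q h, rfl⟩
            rw [this, norm_zero]
        · have : Continuous fun ε : ℝ => cexp ((2 * Real.pi * inner ℝ x η : ℝ) * I) •
              q (x, σ * ε) := by
            have := hq.continuous
            fun_prop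
          simpa using this.tendsto 0
      have := (h1.mul_const (m η)).mul h2
      rw [one_mul] at this
      exact this.mono_left nhdsWithin_le_nhds
  refine hlim.congr' ?_
  filter_upwards [self_mem_nhdsWithin] with ε hε
  exact (hfub ε hε).symm

end BoundaryValues

/-! ### The normal derivative of a potential on the screen -/

section NormalTrace
variable {n : ℕ} {k σ : ℝ}

/-- The exponentials `z ↦ e^{phase k σ η z}` solve the Helmholtz equation. -/
lemma sum_phase_coordVec_sq (hσ : σ = 1 ∨ σ = -1) (η : Hyper n) :
    ∑ i, phase k σ η (coordVec i) * phase k σ η (coordVec i) = -(k : ℂ) ^ 2 := by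
  have hσ2 : (σ : ℂ) * σ = 1 := by rcases hσ with h | h <;> simp [h]
  have hs : symb k η ^ 2 = ((2 * Real.pi * ‖η‖) ^ 2 - k ^ 2 : ℝ) := sqrtSymb_sq _ _
  have h1 : ∀ j : Fin (n - 1), phase k σ η (coordVec (some j)) * phase k σ η (coordVec (some j)) =
      -(2 * Real.pi) ^ 2 * ((η j ^ 2 : ℝ) : ℂ) := by
    intro j
    have : inner ℝ η (EuclideanSpace.single j (1 : ℝ)) = η j := by
      simp [EuclideanSpace.inner_single_right]
    simp only [phase_apply, coordVec, this]
    push_cast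
    linear_combination (2 * Real.pi * (η j : ℂ)) ^ 2 * Complex.I_sq
  have h2 : phase k σ η (coordVec none) * phase k σ η (coordVec none) = symb k η ^ 2 := by
    simp only [phase_apply, coordVec, inner_zero_right]
    push_cast
    linear_combination symb k η ^ 2 * hσ2
  rw [Fintype.sum_option, Finset.sum_congr rfl fun j _ => h1 j, ← Finset.mul_sum, h2, hs,
    ← Complex.ofReal_sum]
  have : ∑ j, η j ^ 2 = ‖η‖ ^ 2 := by
    rw [EuclideanSpace.norm_sq_eq]; simp
  rw [this]
  push_cast
  ring

lemma differentiableAt_pot (hk : 0 ≤ k) {m : Hyper n → ℂ} (hm : ExpIntegrable m) {z : Space n}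
    (hz : z ∈ halfSpace n σ) : DifferentiableAt ℝ (pot k σ m) z :=
  (hasFDerivAt_pot hk hm hz).differentiableAt

lemma pderiv_mul_pot (hk : 0 ≤ k) {m : Hyper n → ℂ} (hm : ExpIntegrable m) {c : Space n → ℂ}
    (hc : ContDiff ℝ ∞ c) (i : Option (Fin (n - 1))) : Set.EqOn
      (pderiv i fun z => c z * pot k σ m z)
      (fun z => pderiv i c z * pot k σ m z +
        c z * pot k σ (fun η => phase k σ η (coordVec i) * m η) z) (halfSpace n σ) := by
  intro z hz
  simp only
  rw [pderiv_mul (hc.differentiable (by simp) z) (differentiableAt_pot hk hm hz)]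
  congr 2
  exact fderiv_pot_apply hk hm hz _

lemma pderiv_pderiv_mul_pot (hk : 0 ≤ k) {m : Hyper n → ℂ} (hm : ExpIntegrable m)
    {c : Space n → ℂ} (hc : ContDiff ℝ ∞ c) (i : Option (Fin (n - 1))) : Set.EqOn
      (pderiv i (pderiv i fun z => c z * pot k σ m z))
      (fun z => pderiv i (pderiv i c) z * pot k σ m z +
        2 * pderiv i c z * pot k σ (fun η => phase k σ η (coordVec i) * m η) z +
        c z * pot k σ (fun η => phase k σ η (coordVec i) * (phase k σ η (coordVec i) * m η)) z)
      (halfSpace n σ) := by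
  intro z hz
  have hm' := expIntegrable_phase_mul hk σ hm (coordVec i)
  have hc' := contDiff_pderiv hc i
  rw [pderiv_congr_halfSpace (pderiv_mul_pot hk hm hc i) i hz]
  have hadd : pderiv i (fun z => pderiv i c z * pot k σ m z +
        c z * pot k σ (fun η => phase k σ η (coordVec i) * m η) z) z =
      pderiv i (fun z => pderiv i c z * pot k σ m z) z +
      pderiv i (fun z => c z * pot k σ (fun η => phase k σ η (coordVec i) * m η) z) z := by
    unfold pderiv
    rw [fderiv_fun_add]
    · rfl
    · exact (hc'.differentiable (by simp) z).mul (differentiableAt_pot hk hm hz)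
    · exact (hc.differentiable (by simp) z).mul (differentiableAt_pot hk hm' hz)
  rw [hadd, pderiv_mul_pot hk hm hc' i hz, pderiv_mul_pot hk hm' hc i hz]
  ring

lemma lap_mul_pot (hk : 0 ≤ k) (hσ : σ = 1 ∨ σ = -1) {m : Hyper n → ℂ} (hm : ExpIntegrable m)
    {c : Space n → ℂ} (hc : ContDiff ℝ ∞ c) : Set.EqOn
      (lap fun z => c z * pot k σ m z)
      (fun z => (lap c z - k ^ 2 * c z) * pot k σ m z +
        ∑ i, 2 * pderiv i c z * pot k σ (fun η => phase k σ η (coordVec i) * m η) z)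
      (halfSpace n σ) := by
  intro z hz
  have hsum : ∑ i, pot k σ (fun η => phase k σ η (coordVec i) *
      (phase k σ η (coordVec i) * m η)) z = -(k : ℂ) ^ 2 * pot k σ m z := by
    unfold pot
    rw [← integral_finsetSum _ fun i _ => pot_integrable hk (expIntegrable_phase_mul hk σ
      (expIntegrable_phase_mul hk σ hm (coordVec i)) (coordVec i)) hz, ← integral_const_mul]
    congr 1; ext η
    rw [← sum_phase_coordVec_sq (k := k) hσ η, Finset.sum_mul]
    refine Finset.sum_congr rfl fun i _ => ?_
    simp only [smul_eq_mul]
    ring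
  rw [lap, Finset.sum_congr rfl fun i _ => pderiv_pderiv_mul_pot hk hm hc i hz,
    Finset.sum_add_distrib, Finset.sum_add_distrib, ← Finset.mul_sum, hsum, ← Finset.sum_mul]
  simp only [lap]
  ring

lemma PosHalf.negHalf {F : Hyper n → ℂ} (hF : PosHalf F) : NegHalf F :=
  hF.negHalf_of_le hF.1 (C := 1) fun η => by
    rw [one_mul]
    exact le_mul_of_one_le_left (norm_nonneg _) (by linarith [norm_nonneg η])

lemma PosHalf.negHalf_phase_mul (hk : 0 ≤ k) {F : Hyper n → ℂ} (hF : PosHalf F) (σ : ℝ)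
    (v : Space n) : NegHalf fun η => phase k σ η v * F η := by
  refine hF.negHalf_of_le (C := (7 + |σ| * (k + 7)) * ‖v‖) ?_ fun η => ?_
  · have := continuous_phase (n := n) k σ
    exact (by fun_prop : Continuous fun η : Hyper n => phase k σ η v).aestronglyMeasurable.mul hF.1
  · rw [norm_mul]
    refine mul_le_mul_of_nonneg_right ?_ (norm_nonneg _)
    calc ‖phase k σ η v‖ ≤ ‖phase k σ η‖ * ‖v‖ := ContinuousLinearMap.le_opNorm _ _
      _ ≤ ((7 + |σ| * (k + 7)) * (1 + ‖η‖)) * ‖v‖ := by gcongr; exact norm_phase_le hk σ η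
      _ = _ := by ring

lemma memW1Lap_mul_pot (hk : 0 ≤ k) (hσ : σ = 1 ∨ σ = -1) {m : Hyper n → ℂ} (hm : PosHalf m)
    {c : Space n → ℂ} (hc : ContDiff ℝ ∞ c) (hcs : HasCompactSupport c) :
    MemW1Lap σ fun z => c z * pot k σ m z := by
  have hmeas : MeasurableSet (halfSpace n σ) := (isOpen_halfSpace n σ).measurableSet
  have hme := hm.negHalf.expIntegrable
  have key {f f' : Space n → ℂ} (h : Set.EqOn f f' (halfSpace n σ)) :
      MemLp f' 2 (volume.restrict (halfSpace n σ)) → MemLp f 2 (volume.restrict (halfSpace n σ)) :=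
    fun hf => hf.ae_eq ((ae_restrict_iff' hmeas).2 (.of_forall fun z hz => (h hz).symm))
  have hd := fun i => (contDiff_pderiv hc i).continuous
  have hds := fun i => hasCompactSupport_pderiv hcs i
  have hlc : Continuous (lap c) :=
    continuous_finsetSum _ fun i _ => (contDiff_pderiv (contDiff_pderiv hc i) i).continuous
  have hls : HasCompactSupport (lap c) := HasCompactSupport.intro hcs.isCompact fun z hz => by
    refine Finset.sum_eq_zero fun i _ => ?_
    by_contra h
    exact hz (tsupport_fderiv_apply_subset ℝ (coordVec i) (tsupport_fderiv_apply_subset ℝ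
      (f := pderiv i c) (coordVec i) (subset_tsupport _ h)))
  refine ⟨?_, memLp_mul_pot hk hσ hm.negHalf hc.continuous hcs, fun i => ?_, ?_⟩
  · exact (contDiff_infty.1 hc 2).contDiffOn.mul (contDiffOn_pot hk 2 hme)
  · exact key (pderiv_mul_pot hk hme hc i) ((memLp_mul_pot hk hσ hm.negHalf (hd i) (hds i)).add
      (memLp_mul_pot hk hσ (hm.negHalf_phase_mul hk σ _) hc.continuous hcs))
  · refine key (lap_mul_pot hk hσ hme hc) ((memLp_mul_pot hk hσ hm.negHalf ?_ ?_).add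
      (memLp_finsetSum _ fun i _ => memLp_mul_pot hk hσ (hm.negHalf_phase_mul hk σ _) ?_ ?_))
    · exact hlc.sub (continuous_const.mul hc.continuous)
    · exact hls.sub hcs.mul_left
    · exact continuous_const.mul (hd i)
    · exact (hds i).mul_left

lemma fourierInv_conj {V : Type*} [NormedAddCommGroup V] [InnerProductSpace ℝ V]
    [FiniteDimensional ℝ V] [MeasurableSpace V] [BorelSpace V] (f : V → ℂ) (η : V) :
    𝓕⁻ (fun x => conj (f x)) η = conj (𝓕 f η) := by
  rw [Real.fourierInv_eq', Real.fourier_eq', ← integral_conj]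
  congr 1; ext x
  rw [smul_eq_mul, smul_eq_mul, map_mul, ← Complex.exp_conj]
  congr 2
  simp [map_ofNat (starRingEnd ℂ) 2]

/-- The normal derivative of a potential with density `m ∈ H^{1/2}` is obtained by differentiating
under the integral sign and passing to the limit in Green's identity. -/
lemma isNormalTrace_mul_pot (hk : 0 ≤ k) (hσ : σ = 1 ∨ σ = -1) {m : Hyper n → ℂ} (hm : PosHalf m)
    {Γ : Opens (Hyper n)} {χ : Space n → ℂ} (hχ : IsCutoff Γ χ) :
    IsNormalTrace Γ σ (fun z => χ z * pot k σ m z)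
      fun θ => fourierPairing (fun η => σ * symb k η * m η) θ.toL2 := by
  have hW := memW1Lap_mul_pot hk hσ hm hχ.1 hχ.2.1
  refine ⟨hW, fun θ v hv hvs hθ => ?_⟩
  have hσ2 : σ * σ = 1 := by rcases hσ with h | h <;> simp [h]
  have hme := hm.negHalf.expIntegrable
  have hm' := hm.negHalf_phase_mul hk σ (coordVec none)
  set w : Space n → ℂ := fun z => χ z * pot k σ m z with hw
  set G : Space n → ℂ := fun z =>
    (∑ i, pderiv i w z * conj (pderiv i v z)) + lap w z * conj (v z) with hG
  have hcv := contDiff_conj hv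
  have hcvs := hasCompactSupport_conj hvs
  have hGi : IntegrableOn G (halfSpace n σ) := by
    have hl : ∀ {f : Space n → ℂ}, ContDiff ℝ ∞ f → HasCompactSupport f →
        MemLp (fun z => conj (f z)) 2 (volume.restrict (halfSpace n σ)) := fun hf hfs =>
      ((contDiff_conj hf).continuous.memLp_of_hasCompactSupport
        (hasCompactSupport_conj hfs)).restrict _
    refine Integrable.add (integrable_finsetSum _ fun i _ => ?_) ?_
    · exact (hW.2.2.1 i).integrable_mul (hl (contDiff_pderiv hv i) (hasCompactSupport_pderiv hvs i))
    · exact hW.2.2.2.integrable_mul (hl hv hvs)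
  -- exhaust the half-space by the half-spaces `στ > 1 / (N + 1)`
  have hlim1 : Filter.Tendsto (fun N : ℕ => ∫ z in {z : Space n | 1 / ((N : ℝ) + 1) < σ * z.2}, G z)
      Filter.atTop (nhds (∫ z in halfSpace n σ, G z)) := by
    have hU : ⋃ N : ℕ, {z : Space n | 1 / ((N : ℝ) + 1) < σ * z.2} = halfSpace n σ := by
      ext z
      simp only [Set.mem_iUnion, Set.mem_ofPred_eq, halfSpace]
      exact ⟨fun ⟨N, hN⟩ => lt_trans (by positivity) hN, exists_nat_one_div_lt⟩
    have := tendsto_setIntegral_of_monotone (μ := volume) (f := G)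
      (s := fun N : ℕ => {z : Space n | 1 / ((N : ℝ) + 1) < σ * z.2})
      (fun N => (isOpen_lt continuous_const (by fun_prop)).measurableSet)
      (fun N M hNM z (hz : _ < _) => show _ < _ from
        lt_of_le_of_lt (Nat.one_div_le_one_div (α := ℝ) hNM) hz)
      (by rw [hU]; exact hGi)
    rwa [hU] at this
  set q₁ : Space n → ℂ := fun z => pderiv none χ z * conj (v z) with hq₁
  set q₂ : Space n → ℂ := fun z => χ z * conj (v z) with hq₂
  have hq₁c : ContDiff ℝ ∞ q₁ := (contDiff_pderiv hχ.1 none).mul hcv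
  have hq₂c : ContDiff ℝ ∞ q₂ := hχ.1.mul hcv
  have hq₁s : HasCompactSupport q₁ := hcvs.mul_left
  have hq₂s : HasCompactSupport q₂ := hcvs.mul_left
  have hlim2 := ((tendsto_integral_pot_mul hk hσ hm.negHalf hq₁c hq₁s).add
    (tendsto_integral_pot_mul hk hσ hm' hq₂c hq₂s)).const_mul (-(σ : ℂ))
  have hint : ∀ {m' : Hyper n → ℂ} {q : Space n → ℂ} {ε : ℝ}, ExpIntegrable m' → ContDiff ℝ ∞ q →
      HasCompactSupport q → 0 < ε →
      Integrable fun x => pot k σ m' (x, σ * ε) * q (x, σ * ε) := by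
    intro m' q ε hm' hq hqs hε
    refine Continuous.integrable_of_hasCompactSupport (.mul ?_ ?_)
      (hasCompactSupport_slice hqs _).mul_left
    · refine (contDiffOn_zero.1 (contDiffOn_pot hk 0 hm')).comp_continuous (by fun_prop) fun x => ?_
      show 0 < σ * (σ * ε)
      rw [← mul_assoc, hσ2, one_mul]; exact hε
    · exact hq.continuous.comp (by fun_prop)
  have hslice : ∀ ε : ℝ, 0 < ε → ∫ z in {z : Space n | ε < σ * z.2}, G z =
      -(σ : ℂ) * ((∫ x, pot k σ m (x, σ * ε) * q₁ (x, σ * ε)) +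
        ∫ x, pot k σ (fun η => phase k σ η (coordVec none) * m η) (x, σ * ε) * q₂ (x, σ * ε)) := by
    intro ε hε
    rw [green_identity hσ hW.1 hv hvs hε, ← integral_add (hint hme hq₁c hq₁s hε)
      (hint hm'.expIntegrable hq₂c hq₂s hε)]
    congr 2; ext x
    have hz : (x, σ * ε) ∈ halfSpace n σ := by
      show 0 < σ * (σ * ε)
      rw [← mul_assoc, hσ2, one_mul]; exact hε
    rw [hw, pderiv_mul_pot hk hme hχ.1 none hz]
    simp only [hq₁, hq₂]
    ring
  have h0 : Filter.Tendsto (fun N : ℕ => 1 / ((N : ℝ) + 1)) Filter.atTop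
      (nhdsWithin 0 (Set.Ioi 0)) :=
    tendsto_nhdsWithin_iff.2 ⟨tendsto_one_div_add_atTop_nhds_zero_nat,
      .of_forall fun N => by show (0 : ℝ) < _; positivity⟩
  have hval := tendsto_nhds_unique hlim1 ((hlim2.comp h0).congr fun N =>
    (hslice _ (by positivity)).symm)
  -- the term with `∂ₙχ` disappears, as `χ = 1` near the support of `θ`
  have hz₁ : (fun x => q₁ (x, 0)) = fun _ => 0 := by
    ext x
    simp only [hq₁, hθ]
    by_cases hx : x ∈ Γ
    · have : pderiv none χ (x, 0) = 0 := by
        rw [pderiv_congr (w' := fun _ => 1) (hχ.2.2 x hx)]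
        simp [pderiv]
      rw [this, zero_mul]
    · rw [θ.eq_zero_of_notMem hx, map_zero, mul_zero]
  have hz₂ : (fun x => q₂ (x, 0)) = fun x => conj (θ x) := by
    ext x
    simp only [hq₂, hθ]
    by_cases hx : x ∈ Γ
    · rw [(hχ.2.2 x hx).self_of_nhds, one_mul]
    · rw [θ.eq_zero_of_notMem hx, map_zero, mul_zero]
  have hF0 : ∀ η : Hyper n, 𝓕⁻ (fun _ : Hyper n => (0 : ℂ)) η = 0 := fun η => by
    rw [Real.fourierInv_eq']; simp
  have hθF : (𝓕 θ.toL2 : L2 n) =ᵐ[volume] 𝓕 (θ : Hyper n → ℂ) :=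
    fourier_toLp_ae_eq (θ.contDiff.continuous.integrable_of_hasCompactSupport θ.hasCompactSupport)
      θ.memLp
  rw [hval, hz₁, hz₂]
  unfold fourierPairing
  simp only [hF0, mul_zero, integral_zero, zero_add, ← mul_assoc, neg_mul_neg]
  rw [show (σ : ℂ) * σ = 1 by exact_mod_cast hσ2, one_mul]
  refine integral_congr_ae ?_
  filter_upwards [hθF] with η hη
  rw [hη, fourierInv_conj]
  simp [phase_apply, coordVec]

/-- The Fourier multiplier of the hypersingular operator is `symb k / 2`. -/
theorem isHypersingular_fourierPairing (hn : n = 2 ∨ n = 3) (hk : 0 < k) {Γ : Opens (Hyper n)}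
    (hΓ : Bornology.IsBounded (Γ : Set (Hyper n))) (φ : HTilde Γ) :
    IsHypersingular k Γ φ fun θ =>
      fourierPairing (fun η => symb k η / 2 * (𝓕 (φ : L2 n) : L2 n) η) θ.toL2 := by
  intro χ hχ σ hσ
  have hσ2 : (σ : ℂ) * σ = 1 := by rcases hσ with h | h <;> simp [h]
  have hm : PosHalf fun η => (σ / 2 : ℂ) * (𝓕 (φ : L2 n) : L2 n) η := by
    refine ⟨(HTilde.posHalf φ).1.const_mul _, ((HTilde.posHalf φ).2.const_mul (‖(σ / 2 : ℂ)‖ ^ 2)).congr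
      (.of_forall fun η => ?_)⟩
    simp only [norm_mul]
    ring
  have h := (isNormalTrace_mul_pot hk.le hσ hm hχ).congr (w := fun x =>
    χ x * doubleLayer k Γ φ x) fun z hz => by
      simp only
      rw [doubleLayer_eq_pot hn hk hσ hΓ φ hz]
  convert h using 4 with θ η
  linear_combination (-(symb k η) / 2 * (𝓕 (φ : L2 n) : L2 n) η) * hσ2

end NormalTrace

/-! ### The sesquilinear form and its uniqueness -/

section Form
variable {n : ℕ} {k : ℝ} {Γ : Opens (Hyper n)}

lemma fourier_add (φ ψ : L2 n) : (𝓕 (φ + ψ) : L2 n) =ᵐ[volume]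
    fun η => (𝓕 φ : L2 n) η + (𝓕 ψ : L2 n) η := by
  rw [show (𝓕 (φ + ψ) : L2 n) = 𝓕 φ + 𝓕 ψ from (Lp.fourierTransformₗᵢ (Hyper n) ℂ).map_add φ ψ]
  exact Lp.coeFn_add _ _

lemma fourier_sub (φ ψ : L2 n) : (𝓕 (φ - ψ) : L2 n) =ᵐ[volume]
    fun η => (𝓕 φ : L2 n) η - (𝓕 ψ : L2 n) η := by
  rw [show (𝓕 (φ - ψ) : L2 n) = 𝓕 φ - 𝓕 ψ from (Lp.fourierTransformₗᵢ (Hyper n) ℂ).map_sub φ ψ]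
  exact Lp.coeFn_sub _ _

lemma fourier_smul (c : ℂ) (φ : L2 n) : (𝓕 (c • φ) : L2 n) =ᵐ[volume]
    fun η => c * (𝓕 φ : L2 n) η := by
  rw [show (𝓕 (c • φ) : L2 n) = c • 𝓕 φ from (Lp.fourierTransformₗᵢ (Hyper n) ℂ).map_smul c φ]
  exact Lp.coeFn_smul _ _

/-- The Fourier transform of `Tₖφ`, for `φ ∈ H̃^{1/2}(Γ)`. -/
def hyperDensity (k : ℝ) (φ : L2 n) (η : Hyper n) : ℂ := symb k η / 2 * (𝓕 φ : L2 n) η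

lemma PosHalf.negHalf_hyperDensity (hk : 0 ≤ k) {φ : L2 n} (hφ : PosHalf (𝓕 φ : L2 n)) :
    NegHalf (hyperDensity k φ) := by
  refine hφ.negHalf_of_le (C := k + 7)
    (((continuous_symb k).div_const 2).aestronglyMeasurable.mul hφ.1) fun η => ?_
  rw [hyperDensity, norm_mul, norm_div]
  refine mul_le_mul_of_nonneg_right ?_ (norm_nonneg _)
  have h := norm_symb_le hk η
  have : ‖(2 : ℂ)‖ = 2 := by simp
  rw [this]
  linarith [norm_nonneg (symb k η)]

/-- The form `∫ (symb k / 2) φ̂ conj ψ̂`. -/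
def hyperForm (hk : 0 ≤ k) (Γ : Opens (Hyper n)) : HTilde Γ →ₗ[ℂ] HTilde Γ →ₗ⋆[ℂ] ℂ :=
  LinearMap.mk₂'ₛₗ (RingHom.id ℂ) (starRingEnd ℂ)
    (fun φ ψ => fourierPairing (hyperDensity k (φ : L2 n)) (ψ : L2 n))
    (fun φ φ' ψ => by
      unfold fourierPairing
      rw [← integral_add
        ((HTilde.posHalf φ).negHalf_hyperDensity hk |>.integrable_mul_conj (HTilde.posHalf ψ))
        ((HTilde.posHalf φ').negHalf_hyperDensity hk |>.integrable_mul_conj (HTilde.posHalf ψ))]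
      refine integral_congr_ae ?_
      filter_upwards [fourier_add (φ : L2 n) (φ' : L2 n)] with η hη
      simp only [hyperDensity, Submodule.coe_add, hη]
      ring)
    (fun c φ ψ => by
      unfold fourierPairing
      rw [RingHom.id_apply, smul_eq_mul, ← integral_const_mul]
      refine integral_congr_ae ?_
      filter_upwards [fourier_smul c (φ : L2 n)] with η hη
      simp only [hyperDensity, Submodule.coe_smul, hη]
      ring)
    (fun φ ψ ψ' => by
      unfold fourierPairing
      rw [← integral_add
        ((HTilde.posHalf φ).negHalf_hyperDensity hk |>.integrable_mul_conj (HTilde.posHalf ψ))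
        ((HTilde.posHalf φ).negHalf_hyperDensity hk |>.integrable_mul_conj (HTilde.posHalf ψ'))]
      refine integral_congr_ae ?_
      filter_upwards [fourier_add (ψ : L2 n) (ψ' : L2 n)] with η hη
      simp only [Submodule.coe_add, hη, map_add]
      ring)
    (fun c φ ψ => by
      unfold fourierPairing
      rw [smul_eq_mul, ← integral_const_mul]
      refine integral_congr_ae ?_
      filter_upwards [fourier_smul c (ψ : L2 n)] with η hη
      simp only [Submodule.coe_smul, hη, map_mul]
      ring)

lemma hyperForm_apply (hk : 0 ≤ k) (φ ψ : HTilde Γ) :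
    hyperForm hk Γ φ ψ = fourierPairing (hyperDensity k (φ : L2 n)) (ψ : L2 n) := rfl

lemma isHypersingularForm_hyperForm (hn : n = 2 ∨ n = 3) (hk : 0 < k)
    (hΓ : Bornology.IsBounded (Γ : Set (Hyper n))) :
    IsHypersingularForm k Γ (hyperForm hk.le Γ) := fun φ =>
  ⟨_, isHypersingular_fourierPairing hn hk hΓ φ, fun _ => ⟨hyperDensity k (φ : L2 n),
    isNegHalfDensity_iff.2 ((HTilde.posHalf φ).negHalf_hyperDensity hk.le), fun _ => rfl, rfl⟩⟩

lemma exists_isCutoff (hΓ : Bornology.IsBounded (Γ : Set (Hyper n))) :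
    ∃ χ : Space n → ℂ, IsCutoff Γ χ := by
  obtain ⟨R, hR, hΓR⟩ := hΓ.subset_ball_lt 0 0
  let f : ContDiffBump (0 : Space n) := ⟨R, R + 1, hR, by linarith⟩
  refine ⟨fun z => (f z : ℂ), Complex.ofRealCLM.contDiff.comp f.contDiff,
    f.hasCompactSupport.comp_left (g := ((↑) : ℝ → ℂ)) (by simp), fun y hy => ?_⟩
  have hy' : ((y, 0) : Space n) ∈ Metric.ball (0 : Space n) R := by
    have := hΓR hy
    simpa [Prod.norm_def, hR] using this
  filter_upwards [Metric.isOpen_ball.mem_nhds hy'] with z hz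
  rw [f.one_of_mem_closedBall (Metric.ball_subset_closedBall hz), ofReal_one]

lemma exists_extension (θ : Test Γ) : ∃ v : Space n → ℂ, ContDiff ℝ ∞ v ∧ HasCompactSupport v ∧
    ∀ y : Hyper n, v (y, 0) = θ y := by
  let f : ContDiffBump (0 : ℝ) := ⟨1, 2, by norm_num, by norm_num⟩
  refine ⟨fun z => θ z.1 * (f z.2 : ℂ), ?_, ?_, fun y => ?_⟩
  · exact (θ.contDiff.comp contDiff_fst).mul
      (Complex.ofRealCLM.contDiff.comp (f.contDiff.comp contDiff_snd))
  · refine HasCompactSupport.intro (θ.hasCompactSupport.isCompact.prod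
      f.hasCompactSupport.isCompact) fun z hz => ?_
    by_contra h
    refine hz ⟨subset_tsupport _ (left_ne_zero_of_mul h), subset_tsupport _ fun h0 => ?_⟩
    exact right_ne_zero_of_mul h (by rw [h0, ofReal_zero])
  · have : f 0 = 1 := f.one_of_mem_closedBall (by simp [f.rIn_pos.le])
    simp [this]

lemma IsHypersingular.unique (hΓ : Bornology.IsBounded (Γ : Set (Hyper n))) {φ : HTilde Γ}
    {g g' : Test Γ → ℂ} (hg : IsHypersingular k Γ φ g) (hg' : IsHypersingular k Γ φ g') :
    g' = g := by
  obtain ⟨χ, hχ⟩ := exists_isCutoff hΓ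
  ext θ
  obtain ⟨v, hv, hvs, hvθ⟩ := exists_extension θ
  rw [(hg χ hχ 1 (Or.inl rfl)).2 θ v hv hvs hvθ, (hg' χ hχ 1 (Or.inl rfl)).2 θ v hv hvs hvθ]

lemma eHalfNorm_sq_eq (k : ℝ) (φ : L2 n) : eHalfNorm k φ ^ 2 = ∫⁻ η, ENNReal.ofReal
    (‖(𝓕 φ : L2 n) η‖ ^ 2 * (k ^ 2 + (2 * Real.pi * ‖η‖) ^ 2) ^ (1 / 2 : ℝ)) := by
  have h := eLpNorm_nnreal_pow_eq_lintegral (f := (𝓕 φ : L2 n))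
    (μ := sobolevMeasure n k (1 / 2)) (p := 2) (by norm_num)
  simp only [ENNReal.coe_ofNat, NNReal.coe_ofNat, ENNReal.rpow_ofNat] at h
  rw [eHalfNorm, h, sobolevMeasure, lintegral_withDensity_eq_lintegral_mul₀
    (measurable_weight n k _).aemeasurable
    ((Lp.aestronglyMeasurable (𝓕 φ : L2 n)).enorm.pow_const 2)]
  refine lintegral_congr fun η => ?_
  rw [Pi.mul_apply, mul_comm, ENNReal.ofReal_mul (by positivity), ← ofReal_norm,
    ENNReal.ofReal_pow (norm_nonneg _)]

lemma halfNorm_sq_eq (k : ℝ) (φ : L2 n) : halfNorm k φ ^ 2 =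
    ∫ η, ‖(𝓕 φ : L2 n) η‖ ^ 2 * (k ^ 2 + (2 * Real.pi * ‖η‖) ^ 2) ^ (1 / 2 : ℝ) := by
  rw [integral_eq_lintegral_of_nonneg_ae (.of_forall fun η => by positivity), ← eHalfNorm_sq_eq k,
    halfNorm, ENNReal.toReal_pow]
  exact ((Lp.aestronglyMeasurable _).norm.pow 2).mul
    (by fun_prop : Measurable fun η : Hyper n =>
      (k ^ 2 + (2 * Real.pi * ‖η‖) ^ 2) ^ (1 / 2 : ℝ)).aestronglyMeasurable

lemma PosHalf.integral_le {φ : L2 n} (hφ : PosHalf (𝓕 φ : L2 n)) :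
    ∫ η, ‖(𝓕 φ : L2 n) η‖ ^ 2 * (1 + ‖η‖) ≤ 2 * halfNorm 1 φ ^ 2 := by
  have hi := ((memLp_sobolevMeasure_iff one_pos (1 / 2) (F := (𝓕 φ : L2 n))).1
    ⟨aesm_fourier 1 _ φ, posHalf_iff.1 hφ⟩).2
  rw [halfNorm_sq_eq, ← integral_const_mul]
  refine integral_mono hφ.2 (hi.const_mul 2) fun η => ?_
  have h := (weight_one_bounds η).1
  have h2 : 0 ≤ ‖(𝓕 φ : L2 n) η‖ ^ 2 := by positivity
  simp only
  nlinarith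

/-- A weighted Young inequality for the duality of `H^{-1/2}` and `H^{1/2}`. -/
lemma NegHalf.norm_fourierPairing_le {m : Hyper n → ℂ} (hm : NegHalf m) {v : L2 n}
    (hv : PosHalf (𝓕 v : L2 n)) {ε : ℝ} (hε : 0 < ε) : ‖fourierPairing m v‖ ≤
      ε / 2 * (∫ η, ‖m η‖ ^ 2 / (1 + ‖η‖)) + ε⁻¹ * halfNorm 1 v ^ 2 := by
  calc ‖fourierPairing m v‖ ≤ ∫ η, ‖m η * conj ((𝓕 v : L2 n) η)‖ := norm_integral_le_integral_norm _
    _ ≤ ∫ η, (ε / 2 * (‖m η‖ ^ 2 / (1 + ‖η‖)) +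
          ε⁻¹ / 2 * (‖(𝓕 v : L2 n) η‖ ^ 2 * (1 + ‖η‖))) := by
        refine integral_mono (hm.integrable_mul_conj hv).norm
          ((hm.2.const_mul _).add (hv.2.const_mul _)) fun η => ?_
        simp only [norm_mul, RCLike.norm_conj]
        have hp : 0 < 1 + ‖η‖ := by positivity
        have h := sq_nonneg (ε * ‖m η‖ - ‖(𝓕 v : L2 n) η‖ * (1 + ‖η‖))
        have e : ε / 2 * (‖m η‖ ^ 2 / (1 + ‖η‖)) + ε⁻¹ / 2 * (‖(𝓕 v : L2 n) η‖ ^ 2 * (1 + ‖η‖)) -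
            ‖m η‖ * ‖(𝓕 v : L2 n) η‖ =
            (ε * ‖m η‖ - ‖(𝓕 v : L2 n) η‖ * (1 + ‖η‖)) ^ 2 / (2 * ε * (1 + ‖η‖)) := by
          field_simp
          ring
        have : 0 ≤ (ε * ‖m η‖ - ‖(𝓕 v : L2 n) η‖ * (1 + ‖η‖)) ^ 2 / (2 * ε * (1 + ‖η‖)) := by
          positivity
        linarith
    _ ≤ _ := by
        rw [integral_add (hm.2.const_mul _) (hv.2.const_mul _), integral_const_mul,
          integral_const_mul]
        have := mul_le_mul_of_nonneg_left hv.integral_le (by positivity : 0 ≤ ε⁻¹ / 2)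
        linarith

lemma NegHalf.sub {m m' : Hyper n → ℂ} (hm : NegHalf m) (hm' : NegHalf m') :
    NegHalf fun η => m η - m' η := by
  refine ⟨hm.1.sub hm'.1, ((hm.2.add hm'.2).const_mul 2).mono'
    (((hm.1.sub hm'.1).norm.pow 2).mul (by fun_prop : Measurable fun η : Hyper n =>
        (1 + ‖η‖)⁻¹).aestronglyMeasurable) (.of_forall fun η => ?_)⟩
  rw [Real.norm_of_nonneg (by positivity)]
  simp only [Pi.add_apply]
  rw [← add_div, mul_div_assoc']
  have h : ‖m η - m' η‖ ^ 2 ≤ 2 * (‖m η‖ ^ 2 + ‖m' η‖ ^ 2) := by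
    have h1 := norm_sub_le (m η) (m' η)
    have h2 : ‖m η - m' η‖ ^ 2 ≤ (‖m η‖ + ‖m' η‖) ^ 2 := by gcongr
    nlinarith [sq_nonneg (‖m η‖ - ‖m' η‖)]
  gcongr

/-- By density of the test functions, an element of `H^{-1/2}(Γ)` has only one extension to an
antilinear form on `H̃^{1/2}(Γ)`. -/
lemma fourierPairing_eq_of_test {m m' : Hyper n → ℂ} (hm : NegHalf m) (hm' : NegHalf m')
    (h : ∀ θ : Test Γ, fourierPairing m θ.toL2 = fourierPairing m' θ.toL2) (ψ : HTilde Γ) :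
    fourierPairing m ψ = fourierPairing m' ψ := by
  have hd := hm.sub hm'
  set d : Hyper n → ℂ := fun η => m η - m' η
  set A := ∫ η, ‖d η‖ ^ 2 / (1 + ‖η‖)
  have hsub : ∀ {v : L2 n}, PosHalf (𝓕 v : L2 n) →
      fourierPairing d v = fourierPairing m v - fourierPairing m' v := fun {v} hv => by
    unfold fourierPairing
    rw [← integral_sub (hm.integrable_mul_conj hv) (hm'.integrable_mul_conj hv)]
    simp only [d, sub_mul]
  have hbound : ∀ ε : ℝ, 0 < ε → ‖fourierPairing d ψ‖ ≤ ε * (A / 2 + 1) := by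
    intro ε hε
    obtain ⟨θ, hθ⟩ := ψ.2.2 (ENNReal.ofReal ε) (by simpa using hε)
    have hlt : eHalfNorm 1 ((ψ : L2 n) - θ.toL2) < ⊤ := hθ.trans ENNReal.ofReal_lt_top
    have hv : PosHalf (𝓕 ((ψ : L2 n) - θ.toL2) : L2 n) := posHalf_iff.2 hlt
    have hψ := HTilde.posHalf ψ
    have hθp : PosHalf (𝓕 θ.toL2 : L2 n) := by
      refine posHalf_iff.2 ?_
      have e : θ.toL2 = (ψ : L2 n) + (-1 : ℂ) • ((ψ : L2 n) - θ.toL2) := by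
        rw [neg_one_smul]; abel
      rw [e]
      refine (eHalfNorm_add_le 1 _ _).trans_lt (ENNReal.add_lt_top.2 ⟨ψ.2.1, ?_⟩)
      rw [eHalfNorm_smul]
      exact ENNReal.mul_lt_top enorm_lt_top hlt
    have hshift : fourierPairing d ψ = fourierPairing d ((ψ : L2 n) - θ.toL2) := by
      have h0 : fourierPairing d θ.toL2 = 0 := by rw [hsub hθp, h θ, sub_self]
      rw [← sub_zero (fourierPairing d ψ), ← h0]
      unfold fourierPairing
      rw [← integral_sub (hd.integrable_mul_conj hψ) (hd.integrable_mul_conj hθp)]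
      refine integral_congr_ae ?_
      filter_upwards [fourier_sub (ψ : L2 n) θ.toL2] with η hη
      rw [hη, map_sub, mul_sub]
    have hnorm : halfNorm 1 ((ψ : L2 n) - θ.toL2) ≤ ε := ENNReal.toReal_le_of_le_ofReal hε.le hθ.le
    have hnorm0 : 0 ≤ halfNorm 1 ((ψ : L2 n) - θ.toL2) := ENNReal.toReal_nonneg
    rw [hshift]
    calc _ ≤ ε / 2 * A + ε⁻¹ * halfNorm 1 ((ψ : L2 n) - θ.toL2) ^ 2 :=
          hd.norm_fourierPairing_le hv hε
      _ ≤ ε / 2 * A + ε⁻¹ * ε ^ 2 := by gcongr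
      _ = _ := by field_simp
  have hA : 0 ≤ A := integral_nonneg fun η => by positivity
  have hz : ‖fourierPairing d ψ‖ ≤ 0 := by
    refine le_of_forall_pos_le_add fun δ hδ => ?_
    have := hbound (δ / (A / 2 + 1)) (by positivity)
    rwa [div_mul_cancel₀ _ (by positivity), ← zero_add δ] at this
  exact sub_eq_zero.1 ((hsub (HTilde.posHalf ψ)).symm.trans (norm_le_zero_iff.1 hz))

theorem IsHypersingularForm.eq_hyperForm (hn : n = 2 ∨ n = 3) (hk : 0 < k)
    (hΓ : Bornology.IsBounded (Γ : Set (Hyper n))) {a : HTilde Γ →ₗ[ℂ] HTilde Γ →ₗ⋆[ℂ] ℂ}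
    (ha : IsHypersingularForm k Γ a) : a = hyperForm hk.le Γ := by
  ext φ ψ
  obtain ⟨g, hg, hpair⟩ := ha φ
  obtain ⟨m, hm, hgm, hval⟩ := hpair ψ
  have hgg := (isHypersingular_fourierPairing hn hk hΓ φ).unique hΓ hg
  rw [hval, hyperForm_apply]
  refine fourierPairing_eq_of_test (isNegHalfDensity_iff.1 hm)
    ((HTilde.posHalf φ).negHalf_hyperDensity hk.le) (fun θ => ?_) ψ
  rw [← hgm θ, hgg]
  rfl

end Form

/-! ### Coercivity -/

section Coercivity
variable {n : ℕ} {k : ℝ} {Γ : Opens (Hyper n)}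

lemma integral_norm_sq_eq {α : Type*} [MeasurableSpace α] {μ : Measure α} {f : α → ℂ}
    (hf : AEStronglyMeasurable f μ) : ∫ x, ‖f x‖ ^ 2 ∂μ = (eLpNorm f 2 μ ^ 2).toReal := by
  have h := eLpNorm_nnreal_pow_eq_lintegral (f := f) (μ := μ) (p := 2) (by norm_num)
  simp only [ENNReal.coe_ofNat, NNReal.coe_ofNat, ENNReal.rpow_ofNat] at h
  have hm : AEStronglyMeasurable (fun x => ‖f x‖ ^ 2) μ := hf.norm.pow 2
  rw [h, integral_eq_lintegral_of_nonneg_ae (.of_forall fun x => by positivity) hm]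
  congr 1
  refine lintegral_congr fun x => ?_
  rw [ENNReal.ofReal_pow (norm_nonneg _), ofReal_norm]

lemma integral_norm_fourier_sq {V : Type*} [NormedAddCommGroup V] [InnerProductSpace ℝ V]
    [FiniteDimensional ℝ V] [MeasurableSpace V] [BorelSpace V] {f : V → ℂ} (h1 : Integrable f)
    (h2 : MemLp f 2) : ∫ η, ‖𝓕 f η‖ ^ 2 = ∫ x, ‖f x‖ ^ 2 := by
  rw [integral_norm_sq_eq (continuous_fourier h1).aestronglyMeasurable, integral_norm_sq_eq h2.1,
    eLpNorm_fourier h1 h2]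

/-- The Fourier transform of a function supported in a set of diameter `L` varies slowly: up to a
unimodular factor, a translation by `h` changes it in `L²` by the relative amount `2π‖h‖L`. -/
lemma integral_fourier_shift_le (hne : (Γ : Set (Hyper n)).Nonempty)
    (hΓ : Bornology.IsBounded (Γ : Set (Hyper n))) (φ : HTilde Γ) (h : Hyper n) :
    ∃ c : ℂ, ‖c‖ = 1 ∧ MemLp (fun η => c * 𝓕 ((φ : L2 n) : Hyper n → ℂ) (η + h) -
      𝓕 ((φ : L2 n) : Hyper n → ℂ) η) 2 ∧
    ∫ η, ‖c * 𝓕 ((φ : L2 n) : Hyper n → ℂ) (η + h) - 𝓕 ((φ : L2 n) : Hyper n → ℂ) η‖ ^ 2 ≤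
      (2 * Real.pi * ‖h‖ * Metric.diam (Γ : Set (Hyper n))) ^ 2 *
        ∫ η, ‖𝓕 ((φ : L2 n) : Hyper n → ℂ) η‖ ^ 2 := by
  obtain ⟨y₀, hy₀⟩ := hne
  set u : Hyper n → ℂ := ((φ : L2 n) : Hyper n → ℂ)
  have hu1 : Integrable u := HTilde.integrable hΓ φ
  have hu2 : MemLp u 2 := Lp.memLp _
  set b : Hyper n → ℂ := fun y => cexp ((-2 * Real.pi * inner ℝ (y - y₀) h : ℝ) * I) with hb
  have hbc : Continuous b := by fun_prop
  have hb1 : ∀ y, ‖b y‖ = 1 := fun y => Complex.norm_exp_ofReal_mul_I _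
  have hbu1 : Integrable fun y => b y * u y :=
    hu1.bdd_mul (c := 1) hbc.aestronglyMeasurable (.of_forall fun y => (hb1 y).le)
  have hbu2 : MemLp (fun y => b y * u y) 2 :=
    hu2.of_le (hbc.aestronglyMeasurable.mul hu2.1) (.of_forall fun y => by rw [norm_mul, hb1, one_mul])
  have hd1 : Integrable fun y => b y * u y - u y := hbu1.sub hu1
  have hd2 : MemLp (fun y => b y * u y - u y) 2 := hbu2.sub hu2
  have hFT : ∀ η, 𝓕 (fun y => b y * u y - u y) η =
      cexp ((2 * Real.pi * inner ℝ y₀ h : ℝ) * I) * 𝓕 u (η + h) - 𝓕 u η := by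
    intro η
    simp only [Real.fourier_eq']
    have hi : ∀ ζ : Hyper n, Integrable fun y =>
        cexp ((-2 * Real.pi * inner ℝ y ζ : ℝ) * I) • u y := fun ζ => by
      refine hu1.bdd_mul (c := 1) (by fun_prop : Continuous _).aestronglyMeasurable
        (.of_forall fun y => (Complex.norm_exp_ofReal_mul_I _).le)
    rw [← integral_const_mul, ← integral_sub ((hi (η + h)).const_mul _) (hi η)]
    congr 1; ext y
    simp only [smul_eq_mul, hb]
    rw [mul_sub, ← mul_assoc, ← mul_assoc, ← Complex.exp_add, ← Complex.exp_add]
    congr 3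
    rw [inner_sub_left, inner_add_right]
    push_cast
    ring
  refine ⟨cexp ((2 * Real.pi * inner ℝ y₀ h : ℝ) * I), Complex.norm_exp_ofReal_mul_I _, ?_, ?_⟩
  · have hmeas : AEStronglyMeasurable (𝓕 fun y => b y * u y - u y) :=
      (continuous_fourier hd1).aestronglyMeasurable
    simp only [← hFT]
    refine ⟨hmeas, ?_⟩
    exact (eLpNorm_fourier hd1 hd2).trans_lt hd2.2
  · simp only [← hFT]
    rw [integral_norm_fourier_sq hd1 hd2, integral_norm_fourier_sq hu1 hu2,
      ← integral_const_mul]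
    refine integral_mono_ae ((memLp_two_iff_integrable_sq_norm hd2.1).1 hd2)
      (((memLp_two_iff_integrable_sq_norm hu2.1).1 hu2).const_mul _) ?_
    filter_upwards [HTilde.ae_eq_zero φ] with y hy
    rw [← mul_pow]
    refine pow_le_pow_left₀ (norm_nonneg _) ?_ 2
    by_cases hyΓ : y ∈ Γ
    · rw [show b y * u y - u y = (b y - 1) * u y by ring, norm_mul]
      refine mul_le_mul_of_nonneg_right ?_ (norm_nonneg _)
      calc ‖b y - 1‖ ≤ ‖-2 * Real.pi * inner ℝ (y - y₀) h‖ := by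
            rw [hb]
            simp only
            rw [mul_comm]
            exact Real.norm_exp_I_mul_ofReal_sub_one_le
        _ ≤ 2 * Real.pi * (‖y - y₀‖ * ‖h‖) := by
            rw [norm_mul, norm_mul, norm_neg, Real.norm_of_nonneg Real.pi_pos.le, Real.norm_ofNat]
            gcongr
            exact norm_inner_le_norm _ _
        _ ≤ 2 * Real.pi * (Metric.diam (Γ : Set (Hyper n)) * ‖h‖) := by
            gcongr
            rw [← dist_eq_norm]
            exact Metric.dist_le_diam_of_mem hΓ hyΓ hy₀
        _ = _ := by ring
    · rw [show u y = 0 from hy hyΓ]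
      simp

lemma HTilde.integrable_fourier_sq (φ : HTilde Γ) :
    Integrable fun η => ‖(𝓕 (φ : L2 n) : L2 n) η‖ ^ 2 :=
  (memLp_two_iff_integrable_sq_norm (Lp.aestronglyMeasurable _)).1 (Lp.memLp (𝓕 (φ : L2 n) : L2 n))

/-- If the translation by `h` moves `B` into `D`, the mass of `φ̂` on `B` is controlled by that on
`D`, up to a fraction of the total mass that is small for `‖h‖L` small. -/
lemma setIntegral_fourier_sq_le (hne : (Γ : Set (Hyper n)).Nonempty)
    (hΓ : Bornology.IsBounded (Γ : Set (Hyper n))) (φ : HTilde Γ) (h : Hyper n)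
    {B D : Set (Hyper n)} (hB : MeasurableSet B) (hD : MeasurableSet D)
    (hBD : ∀ η ∈ B, η + h ∈ D) :
    ∫ η in B, ‖(𝓕 (φ : L2 n) : L2 n) η‖ ^ 2 ≤ 2 * (∫ η in D, ‖(𝓕 (φ : L2 n) : L2 n) η‖ ^ 2) +
      2 * (2 * Real.pi * ‖h‖ * Metric.diam (Γ : Set (Hyper n))) ^ 2 *
        ∫ η, ‖(𝓕 (φ : L2 n) : L2 n) η‖ ^ 2 := by
  obtain ⟨c, hc, hmem, hle⟩ := integral_fourier_shift_le hne hΓ φ h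
  have hae : (fun η => ‖(𝓕 (φ : L2 n) : L2 n) η‖ ^ 2) =ᵐ[volume]
      fun η => ‖𝓕 ((φ : L2 n) : Hyper n → ℂ) η‖ ^ 2 := by
    filter_upwards [HTilde.fourier_ae_eq hΓ φ] with η hη
    rw [hη]
  have hf2 := (HTilde.integrable_fourier_sq φ).congr hae
  rw [integral_congr_ae hae, integral_congr_ae (ae_restrict_of_ae hae),
    integral_congr_ae (ae_restrict_of_ae hae)]
  set f : Hyper n → ℂ := 𝓕 ((φ : L2 n) : Hyper n → ℂ)
  have hg2 := (memLp_two_iff_integrable_sq_norm hmem.1).1 hmem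
  have hDi := hf2.indicator hD
  have hshift := hDi.comp_add_right h
  have hpt : ∀ η, B.indicator (fun η => ‖f η‖ ^ 2) η ≤
      2 * D.indicator (fun η => ‖f η‖ ^ 2) (η + h) + 2 * ‖c * f (η + h) - f η‖ ^ 2 := by
    intro η
    by_cases hη : η ∈ B
    · rw [Set.indicator_of_mem hη, Set.indicator_of_mem (hBD η hη)]
      have h1 : ‖f η‖ ≤ ‖f (η + h)‖ + ‖c * f (η + h) - f η‖ := by
        calc ‖f η‖ = ‖c * f (η + h) - (c * f (η + h) - f η)‖ := by congr 1; ring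
          _ ≤ ‖c * f (η + h)‖ + ‖c * f (η + h) - f η‖ := norm_sub_le _ _
          _ = _ := by rw [norm_mul, hc, one_mul]
      have h2 : ‖f η‖ ^ 2 ≤ (‖f (η + h)‖ + ‖c * f (η + h) - f η‖) ^ 2 := by gcongr
      nlinarith [sq_nonneg (‖f (η + h)‖ - ‖c * f (η + h) - f η‖)]
    · rw [Set.indicator_of_notMem hη]
      have : 0 ≤ D.indicator (fun η => ‖f η‖ ^ 2) (η + h) :=
        Set.indicator_nonneg (fun _ _ => by positivity) _
      positivity
  calc ∫ η in B, ‖f η‖ ^ 2 = ∫ η, B.indicator (fun η => ‖f η‖ ^ 2) η := (integral_indicator hB).symm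
    _ ≤ ∫ η, (2 * D.indicator (fun η => ‖f η‖ ^ 2) (η + h) + 2 * ‖c * f (η + h) - f η‖ ^ 2) :=
        integral_mono (hf2.indicator hB) ((hshift.const_mul 2).add (hg2.const_mul 2)) hpt
    _ = 2 * (∫ η in D, ‖f η‖ ^ 2) + 2 * ∫ η, ‖c * f (η + h) - f η‖ ^ 2 := by
        rw [integral_add (hshift.const_mul 2) (hg2.const_mul 2), integral_const_mul,
          integral_const_mul,
          integral_add_right_eq_self (D.indicator fun η => ‖f η‖ ^ 2) h, integral_indicator hD]
    _ ≤ _ := by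
        rw [mul_assoc 2 (_ ^ 2)]
        gcongr

/-- The annulus of relative width `δ` around the sphere `|2πη| = k`, where the symbol vanishes. -/
def annulus (n : ℕ) (k δ : ℝ) : Set (Hyper n) := {η | |2 * Real.pi * ‖η‖ - k| < δ * k}

lemma measurableSet_annulus (n : ℕ) (k δ : ℝ) : MeasurableSet (annulus n k δ) :=
  (isOpen_lt (by fun_prop) continuous_const).measurableSet

/-- A translation by `6δk` (in `ξ = 2πη`) in a direction `e` moves those points of the annulus out
of it which form an angle of at most `π / 4` with `e`. -/
lemma add_smul_notMem_annulus {δ : ℝ} (hk : 0 < k) (hδ : 0 < δ) (hδ' : δ ≤ 1 / 2) {η e : Hyper n}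
    (he : ‖e‖ = 1) (hη : η ∈ annulus n k δ) (h0 : 0 ≤ inner ℝ η e)
    (hηe : ‖η‖ ^ 2 ≤ 2 * inner ℝ η e ^ 2) :
    η + (6 * δ * k / (2 * Real.pi)) • e ∈ (annulus n k δ)ᶜ := by
  have hpi : 0 < 2 * Real.pi := by positivity
  have hη' : |2 * Real.pi * ‖η‖ - k| < δ * k := hη
  have h1 := (abs_lt.1 hη').1
  set p := 2 * Real.pi * inner ℝ η e with hp
  have hp0 : 0 ≤ p := by positivity
  have hp2 : (2 * Real.pi * ‖η‖) ^ 2 ≤ 2 * p ^ 2 := by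
    rw [hp, mul_pow, mul_pow]
    nlinarith [sq_nonneg (2 * Real.pi)]
  have hsq : (2 * Real.pi * ‖η + (6 * δ * k / (2 * Real.pi)) • e‖) ^ 2 =
      (2 * Real.pi * ‖η‖) ^ 2 + 12 * δ * k * p + (6 * δ * k) ^ 2 := by
    rw [mul_pow, norm_add_sq_real, norm_smul, he, real_inner_smul_right, hp,
      Real.norm_of_nonneg (by positivity)]
    field_simp
    ring
  intro hmem
  have hmem' : |2 * Real.pi * ‖η + (6 * δ * k / (2 * Real.pi)) • e‖ - k| < δ * k := hmem
  have h2 := (abs_lt.1 hmem').2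
  set t := 2 * Real.pi * ‖η‖
  set T := 2 * Real.pi * ‖η + (6 * δ * k / (2 * Real.pi)) • e‖ with hT
  have hT0 : 0 ≤ T := by positivity
  have ht : (1 - δ) * k < t := by linarith
  have hT1 : T < (1 + δ) * k := by linarith
  have hT2 : T ^ 2 < ((1 + δ) * k) ^ 2 := by gcongr
  have ht2 : ((1 - δ) * k) ^ 2 ≤ t ^ 2 := by
    have : 0 ≤ (1 - δ) * k := mul_nonneg (by linarith) hk.le
    gcongr
  -- `√2 p ≥ t ≥ k / 2`, so that `p > k / 3`
  have hp3 : k / 3 ≤ p := by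
    by_contra hlt
    push Not at hlt
    have h3 : p ^ 2 < (k / 3) ^ 2 := by gcongr
    have h4 : (1 / 2 * k) ^ 2 ≤ ((1 - δ) * k) ^ 2 := by
      gcongr
      linarith
    nlinarith
  have h5 : 12 * δ * k * (k / 3) ≤ 12 * δ * k * p := by gcongr
  nlinarith [sq_nonneg (δ * k)]

lemma exists_coord_sq_ge (hn : n = 2 ∨ n = 3) (η : Hyper n) :
    ∃ j : Fin (n - 1), ‖η‖ ^ 2 ≤ 2 * η j ^ 2 := by
  have hne : (Finset.univ : Finset (Fin (n - 1))).Nonempty := by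
    rcases hn with rfl | rfl <;> exact ⟨0, Finset.mem_univ _⟩
  have hcard : ((n - 1 : ℕ) : ℝ) ≤ 2 := by rcases hn with rfl | rfl <;> norm_num
  obtain ⟨j, -, hj⟩ := Finset.exists_le_of_sum_le (s := Finset.univ)
    (f := fun _ : Fin (n - 1) => ‖η‖ ^ 2 / 2) (g := fun j => η j ^ 2) hne (by
      rw [Finset.sum_const, Finset.card_univ, Fintype.card_fin, nsmul_eq_mul]
      have : ∑ j, η j ^ 2 = ‖η‖ ^ 2 := by rw [EuclideanSpace.norm_sq_eq]; simp
      rw [this]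
      nlinarith [sq_nonneg ‖η‖])
  exact ⟨j, by linarith⟩

/-- At most a fixed fraction of `|φ̂|²` is concentrated on an annulus whose width is small compared
to `1 / L`. -/
lemma setIntegral_annulus_le (hn : n = 2 ∨ n = 3) (hne : (Γ : Set (Hyper n)).Nonempty)
    (hΓ : Bornology.IsBounded (Γ : Set (Hyper n))) (hk : 0 < k) {δ : ℝ} (hδ : 0 < δ)
    (hδ' : δ ≤ 1 / 2) (hδL : δ * (k * Metric.diam (Γ : Set (Hyper n))) ≤ 1 / 24) (φ : HTilde Γ) :
    ∫ η in annulus n k δ, ‖(𝓕 (φ : L2 n) : L2 n) η‖ ^ 2 ≤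
      17 * ∫ η in (annulus n k δ)ᶜ, ‖(𝓕 (φ : L2 n) : L2 n) η‖ ^ 2 := by
  set f : Hyper n → ℝ := fun η => ‖(𝓕 (φ : L2 n) : L2 n) η‖ ^ 2
  have hf : Integrable f := HTilde.integrable_fourier_sq φ
  have hf0 : ∀ η, 0 ≤ f η := fun η => by positivity
  set A := annulus n k δ
  have hA : MeasurableSet A := measurableSet_annulus n k δ
  -- The annulus is covered by `2(n - 1) ≤ 4` pieces, in each of which `η` forms an angle of at most
  -- `π / 4` with one of the vectors `±eⱼ`; each piece is moved out of the annulus by a translation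
  -- of length `6δk` in `ξ`, for which the relative error is `6δkL ≤ 1 / 4`.
  set E : Fin (n - 1) × Bool → Hyper n := fun p => EuclideanSpace.single p.1 (bif p.2 then 1 else -1)
  have hE : ∀ p, ‖E p‖ = 1 := by rintro ⟨j, _ | _⟩ <;> simp [E]
  set S : Fin (n - 1) × Bool → Set (Hyper n) := fun p =>
    A ∩ {η | 0 ≤ inner ℝ η (E p) ∧ ‖η‖ ^ 2 ≤ 2 * inner ℝ η (E p) ^ 2}
  have hS : ∀ p, MeasurableSet (S p) := fun p =>
    hA.inter (((isClosed_le (by fun_prop) (by fun_prop) : IsClosed {η | 0 ≤ inner ℝ η (E p)}).inter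
      (isClosed_le (by fun_prop) (by fun_prop) :
        IsClosed {η | ‖η‖ ^ 2 ≤ 2 * inner ℝ η (E p) ^ 2})).measurableSet)
  have hcover : ∀ η ∈ A, ∃ p, η ∈ S p := by
    intro η hη
    obtain ⟨j, hj⟩ := exists_coord_sq_ge hn η
    rcases le_total 0 (η j) with h | h
    · exact ⟨(j, true), hη, by simpa [E, EuclideanSpace.inner_single_right] using h,
        by simpa [E, EuclideanSpace.inner_single_right] using hj⟩
    · exact ⟨(j, false), hη, by simpa [E, EuclideanSpace.inner_single_right] using h,
        by simpa [E, EuclideanSpace.inner_single_right] using hj⟩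
  set P := ∫ η, f η
  have hP0 : 0 ≤ P := integral_nonneg hf0
  set Q := ∫ η in Aᶜ, f η
  have hQ0 : 0 ≤ Q := integral_nonneg hf0
  have hpiece : ∀ p, ∫ η in S p, f η ≤ 2 * Q + 1 / 8 * P := by
    intro p
    refine (setIntegral_fourier_sq_le hne hΓ φ ((6 * δ * k / (2 * Real.pi)) • E p) (hS p) hA.compl
      fun η hη => add_smul_notMem_annulus hk hδ hδ' (hE p) hη.1 hη.2.1 hη.2.2).trans ?_
    rw [norm_smul, hE, Real.norm_of_nonneg (by positivity)]
    have e : 2 * Real.pi * (6 * δ * k / (2 * Real.pi) * 1) * Metric.diam (Γ : Set (Hyper n)) =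
        6 * (δ * (k * Metric.diam (Γ : Set (Hyper n)))) := by
      field_simp
    rw [e]
    have h0 : 0 ≤ δ * (k * Metric.diam (Γ : Set (Hyper n))) := by
      have := Metric.diam_nonneg (s := (Γ : Set (Hyper n)))
      positivity
    have : (6 * (δ * (k * Metric.diam (Γ : Set (Hyper n))))) ^ 2 ≤ (1 / 4) ^ 2 := by
      gcongr
      linarith
    have h2 : 2 * (6 * (δ * (k * Metric.diam (Γ : Set (Hyper n))))) ^ 2 * P ≤ 1 / 8 * P := by
      gcongr
      linarith
    linarith
  have hsum : ∫ η in A, f η ≤ ∑ p, ∫ η in S p, f η := by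
    rw [← integral_indicator hA, Finset.sum_congr rfl fun p _ => (integral_indicator (hS p)).symm,
      ← integral_finsetSum _ fun p _ => hf.indicator (hS p)]
    refine integral_mono (hf.indicator hA) (integrable_finsetSum _ fun p _ => hf.indicator (hS p))
      fun η => ?_
    have hnn : ∀ p ∈ Finset.univ, 0 ≤ (S p).indicator f η := fun p _ =>
      Set.indicator_nonneg (fun η _ => hf0 η) η
    by_cases hη : η ∈ A
    · obtain ⟨p, hp⟩ := hcover η hη
      rw [Set.indicator_of_mem hη]
      calc f η = (S p).indicator f η := (Set.indicator_of_mem hp f).symm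
        _ ≤ _ := Finset.single_le_sum hnn (Finset.mem_univ p)
    · rw [Set.indicator_of_notMem hη]
      exact Finset.sum_nonneg hnn
  have hcard : ((n - 1 : ℕ) : ℝ) * 2 ≤ 4 := by rcases hn with rfl | rfl <;> norm_num
  have htotal : ∑ p, ∫ η in S p, f η ≤ 4 * (2 * Q + 1 / 8 * P) := by
    calc ∑ p, ∫ η in S p, f η ≤ ∑ _p : Fin (n - 1) × Bool, (2 * Q + 1 / 8 * P) :=
          Finset.sum_le_sum fun p _ => hpiece p
      _ = ((n - 1 : ℕ) : ℝ) * 2 * (2 * Q + 1 / 8 * P) := by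
          rw [Finset.sum_const, Finset.card_univ, nsmul_eq_mul]
          simp
      _ ≤ _ := by gcongr
  have hsplit : (∫ η in A, f η) + Q = P := integral_add_compl hA hf
  linarith

/-- Outside the annulus, `k² + |ξ|²` is controlled by `||ξ|² - k²|`. -/
lemma weight_le_of_notMem_annulus {δ t : ℝ} (hk : 0 < k) (hδ : 0 < δ) (hδ' : δ ≤ 1 / 2)
    (ht : 0 ≤ t) (h : δ * k ≤ |t - k|) : δ * (k ^ 2 + t ^ 2) ≤ 4 * |t ^ 2 - k ^ 2| := by
  rcases le_total t k with htk | htk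
  · rw [abs_of_nonpos (by linarith)] at h
    rw [abs_of_nonpos (by nlinarith)]
    have h1 : t ^ 2 ≤ ((1 - δ) * k) ^ 2 := by
      gcongr
      linarith
    nlinarith [mul_pos hδ (pow_pos hk 2), mul_nonneg hδ.le (sq_nonneg (δ * k)), sq_nonneg (δ * k)]
  · rw [abs_of_nonneg (by linarith)] at h
    rw [abs_of_nonneg (by nlinarith)]
    have h1 : δ * t ≤ (1 + δ) * (t - k) := by nlinarith
    have h2 : δ * t ≤ 3 / 2 * (t - k) := by nlinarith
    have h3 : δ * t * t ≤ 3 / 2 * (t - k) * (t + k) := by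
      have : 0 ≤ 3 / 2 * (t - k) := by linarith
      calc δ * t * t ≤ 3 / 2 * (t - k) * t := by gcongr
        _ ≤ _ := by gcongr; linarith
    have h4 : k ^ 2 ≤ t ^ 2 := by gcongr
    nlinarith

lemma integrable_symb_mul (hk : 0 ≤ k) (φ : HTilde Γ) :
    Integrable fun η => ‖symb k η‖ * ‖(𝓕 (φ : L2 n) : L2 n) η‖ ^ 2 := by
  refine ((HTilde.posHalf φ).2.const_mul (k + 7)).mono'
    ((continuous_symb k).norm.aestronglyMeasurable.mul ((Lp.aestronglyMeasurable _).norm.pow 2))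
    (.of_forall fun η => ?_)
  rw [Real.norm_of_nonneg (by positivity)]
  have := mul_le_mul_of_nonneg_right (norm_symb_le hk η)
    (sq_nonneg ‖(𝓕 (φ : L2 n) : L2 n) η‖)
  linarith

lemma sqrt_weight_le (hk : 0 ≤ k) (η : Hyper n) :
    √(k ^ 2 + (2 * Real.pi * ‖η‖) ^ 2) ≤ (k + 7) * (1 + ‖η‖) := by
  have h7 : 2 * Real.pi * ‖η‖ ≤ 7 * ‖η‖ := by
    have := Real.pi_lt_d2
    gcongr
    linarith
  refine Real.sqrt_le_iff.2 ⟨by positivity, ?_⟩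
  have h : (2 * Real.pi * ‖η‖) ^ 2 ≤ (7 * ‖η‖) ^ 2 := by gcongr
  have := norm_nonneg η
  have h1 : k ^ 2 + (7 * ‖η‖) ^ 2 ≤ (k + 7 * ‖η‖) ^ 2 := by nlinarith [mul_nonneg hk this]
  have h2 : (k + 7 * ‖η‖) ^ 2 ≤ ((k + 7) * (1 + ‖η‖)) ^ 2 := by
    gcongr
    nlinarith [mul_nonneg hk this]
  linarith

/-- The `H^{1/2}` norm is controlled by the symbol, as `φ̂` cannot concentrate on the annulus. -/
lemma halfNorm_sq_le (hn : n = 2 ∨ n = 3) (hne : (Γ : Set (Hyper n)).Nonempty)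
    (hΓ : Bornology.IsBounded (Γ : Set (Hyper n))) (hk : 0 < k) {δ : ℝ} (hδ : 0 < δ)
    (hδ' : δ ≤ 1 / 2) (hδL : δ * (k * Metric.diam (Γ : Set (Hyper n))) ≤ 1 / 24) (φ : HTilde Γ) :
    √δ * halfNorm k (φ : L2 n) ^ 2 ≤
      70 * ∫ η, ‖symb k η‖ * ‖(𝓕 (φ : L2 n) : L2 n) η‖ ^ 2 := by
  have hf := HTilde.integrable_fourier_sq φ
  have hmain := setIntegral_annulus_le hn hne hΓ hk hδ hδ' hδL φ
  have hsy := integrable_symb_mul hk.le φ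
  set f : Hyper n → ℝ := fun η => ‖(𝓕 (φ : L2 n) : L2 n) η‖ ^ 2
  have hf0 : ∀ η, 0 ≤ f η := fun η => by positivity
  set A := annulus n k δ
  have hA : MeasurableSet A := measurableSet_annulus n k δ
  set w : Hyper n → ℝ := fun η => √(k ^ 2 + (2 * Real.pi * ‖η‖) ^ 2)
  have hw : halfNorm k (φ : L2 n) ^ 2 = ∫ η, f η * w η := by
    rw [halfNorm_sq_eq]
    simp only [f, w, Real.sqrt_eq_rpow]
  have hwi : Integrable fun η => f η * w η := by
    refine ((HTilde.posHalf φ).2.const_mul (k + 7)).mono' (hf.1.mul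
      (by fun_prop : Continuous w).aestronglyMeasurable) (.of_forall fun η => ?_)
    rw [Real.norm_of_nonneg (by positivity)]
    have := mul_le_mul_of_nonneg_left (sqrt_weight_le hk.le η) (hf0 η)
    linarith
  have hin : ∫ η in A, f η * w η ≤ 2 * k * ∫ η in A, f η := by
    rw [← integral_const_mul]
    refine setIntegral_mono_on hwi.integrableOn (hf.const_mul _).integrableOn hA fun η hη => ?_
    have h1 := (abs_lt.1 (show |2 * Real.pi * ‖η‖ - k| < δ * k from hη)).2
    have h2 : 2 * Real.pi * ‖η‖ ≤ 3 / 2 * k := by nlinarith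
    have h3 : w η ≤ 2 * k := by
      refine Real.sqrt_le_iff.2 ⟨by positivity, ?_⟩
      have : (2 * Real.pi * ‖η‖) ^ 2 ≤ (3 / 2 * k) ^ 2 := by gcongr
      nlinarith
    rw [mul_comm]
    exact mul_le_mul_of_nonneg_right h3 (hf0 η)
  have hout : k * ∫ η in Aᶜ, f η ≤ ∫ η in Aᶜ, f η * w η := by
    rw [← integral_const_mul]
    refine setIntegral_mono_on (hf.const_mul _).integrableOn hwi.integrableOn hA.compl fun η _ => ?_
    rw [mul_comm]
    refine mul_le_mul_of_nonneg_left (Real.le_sqrt_of_sq_le ?_) (hf0 η)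
    linarith [sq_nonneg (2 * Real.pi * ‖η‖)]
  have hsymb : √δ * ∫ η in Aᶜ, f η * w η ≤ 2 * ∫ η, ‖symb k η‖ * f η := by
    rw [← integral_const_mul, ← integral_const_mul]
    calc ∫ η in Aᶜ, √δ * (f η * w η) ≤ ∫ η in Aᶜ, 2 * (‖symb k η‖ * f η) := by
          refine setIntegral_mono_on (hwi.const_mul _).integrableOn (hsy.const_mul _).integrableOn
            hA.compl fun η hη => ?_
          have h1 := weight_le_of_notMem_annulus hk hδ hδ' (t := 2 * Real.pi * ‖η‖) (by positivity)
            (not_lt.1 hη)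
          have h2 : √δ * w η ≤ 2 * ‖symb k η‖ := by
            rw [symb, norm_sqrtSymb, ← Real.sqrt_mul hδ.le]
            refine (Real.sqrt_le_sqrt h1).trans_eq ?_
            rw [Real.sqrt_mul (by norm_num), show (4 : ℝ) = 2 ^ 2 by norm_num,
              Real.sqrt_sq (by norm_num)]
          nlinarith [hf0 η]
      _ ≤ _ := setIntegral_le_integral (hsy.const_mul _) (.of_forall fun η => by
          have := hf0 η
          positivity)
  rw [hw, ← integral_add_compl hA hwi]
  have h17 : k * ∫ η in A, f η ≤ 17 * ∫ η in Aᶜ, f η * w η := by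
    have := mul_le_mul_of_nonneg_left hmain hk.le
    linarith
  have h35 : (∫ η in A, f η * w η) + ∫ η in Aᶜ, f η * w η ≤ 35 * ∫ η in Aᶜ, f η * w η := by
    linarith
  have := mul_le_mul_of_nonneg_left h35 (Real.sqrt_nonneg δ)
  linarith

/-- The real and the imaginary part of the symbol have constant signs. -/
lemma integral_symb_le_norm_hyperForm (hk : 0 ≤ k) (φ : HTilde Γ) :
    ∫ η, ‖symb k η‖ * ‖(𝓕 (φ : L2 n) : L2 n) η‖ ^ 2 ≤ 4 * ‖hyperForm hk Γ φ φ‖ := by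
  have hi := ((HTilde.posHalf φ).negHalf_hyperDensity hk).integrable_mul_conj (HTilde.posHalf φ)
  have hval : hyperForm hk Γ φ φ = ∫ η, hyperDensity k (φ : L2 n) η *
    conj ((𝓕 (φ : L2 n) : L2 n) η) := rfl
  have hpt : ∀ η, hyperDensity k (φ : L2 n) η * conj ((𝓕 (φ : L2 n) : L2 n) η) =
      ((1 / 2 * ‖(𝓕 (φ : L2 n) : L2 n) η‖ ^ 2 : ℝ) : ℂ) * symb k η := by
    intro η
    rw [hyperDensity, mul_assoc, Complex.mul_conj, Complex.normSq_eq_norm_sq]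
    push_cast
    ring
  have hre : (hyperForm hk Γ φ φ).re = ∫ η, 1 / 2 * ‖(𝓕 (φ : L2 n) : L2 n) η‖ ^ 2 *
      (symb k η).re := by
    rw [hval]
    refine (Complex.reCLM.integral_comp_comm hi).symm.trans (integral_congr_ae (.of_forall fun η => ?_))
    simp only [reCLM_apply]
    rw [hpt, re_ofReal_mul]
  have him : (hyperForm hk Γ φ φ).im = ∫ η, 1 / 2 * ‖(𝓕 (φ : L2 n) : L2 n) η‖ ^ 2 *
      (symb k η).im := by
    rw [hval]
    refine (Complex.imCLM.integral_comp_comm hi).symm.trans (integral_congr_ae (.of_forall fun η => ?_))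
    simp only [imCLM_apply]
    rw [hpt, im_ofReal_mul]
  have hrei : Integrable fun η => 1 / 2 * ‖(𝓕 (φ : L2 n) : L2 n) η‖ ^ 2 * (symb k η).re := by
    refine (Complex.reCLM.integrable_comp hi).congr (.of_forall fun η => ?_)
    simp only [reCLM_apply]
    rw [hpt, re_ofReal_mul]
  have himi : Integrable fun η => 1 / 2 * ‖(𝓕 (φ : L2 n) : L2 n) η‖ ^ 2 * (symb k η).im := by
    refine (Complex.imCLM.integrable_comp hi).congr (.of_forall fun η => ?_)
    simp only [imCLM_apply]
    rw [hpt, im_ofReal_mul]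
  have hnorm : ∀ η : Hyper n, ‖symb k η‖ ≤ (symb k η).im - (symb k η).re := by
    intro η
    have h := Complex.norm_le_abs_re_add_abs_im (symb k η)
    rw [abs_of_nonpos (re_symb_nonpos k η), abs_of_nonneg (a := (symb k η).im)
      (by rw [symb, sqrtSymb_im]; positivity)] at h
    linarith
  calc ∫ η, ‖symb k η‖ * ‖(𝓕 (φ : L2 n) : L2 n) η‖ ^ 2
      ≤ ∫ η, 2 * (1 / 2 * ‖(𝓕 (φ : L2 n) : L2 n) η‖ ^ 2 * (symb k η).im -
          1 / 2 * ‖(𝓕 (φ : L2 n) : L2 n) η‖ ^ 2 * (symb k η).re) := by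
        refine integral_mono (integrable_symb_mul hk φ) ((himi.sub hrei).const_mul 2) fun η => ?_
        have := mul_le_mul_of_nonneg_right (hnorm η) (sq_nonneg ‖(𝓕 (φ : L2 n) : L2 n) η‖)
        simp only
        linarith
    _ = 2 * ((hyperForm hk Γ φ φ).im - (hyperForm hk Γ φ φ).re) := by
        rw [integral_const_mul, integral_sub himi hrei, him, hre]
    _ ≤ _ := by
        have h1 := Complex.abs_re_le_norm (hyperForm hk Γ φ φ)
        have h2 := Complex.abs_im_le_norm (hyperForm hk Γ φ φ)
        linarith [neg_abs_le (hyperForm hk Γ φ φ).re, le_abs_self (hyperForm hk Γ φ φ).im]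

/-- Coercivity with the exponent `-1/2`, in both dimensions. -/
lemma hyperForm_coercive {c₀ : ℝ} (hc₀ : 0 < c₀) (hn : n = 2 ∨ n = 3)
    (hne : (Γ : Set (Hyper n)).Nonempty) (hΓ : Bornology.IsBounded (Γ : Set (Hyper n)))
    (hk : 0 < k) (hkL : c₀ ≤ k * Metric.diam (Γ : Set (Hyper n))) (φ : HTilde Γ) :
    √(min (c₀ / 2) (1 / 24)) / 280 * (k * Metric.diam (Γ : Set (Hyper n))) ^ (-1 / 2 : ℝ) *
      halfNorm k (φ : L2 n) ^ 2 ≤ ‖hyperForm hk.le Γ φ φ‖ := by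
  set κ := k * Metric.diam (Γ : Set (Hyper n))
  have hκ : 0 < κ := hc₀.trans_le hkL
  set δ₀ := min (c₀ / 2) (1 / 24)
  have hδ₀ : 0 < δ₀ := lt_min (by positivity) (by norm_num)
  have h1 := halfNorm_sq_le hn hne hΓ hk (δ := δ₀ / κ) (by positivity) (by
    rw [div_le_iff₀ hκ]
    linarith [min_le_left (c₀ / 2) (1 / 24)]) (by
    rw [div_mul_cancel₀ _ hκ.ne']
    exact min_le_right _ _) φ
  have h2 := integral_symb_le_norm_hyperForm hk.le φ
  have e : √(δ₀ / κ) = √δ₀ * κ ^ (-1 / 2 : ℝ) := by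
    rw [Real.sqrt_div hδ₀.le, div_eq_mul_inv, Real.sqrt_eq_rpow κ, ← Real.rpow_neg hκ.le]
    norm_num
  rw [e] at h1
  linarith

end Coercivity

end

end PlanarScreen

theorem theorem1p9 (c₀ : ℝ) (hc₀ : 0 < c₀) :
    ∃ C : ℝ, 0 < C ∧
      ∀ n : ℕ, n = 2 ∨ n = 3 →
      ∀ Γ : TopologicalSpace.Opens (PlanarScreen.Hyper n),
        (Γ : Set (PlanarScreen.Hyper n)).Nonempty →
        Bornology.IsBounded (Γ : Set (PlanarScreen.Hyper n)) →
      ∀ k : ℝ, 0 < k →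
        ∃ a : PlanarScreen.HTilde Γ →ₗ[ℂ] PlanarScreen.HTilde Γ →ₗ⋆[ℂ] ℂ,
          PlanarScreen.IsHypersingularForm k Γ a ∧
          (∀ a', PlanarScreen.IsHypersingularForm k Γ a' → a' = a) ∧
          (c₀ ≤ k * Metric.diam (Γ : Set (PlanarScreen.Hyper n)) →
            ∀ φ : PlanarScreen.HTilde Γ,
              C * (k * Metric.diam (Γ : Set (PlanarScreen.Hyper n))) ^
                  PlanarScreen.coercivityExponent n *
                PlanarScreen.halfNorm k (φ : PlanarScreen.L2 n) ^ 2 ≤ ‖a φ φ‖) := by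
  set K := √(min (c₀ / 2) (1 / 24)) / 280
  have hK : 0 < K := div_pos (Real.sqrt_pos.2 (lt_min (by positivity) (by norm_num))) (by norm_num)
  have hc₁ : 0 < c₀ ^ (1 / 6 : ℝ) := Real.rpow_pos_of_pos hc₀ _
  refine ⟨K * min 1 (c₀ ^ (1 / 6 : ℝ)), mul_pos hK (lt_min one_pos hc₁), ?_⟩
  intro n hn Γ hne hΓ k hk
  refine ⟨PlanarScreen.hyperForm hk.le Γ, PlanarScreen.isHypersingularForm_hyperForm hn hk hΓ,
    fun a' ha' => ha'.eq_hyperForm hn hk hΓ, fun hkL φ => ?_⟩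
  refine le_trans ?_ (PlanarScreen.hyperForm_coercive hc₀ hn hne hΓ hk hkL φ)
  set κ := k * Metric.diam (Γ : Set (PlanarScreen.Hyper n))
  have hκ : 0 < κ := hc₀.trans_le hkL
  refine mul_le_mul_of_nonneg_right ?_ (sq_nonneg _)
  rw [mul_assoc]
  refine mul_le_mul_of_nonneg_left ?_ hK.le
  -- for `n = 3` the stronger exponent `-1/2` is used, as `κ^{-2/3} ≤ c₀^{-1/6} κ^{-1/2}`
  rcases hn with rfl | rfl
  · rw [PlanarScreen.coercivityExponent, if_neg (by norm_num)]
    exact mul_le_of_le_one_left (Real.rpow_nonneg hκ.le _) (min_le_left _ _)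
  · rw [PlanarScreen.coercivityExponent, if_pos rfl]
    calc min 1 (c₀ ^ (1 / 6 : ℝ)) * κ ^ (-2 / 3 : ℝ) ≤ κ ^ (1 / 6 : ℝ) * κ ^ (-2 / 3 : ℝ) := by
          gcongr
          exact (min_le_right _ _).trans (Real.rpow_le_rpow hc₀.le hkL (by norm_num))
      _ = κ ^ (-1 / 2 : ℝ) := by rw [← Real.rpow_add hκ]; norm_num
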